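/- A nice path decomposition of a finite simple graph $G$ is a path decomposition of $G$ with bags $B_1,\dots,B_\ell$, from left to right, in which $B_1=B_\ell=\emptyset$ and every internal node $i$ is labelled as one of the following: it introduces a vertex $v\notin B_{i-1}$, so that $B_i=B_{i-1}\cup\{v\}$; or it introduces an edge $\{u,v\}\in E(G)$, where $u,v\in B_i=B_{i-1}$; or it forgets a vertex $v\in B_{i-1}$, so that $B_i=B_{i-1}\setminus\{v\}$. Every edge of $G$ is introduced (at least once). Let $E_i$ be the set of edges introduced at nodes $j\le i$, let $d(v)$ be the degree of $v$ in $G$, and let $d_{E_i}(v)$ be the number of edges of $E_i$ incident to $v$. Theorem. For every constant $c\in\mathbb N$ there is a Monte Carlo algorithm (a program for a coin-flipping random access machine with logarithmic cost) that, given $q\in\mathbb N$, a graph $G$ and a nice path decomposition $B_1,\dots,B_\ell$ of $G$, decides whether $G$ has a proper $q$-coloring, with the following properties, where $N$ denotes the size of the input in bits. (1) For all outcomes of the coin flips it halts with an answer within time $$\mathcal O\Bigl(N^{\mathcal O(1)}\cdot\max_{i}\prod_{v\in B_i}\bigl(\min\{d_{E_i}(v),\,d(v)-d_{E_i}(v)\}+1\bigr)\Bigr),$$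 where the constants hidden in both $\mathcal O$'s depend only on $c$ (in particular not on $q$). (2) It never gives a false positive: if it answers yes, for any outcome of the coin flips, then $G$ has a proper $q$-coloring. (3) It answers correctly with high probability: on every input the probability that it does not answer correctly is at most $2^{-N^{c}}$. -/

import Mathlib

open MeasureTheory
open scoped ENNReal

/-! ### A randomized random access machine with logarithmic cost

The machine stores integers in registers and in memory banks. Its programs are built from assignments,
stores, coin flips, sequential composition, conditionals and loops; a program mentions only
finitely many registers and banks. Every operation is charged the total bit length of the integers
(addresses included) that it handles. -/

namespace RAM

/-- The bit length of an integer. -/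
def bitLen (z : ℤ) : ℕ := Nat.size z.natAbs

/-- The memory of the machine: `reg x` is the content of register `x`, `bank a i` is the content of
the cell with address `i` of bank `a`, and `used` is the number of coins flipped so far. -/
structure State where
  reg : ℕ → ℤ
  bank : ℕ → ℤ → ℤ
  used : ℕ

/-- The arithmetic operations and comparisons of the machine. -/
inductive Op
  | add | sub | mul | div | mod | eq | lt

/-- The result of an operation. Division is integer division (with value `0` for the divisor `0`),
a comparison has the value `1` (true) or `0` (false). -/
def Op.apply : Op → ℤ → ℤ → ℤ
  | .add, x, y => x + y
  | .sub, x, y => x - y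
  | .mul, x, y => x * y
  | .div, x, y => x / y
  | .mod, x, y => x % y
  | .eq, x, y => if x = y then 1 else 0
  | .lt, x, y => if x < y then 1 else 0

/-- Expressions: constants, registers, memory cells with a computed address, and operations. -/
inductive Expr
  | const (z : ℤ)
  | reg (x : ℕ)
  | cell (a : ℕ) (i : Expr)
  | op (o : Op) (e₁ e₂ : Expr)

/-- The value of an expression. -/
def Expr.val (s : State) : Expr → ℤ
  | .const z => z
  | .reg x => s.reg x
  | .cell a i => s.bank a (i.val s)
  | .op o e₁ e₂ => o.apply (e₁.val s) (e₂.val s)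

/-- The (logarithmic) cost of evaluating an expression. -/
def Expr.cost (s : State) : Expr → ℕ
  | .const z => 1 + bitLen z
  | .reg x => 1 + bitLen (s.reg x)
  | .cell a i => i.cost s + (1 + bitLen (i.val s) + bitLen (s.bank a (i.val s)))
  | .op _ e₁ e₂ => e₁.cost s + e₂.cost s + (1 + bitLen (e₁.val s) + bitLen (e₂.val s))

/-- Programs. -/
inductive Program
  | skip
  | assign (x : ℕ) (e : Expr)
  | store (a : ℕ) (i e : Expr)
  | flip (x : ℕ)
  | seq (c₁ c₂ : Program)
  | ite (e : Expr) (c₁ c₂ : Program)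
  | loop (e : Expr) (c : Program)

/-- Set register `x` to `z`. -/
def State.setReg (s : State) (x : ℕ) (z : ℤ) : State :=
  { s with reg := Function.update s.reg x z }

/-- Set the cell with address `i` of bank `a` to `z`. -/
def State.setCell (s : State) (a : ℕ) (i z : ℤ) : State :=
  { s with bank := Function.update s.bank a (Function.update (s.bank a) i z) }

/-- Put the next coin of the coin sequence `ρ` into register `x`. -/
def State.flipCoin (ρ : ℕ → Bool) (s : State) (x : ℕ) : State :=
  { reg := Function.update s.reg x (if ρ s.used then 1 else 0)
    bank := s.bank
    used := s.used + 1 }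

/-- `Exec ρ c s t s'`: with the coin sequence `ρ`, the program `c` started in the state `s` halts in
the state `s'` at total cost `t`. A test succeeds if its value is not `0`. -/
inductive Exec (ρ : ℕ → Bool) : Program → State → ℕ → State → Prop
  | skip (s : State) : Exec ρ .skip s 1 s
  | assign (s : State) (x : ℕ) (e : Expr) :
      Exec ρ (.assign x e) s (e.cost s + (1 + bitLen (e.val s))) (s.setReg x (e.val s))
  | store (s : State) (a : ℕ) (i e : Expr) :
      Exec ρ (.store a i e) s (i.cost s + e.cost s + (1 + bitLen (i.val s) + bitLen (e.val s)))
        (s.setCell a (i.val s) (e.val s))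
  | flip (s : State) (x : ℕ) : Exec ρ (.flip x) s 1 (s.flipCoin ρ x)
  | seq {c₁ c₂ : Program} {s s₁ s₂ : State} {t₁ t₂ : ℕ} :
      Exec ρ c₁ s t₁ s₁ → Exec ρ c₂ s₁ t₂ s₂ → Exec ρ (.seq c₁ c₂) s (t₁ + t₂) s₂
  | ite_true {e : Expr} {c₁ c₂ : Program} {s s' : State} {t : ℕ} :
      e.val s ≠ 0 → Exec ρ c₁ s t s' → Exec ρ (.ite e c₁ c₂) s (e.cost s + 1 + t) s'
  | ite_false {e : Expr} {c₁ c₂ : Program} {s s' : State} {t : ℕ} :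
      e.val s = 0 → Exec ρ c₂ s t s' → Exec ρ (.ite e c₁ c₂) s (e.cost s + 1 + t) s'
  | loop_true {e : Expr} {c : Program} {s s₁ s₂ : State} {t₁ t₂ : ℕ} :
      e.val s ≠ 0 → Exec ρ c s t₁ s₁ → Exec ρ (.loop e c) s₁ t₂ s₂ →
        Exec ρ (.loop e c) s (e.cost s + 1 + t₁ + t₂) s₂
  | loop_false {e : Expr} {c : Program} {s : State} :
      e.val s = 0 → Exec ρ (.loop e c) s (e.cost s + 1) s

/-- The initial state: the input is written in the cells `0, 1, 2, …` of bank `0`, and everything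
else is `0`. -/
def start (input : List ℕ) : State where
  reg := fun _ => 0
  bank := fun a i => if a = 0 ∧ 0 ≤ i then ((input.getD i.toNat 0 : ℕ) : ℤ) else 0
  used := 0

/-- With the coin sequence `ρ`, the program `P` halts on `input` at total cost `t` and gives the answer
`b`, which is read off register `0` (`1` means yes, `0` means no). -/
def Answers (P : Program) (input : List ℕ) (ρ : ℕ → Bool) (t : ℕ) (b : Bool) : Prop :=
  ∃ s, Exec ρ P (start input) t s ∧ s.reg 0 = if b then 1 else 0

/-- The size of an input in bits (with one separator for every number). -/
def inputSize (input : List ℕ) : ℕ := (input.map fun a => Nat.size a + 1).sum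

/-- The law of an infinite sequence of independent fair coins. -/
noncomputable def coins : Measure (ℕ → Bool) :=
  Measure.infinitePi fun _ => (PMF.uniformOfFintype Bool).toMeasure

end RAM

/-! ### Nice path decompositions -/

/-- A path decomposition of `G`; the nodes of the path are `0, …, len - 1`, from left to right. -/
structure PathDecomposition {n : ℕ} (G : SimpleGraph (Fin n)) where
  len : ℕ
  len_pos : 0 < len
  bag : Fin len → Finset (Fin n)
  cover : ∀ v, ∃ i, v ∈ bag i
  cover_edge : ∀ u v, G.Adj u v → ∃ i, u ∈ bag i ∧ v ∈ bag i
  convex : ∀ i j k : Fin len, i ≤ j → j ≤ k → ∀ v, v ∈ bag i → v ∈ bag k → v ∈ bag j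

/-- The types of the nodes of a nice path decomposition; `endpoint` stands for the leftmost and for
the rightmost node. -/
inductive NodeKind (n : ℕ)
  | endpoint
  | introVertex (v : Fin n)
  | introEdge (u v : Fin n)
  | forget (v : Fin n)

/-- A nice path decomposition: the leftmost and the rightmost bag are empty, and every internal node
introduces a vertex, introduces an edge or forgets a vertex. Every edge of `G` is introduced. -/
structure NicePathDecomposition {n : ℕ} (G : SimpleGraph (Fin n)) extends PathDecomposition G where
  kind : Fin len → NodeKind n
  kind_valid : ∀ i : Fin len,
    match kind i with
    | .endpoint => (i.val = 0 ∨ i.val + 1 = len) ∧ bag i = ∅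
    | .introVertex v => i.val + 1 < len ∧
        ∃ p : Fin len, p.val + 1 = i.val ∧ v ∉ bag p ∧ bag i = insert v (bag p)
    | .introEdge u v => i.val + 1 < len ∧
        ∃ p : Fin len, p.val + 1 = i.val ∧ G.Adj u v ∧ u ∈ bag p ∧ v ∈ bag p ∧ bag i = bag p
    | .forget v => i.val + 1 < len ∧
        ∃ p : Fin len, p.val + 1 = i.val ∧ v ∈ bag p ∧ bag i = (bag p).erase v
  edge_introduced : ∀ u v, G.Adj u v → ∃ i, kind i = .introEdge u v ∨ kind i = .introEdge v u

namespace NicePathDecomposition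

variable {n : ℕ} {G : SimpleGraph (Fin n)}

open Classical in
/-- The set `E_i` of the edges that are introduced at node `i` or at a node to the left of it. -/
noncomputable def introduced (D : NicePathDecomposition G) (i : Fin D.len) :
    Finset (Sym2 (Fin n)) :=
  Finset.univ.filter fun e => ∃ j ≤ i, ∃ u v, D.kind j = .introEdge u v ∧ e = s(u, v)

open Classical in
/-- The number `d_{E_i}(v)` of the edges in `E_i` that are incident to `v`. -/
noncomputable def introducedDegree (D : NicePathDecomposition G) (i : Fin D.len) (v : Fin n) : ℕ :=
  ((D.introduced i).filter fun e => v ∈ e).card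

open Classical in
/-- The maximum over all nodes `i` of `∏_{v ∈ B_i} (min {d_{E_i}(v), d(v) - d_{E_i}(v)} + 1)`. -/
noncomputable def tableSize (D : NicePathDecomposition G) : ℕ :=
  Finset.univ.sup fun i : Fin D.len =>
    ∏ v ∈ D.bag i, (min (D.introducedDegree i v) (G.degree v - D.introducedDegree i v) + 1)

end NicePathDecomposition

/-! ### The inputs of the algorithm -/

/-- The label of a node, as a list of numbers. -/
def NodeKind.encode {n : ℕ} : NodeKind n → List ℕ
  | .endpoint => [0, 0, 0]
  | .introVertex v => [1, v, 0]
  | .introEdge u v => [2, u, v]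
  | .forget v => [3, v, 0]

open Classical in
/-- The input consists of `n`, `q`, the adjacency matrix of `G`, row by row, the number of nodes of the
decomposition and then, for each node from left to right, its label and the indicator vector of
its bag. -/
noncomputable def encodeInput {n : ℕ} (q : ℕ) (G : SimpleGraph (Fin n))
    (D : NicePathDecomposition G) : List ℕ :=
  [n, q]
    ++ (List.finRange n).flatMap
        (fun u => (List.finRange n).map fun v => if G.Adj u v then 1 else 0)
    ++ [D.len]
    ++ (List.finRange D.len).flatMap
        (fun i => (D.kind i).encode
          ++ (List.finRange n).map fun v => if v ∈ D.bag i then 1 else 0)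

/-!
For an orientation `E` of the edges, let `∏_{(u, v) ∈ E} (x_u - x_v)` be the graph polynomial. A
map `x : V → {0, …, q - 1}` is a proper coloring exactly when the polynomial does not vanish at
`x`. If there are at least as many colors as vertices the answer is yes, and if there are vertices
but no colors it is no. Otherwise the program draws a random weight `y_v` for every vertex `v` and
computes the sum `∑ₓ (∏_v y_v ^ x_v) ∏_{(u, v) ∈ E} (x_u - x_v)` over all `x` (isolated vertices
are fixed to the color `0`). It answers yes if the sum is not `0`. A nonzero sum has a nonzero
summand, hence a yes is always right (`colorable_of_table_ne_zero`). If there is a proper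
coloring, the sum is the value at `y` of a polynomial with a nonzero coefficient
(`genPoly_ne_zero`), and by the Schwartz–Zippel lemma random weights with enough bits are a zero
of it only with small probability (`coins_eval_eq_zero_le`).

The sum is computed by a dynamic program over the edges in the order of their introduction. Expand
the product over the edges introduced so far into monomials `∏_v x_v ^ m_v`; the exponent `m_v` is
at most the current degree `k_v` of `v`, and the remaining edges contribute an exponent of at most
`d_v - k_v`. While `2 k_v ≤ d_v`, the table is indexed by the exponent `m_v`. After that it is
indexed by the exponent `e_v` still to come, and its entry contains the power sum
`∑_{x < q} y_v ^ x * x ^ (m_v + e_v)` in place of the monomial `x_v ^ m_v` (`kernel`, `table`).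
Thus each vertex contributes `min k_v (d_v - k_v) + 1` indices. A new edge `(u, v)` changes the
indices at `u` and `v` only, and every entry of the new table is a combination of entries of the
old one over all indices at `u` and `v` (`table_cons`). At the end `k_v = d_v` for all `v`, and
the only entry is the sum above (`table_zero`).

Nodes that introduce or forget a vertex do nothing: a vertex outside the current bag has had none
or all of its edges introduced, so it contributes a factor `1` to the size of the table
(`prod_radix_le_tableSize`). An edge that is introduced repeatedly is processed only once. The
tables are never erased. The entries of the `i`-th table are written to addresses with the leading
digit `i`, so that every cell is written at most once. The correctness and the cost of the program
are derived together in a program logic (`Runs`), which bounds the bit length of all numbers in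
memory, so that the logarithmic cost is the number of steps times that bound, up to a constant.
-/

/-! ### A program logic for the machine -/

namespace RAM

theorem bitLen_le_iff {z : ℤ} {W : ℕ} : bitLen z ≤ W ↔ z.natAbs < 2 ^ W := Nat.size_le

theorem natAbs_lt_two_pow_bitLen (z : ℤ) : z.natAbs < 2 ^ bitLen z := Nat.lt_size_self _

theorem bitLen_natCast_le {k W : ℕ} (h : k < 2 ^ W) : bitLen (k : ℤ) ≤ W := by
  rw [bitLen_le_iff]; simpa using h

theorem bitLen_le_natAbs (z : ℤ) : bitLen z ≤ z.natAbs :=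
  bitLen_le_iff.2 Nat.lt_two_pow_self

theorem bitLen_apply_le (o : Op) (x y : ℤ) : bitLen (o.apply x y) ≤ bitLen x + bitLen y + 1 := by
  have hx := natAbs_lt_two_pow_bitLen x
  have hy := natAbs_lt_two_pow_bitLen y
  rw [bitLen_le_iff]
  set a := bitLen x
  set b := bitLen y
  have ha : 2 ^ a ≤ 2 ^ (a + b) := Nat.pow_le_pow_right (by norm_num) (by omega)
  have hb : 2 ^ b ≤ 2 ^ (a + b) := Nat.pow_le_pow_right (by norm_num) (by omega)
  have hab : 2 ^ (a + b + 1) = 2 ^ (a + b) + 2 ^ (a + b) := by ring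
  have h1 : 1 ≤ 2 ^ (a + b) := Nat.one_le_two_pow
  cases o with
  | add => simp only [Op.apply]; omega
  | sub => simp only [Op.apply]; omega
  | mul =>
    simp only [Op.apply, Int.natAbs_mul]
    calc x.natAbs * y.natAbs < 2 ^ a * 2 ^ b := Nat.mul_lt_mul'' hx hy
      _ ≤ _ := by rw [← pow_add]; omega
  | div =>
    have := Int.natAbs_ediv_le_natAbs x y
    simp only [Op.apply]; omega
  | mod =>
    simp only [Op.apply]
    rcases eq_or_ne y 0 with rfl | h
    · simp only [Int.emod_zero]; omega
    · have h2 := Int.emod_nonneg x h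
      have h3 := Int.emod_lt x h
      omega
  | eq => simp only [Op.apply]; split_ifs <;> simp
  | lt => simp only [Op.apply]; split_ifs <;> simp

/-- All registers and all memory cells hold integers of at most `W` bits. -/
structure State.Bounded (W : ℕ) (s : State) : Prop where
  reg : ∀ r, bitLen (s.reg r) ≤ W
  bank : ∀ a i, bitLen (s.bank a i) ≤ W

/-- The number of nodes of an expression, a constant `z` being counted `|z|` more times, so that it
also bounds the bit length of the constants. -/
def Expr.size : Expr → ℕ
  | .const z => 1 + z.natAbs
  | .reg _ => 1
  | .cell _ i => i.size + 1
  | .op _ e₁ e₂ => e₁.size + e₂.size + 1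

theorem Expr.bitLen_val_le {W : ℕ} {s : State} (hs : s.Bounded W) (e : Expr) :
    bitLen (e.val s) ≤ e.size * (W + 1) := by
  induction e with
  | const z =>
    have := bitLen_le_natAbs z
    simp only [Expr.val, Expr.size]; nlinarith
  | reg x => have := hs.reg x; simp only [Expr.val, Expr.size]; omega
  | cell a i ih => have := hs.bank a (i.val s); simp only [Expr.val, Expr.size]; nlinarith
  | op o e f he hf =>
    have := bitLen_apply_le o (e.val s) (f.val s)
    simp only [Expr.val, Expr.size]; nlinarith

theorem Expr.cost_le {W : ℕ} {s : State} (hs : s.Bounded W) (e : Expr) :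
    e.cost s ≤ e.size ^ 2 * (W + 1) := by
  induction e with
  | const z =>
    have := bitLen_le_natAbs z
    simp only [Expr.cost, Expr.size]; nlinarith [Nat.zero_le (z.natAbs ^ 2)]
  | reg x => have := hs.reg x; simp only [Expr.cost, Expr.size]; omega
  | cell a i ih =>
    have := hs.bank a (i.val s)
    have := i.bitLen_val_le hs
    simp only [Expr.cost, Expr.size]; nlinarith
  | op o e f he hf =>
    have h1 := e.bitLen_val_le hs
    have h2 := f.bitLen_val_le hs
    simp only [Expr.cost, Expr.size]
    nlinarith [Nat.zero_le (e.size * f.size * (W + 1)), Nat.zero_le (e.size * (W + 1)),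
      Nat.zero_le (f.size * (W + 1))]

/-- Whether a program may change register `r`. -/
def Program.writes (r : ℕ) : Program → Bool
  | .skip => false
  | .assign x _ => r == x
  | .store _ _ _ => false
  | .flip x => r == x
  | .seq c₁ c₂ => c₁.writes r || c₂.writes r
  | .ite _ c₁ c₂ => c₁.writes r || c₂.writes r
  | .loop _ c => c.writes r

/-- Whether a program may change bank `a`. -/
def Program.stores (a : ℕ) : Program → Bool
  | .skip => false
  | .assign _ _ => false
  | .store b _ _ => a == b
  | .flip _ => false
  | .seq c₁ c₂ => c₁.stores a || c₂.stores a
  | .ite _ c₁ c₂ => c₁.stores a || c₂.stores a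
  | .loop _ c => c.stores a

/-- Whether a program may flip a coin. -/
def Program.flips : Program → Bool
  | .skip => false
  | .assign _ _ => false
  | .store _ _ _ => false
  | .flip _ => true
  | .seq c₁ c₂ => c₁.flips || c₂.flips
  | .ite _ c₁ c₂ => c₁.flips || c₂.flips
  | .loop _ c => c.flips

/-- `s'` differs from `s` only in what the program `c` may change. -/
structure Frame (c : Program) (s s' : State) : Prop where
  reg : ∀ r, c.writes r = false → s'.reg r = s.reg r
  bank : ∀ a, c.stores a = false → s'.bank a = s.bank a
  used : c.flips = false → s'.used = s.used

theorem Frame.refl (c : Program) (s : State) : Frame c s s :=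
  ⟨fun _ _ => rfl, fun _ _ => rfl, fun _ => rfl⟩

theorem Frame.trans {c : Program} {s s' s'' : State} (h : Frame c s s') (h' : Frame c s' s'') :
    Frame c s s'' :=
  ⟨fun r hr => (h'.reg r hr).trans (h.reg r hr), fun a ha => (h'.bank a ha).trans (h.bank a ha),
    fun hu => (h'.used hu).trans (h.used hu)⟩

/-- A program changes only what occurs in it as the target of an assignment, a store or a flip. -/
theorem Exec.frame {ρ : ℕ → Bool} {c : Program} {s s' : State} {t : ℕ} (h : Exec ρ c s t s') :
    Frame c s s' := by
  induction h with
  | skip s => exact Frame.refl _ _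
  | assign s x e =>
    refine ⟨fun r hr => ?_, fun _ _ => rfl, fun _ => rfl⟩
    have : r ≠ x := by simpa [Program.writes] using hr
    simp [State.setReg, this]
  | store s a i e =>
    refine ⟨fun _ _ => rfl, fun b hb => ?_, fun _ => rfl⟩
    have : b ≠ a := by simpa [Program.stores] using hb
    simp [State.setCell, this]
  | flip s x =>
    refine ⟨fun r hr => ?_, fun _ _ => rfl, fun hu => by simp [Program.flips] at hu⟩
    have : r ≠ x := by simpa [Program.writes] using hr
    simp [State.flipCoin, this]
  | seq _ _ h₁ h₂ =>
    refine ⟨fun r hr => ?_, fun a ha => ?_, fun hu => ?_⟩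
    · simp only [Program.writes, Bool.or_eq_false_iff] at hr
      rw [h₂.reg r hr.2, h₁.reg r hr.1]
    · simp only [Program.stores, Bool.or_eq_false_iff] at ha
      rw [h₂.bank a ha.2, h₁.bank a ha.1]
    · simp only [Program.flips, Bool.or_eq_false_iff] at hu
      rw [h₂.used hu.2, h₁.used hu.1]
  | ite_true _ _ h =>
    refine ⟨fun r hr => ?_, fun a ha => ?_, fun hu => ?_⟩
    · simp only [Program.writes, Bool.or_eq_false_iff] at hr; exact h.reg r hr.1
    · simp only [Program.stores, Bool.or_eq_false_iff] at ha; exact h.bank a ha.1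
    · simp only [Program.flips, Bool.or_eq_false_iff] at hu; exact h.used hu.1
  | ite_false _ _ h =>
    refine ⟨fun r hr => ?_, fun a ha => ?_, fun hu => ?_⟩
    · simp only [Program.writes, Bool.or_eq_false_iff] at hr; exact h.reg r hr.2
    · simp only [Program.stores, Bool.or_eq_false_iff] at ha; exact h.bank a ha.2
    · simp only [Program.flips, Bool.or_eq_false_iff] at hu; exact h.used hu.2
  | loop_true _ _ _ h₁ h₂ =>
    exact ⟨fun r hr => (h₂.reg r hr).trans (h₁.reg r hr),
      fun a ha => (h₂.bank a ha).trans (h₁.bank a ha),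
      fun hu => (h₂.used hu).trans (h₁.used hu)⟩
  | loop_false _ => exact Frame.refl _ _

@[simp] theorem State.setReg_reg (s : State) (x y : ℕ) (z : ℤ) :
    (s.setReg x z).reg y = if y = x then z else s.reg y := by
  simp [State.setReg, Function.update_apply]

@[simp] theorem State.setReg_bank (s : State) (x : ℕ) (z : ℤ) : (s.setReg x z).bank = s.bank := rfl

@[simp] theorem State.setReg_used (s : State) (x : ℕ) (z : ℤ) : (s.setReg x z).used = s.used := rfl

@[simp] theorem State.setCell_reg (s : State) (a : ℕ) (i z : ℤ) :
    (s.setCell a i z).reg = s.reg := rfl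

@[simp] theorem State.setCell_used (s : State) (a : ℕ) (i z : ℤ) :
    (s.setCell a i z).used = s.used := rfl

@[simp] theorem State.setCell_bank (s : State) (a b : ℕ) (i j z : ℤ) :
    (s.setCell a i z).bank b j = if b = a ∧ j = i then z else s.bank b j := by
  by_cases h : b = a
  · subst h; simp [State.setCell, Function.update_apply]
  · simp [State.setCell, h]

@[simp] theorem State.flipCoin_reg (ρ : ℕ → Bool) (s : State) (x y : ℕ) :
    (s.flipCoin ρ x).reg y = if y = x then (if ρ s.used then 1 else 0) else s.reg y := by
  simp [State.flipCoin, Function.update_apply]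

@[simp] theorem State.flipCoin_used (ρ : ℕ → Bool) (s : State) (x : ℕ) :
    (s.flipCoin ρ x).used = s.used + 1 := rfl

theorem State.Bounded.setReg {W : ℕ} {s : State} (hs : s.Bounded W) {x : ℕ} {z : ℤ}
    (hz : bitLen z ≤ W) : (s.setReg x z).Bounded W := by
  refine ⟨fun r => ?_, hs.bank⟩
  rw [State.setReg_reg]; split_ifs
  · exact hz
  · exact hs.reg r

theorem State.Bounded.setCell {W : ℕ} {s : State} (hs : s.Bounded W) {a : ℕ} {i z : ℤ}
    (hz : bitLen z ≤ W) : (s.setCell a i z).Bounded W := by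
  refine ⟨hs.reg, fun b j => ?_⟩
  rw [State.setCell_bank]; split_ifs
  · exact hz
  · exact hs.bank b j

theorem State.Bounded.flipCoin {W : ℕ} {s : State} (hs : s.Bounded W) (hW : 1 ≤ W)
    (ρ : ℕ → Bool) (x : ℕ) : (s.flipCoin ρ x).Bounded W := by
  refine ⟨fun r => ?_, hs.bank⟩
  rw [State.flipCoin_reg]
  have h1 : bitLen 1 ≤ W := (bitLen_le_natAbs 1).trans (by simpa using hW)
  have h0 : bitLen 0 ≤ W := (bitLen_le_natAbs 0).trans (by simp)
  split_ifs
  · exact h1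
  · exact h0
  · exact hs.reg r

/-- The cost of a step: it pays for every statement with expressions of size at most `Z` over
integers of at most `W` bits. -/
def stepCost (W Z : ℕ) : ℕ := (Z + 5) ^ 2 * (W + 1)

theorem stepCost_eq (W Z : ℕ) :
    stepCost W Z = Z ^ 2 * (W + 1) + 10 * (Z * (W + 1)) + 25 * (W + 1) := by
  unfold stepCost; ring

theorem Expr.cost_le_of_size_le {W Z : ℕ} {s : State} (hs : s.Bounded W) {e : Expr}
    (h : e.size ≤ Z) : e.cost s ≤ Z ^ 2 * (W + 1) :=
  (e.cost_le hs).trans (Nat.mul_le_mul_right _ (Nat.pow_le_pow_left h 2))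

theorem Expr.bitLen_val_le_of_size_le {W Z : ℕ} {s : State} (hs : s.Bounded W) {e : Expr}
    (h : e.size ≤ Z) : bitLen (e.val s) ≤ Z * (W + 1) :=
  (e.bitLen_val_le hs).trans (Nat.mul_le_mul_right _ h)

/-- With the coin sequence `ρ`, the program `c` started in `s` halts at a cost of at most `m` times
`stepCost W Z` in a state that satisfies `Q` and whose integers have at most `W` bits. The bound on
the bits is part of the statement because the cost of the next step depends on it. -/
def Runs (ρ : ℕ → Bool) (W Z : ℕ) (c : Program) (s : State) (m : ℕ) (Q : State → Prop) : Prop :=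
  ∃ t s', Exec ρ c s t s' ∧ t ≤ m * stepCost W Z ∧ s'.Bounded W ∧ Q s'

section Rules

variable {ρ : ℕ → Bool} {W Z : ℕ}

/-- The weakening rule. The weaker postcondition may use that the rest of the memory is unchanged.
-/
theorem Runs.mono {c : Program} {s : State} {m m' : ℕ} {Q Q' : State → Prop}
    (h : Runs ρ W Z c s m Q) (hm : m ≤ m')
    (hQ : ∀ s', s'.Bounded W → Frame c s s' → Q s' → Q' s') : Runs ρ W Z c s m' Q' := by
  obtain ⟨t, s', he, ht, hs', hq⟩ := h
  exact ⟨t, s', he, ht.trans (Nat.mul_le_mul_right _ hm), hs', hQ s' hs' he.frame hq⟩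

theorem Runs.skip {s : State} {Q : State → Prop} (hs : s.Bounded W) (hQ : Q s) :
    Runs ρ W Z .skip s 1 Q := by
  refine ⟨1, s, .skip s, ?_, hs, hQ⟩
  rw [stepCost_eq]; omega

theorem Runs.assign {s : State} {x : ℕ} {e : Expr} {Q : State → Prop} (hs : s.Bounded W)
    (hZ : e.size ≤ Z) (hb : bitLen (e.val s) ≤ W) (hQ : Q (s.setReg x (e.val s))) :
    Runs ρ W Z (.assign x e) s 1 Q := by
  refine ⟨_, _, .assign s x e, ?_, hs.setReg hb, hQ⟩
  have h1 := Expr.cost_le_of_size_le hs hZ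
  rw [stepCost_eq]; omega

theorem Runs.store {s : State} {a : ℕ} {i e : Expr} {Q : State → Prop} (hs : s.Bounded W)
    (hi : i.size ≤ Z) (hZ : e.size ≤ Z) (hb : bitLen (e.val s) ≤ W)
    (hQ : Q (s.setCell a (i.val s) (e.val s))) :
    Runs ρ W Z (.store a i e) s 2 Q := by
  refine ⟨_, _, .store s a i e, ?_, hs.setCell hb, hQ⟩
  have h1 := Expr.cost_le_of_size_le hs hZ
  have h3 := Expr.cost_le_of_size_le hs hi
  have h4 := Expr.bitLen_val_le_of_size_le hs hi
  rw [stepCost_eq]; omega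

theorem Runs.flip {s : State} {x : ℕ} {Q : State → Prop} (hs : s.Bounded W) (hW : 1 ≤ W)
    (hQ : Q (s.flipCoin ρ x)) : Runs ρ W Z (.flip x) s 1 Q := by
  refine ⟨_, _, .flip s x, ?_, hs.flipCoin hW ρ x, hQ⟩
  rw [stepCost_eq]; omega

theorem Runs.seq {c₁ c₂ : Program} {s : State} {m₁ m₂ : ℕ} {Q₁ Q : State → Prop}
    (h₁ : Runs ρ W Z c₁ s m₁ Q₁)
    (h₂ : ∀ s₁, s₁.Bounded W → Frame c₁ s s₁ → Q₁ s₁ → Runs ρ W Z c₂ s₁ m₂ Q) :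
    Runs ρ W Z (.seq c₁ c₂) s (m₁ + m₂) Q := by
  obtain ⟨t₁, s₁, he₁, ht₁, hs₁, hq₁⟩ := h₁
  obtain ⟨t₂, s₂, he₂, ht₂, hs₂, hq₂⟩ := h₂ s₁ hs₁ he₁.frame hq₁
  exact ⟨_, s₂, .seq he₁ he₂, by rw [add_mul]; exact Nat.add_le_add ht₁ ht₂, hs₂, hq₂⟩

theorem Runs.assign_seq {s : State} {x : ℕ} {e : Expr} {c : Program} {m : ℕ} {Q : State → Prop}
    (hs : s.Bounded W) (hZ : e.size ≤ Z) (hb : bitLen (e.val s) ≤ W)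
    (h : (s.setReg x (e.val s)).Bounded W → Runs ρ W Z c (s.setReg x (e.val s)) m Q) :
    Runs ρ W Z (.seq (.assign x e) c) s (1 + m) Q :=
  (Runs.assign (Q := (· = s.setReg x (e.val s))) hs hZ hb rfl).seq
    fun _ hs₁ _ h₁ => by subst h₁; exact h hs₁

theorem Runs.store_seq {s : State} {a : ℕ} {i e : Expr} {c : Program} {m : ℕ} {Q : State → Prop}
    (hs : s.Bounded W) (hi : i.size ≤ Z) (hZ : e.size ≤ Z) (hb : bitLen (e.val s) ≤ W)
    (h : (s.setCell a (i.val s) (e.val s)).Bounded W →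
      Runs ρ W Z c (s.setCell a (i.val s) (e.val s)) m Q) :
    Runs ρ W Z (.seq (.store a i e) c) s (2 + m) Q :=
  (Runs.store (Q := (· = s.setCell a (i.val s) (e.val s))) hs hi hZ hb rfl).seq
    fun _ hs₁ _ h₁ => by subst h₁; exact h hs₁

theorem Runs.ite {s : State} {e : Expr} {c₁ c₂ : Program} {m : ℕ} {Q : State → Prop}
    (hs : s.Bounded W) (hZ : e.size ≤ Z)
    (h₁ : e.val s ≠ 0 → Runs ρ W Z c₁ s m Q) (h₂ : e.val s = 0 → Runs ρ W Z c₂ s m Q) :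
    Runs ρ W Z (.ite e c₁ c₂) s (1 + m) Q := by
  have h3 := Expr.cost_le_of_size_le hs hZ
  have h5 : e.cost s + 1 ≤ stepCost W Z := by rw [stepCost_eq]; omega
  by_cases h : e.val s = 0
  · obtain ⟨t, s', he, ht, hs', hq⟩ := h₂ h
    exact ⟨_, s', .ite_false h he, by rw [add_mul]; omega, hs', hq⟩
  · obtain ⟨t, s', he, ht, hs', hq⟩ := h₁ h
    exact ⟨_, s', .ite_true h he, by rw [add_mul]; omega, hs', hq⟩

/-- The loop `for x = 0, 1, …, e - 1 do c`. -/
def Program.for (x : ℕ) (e : Expr) (c : Program) : Program :=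
  .seq (.assign x (.const 0))
    (.loop (.op .lt (.reg x) e) (.seq c (.assign x (.op .add (.reg x) (.const 1)))))

/-- The rule for counting loops: the bound evaluates to `L` throughout, the body does not write to
the counter and maintains the invariant `I`. -/
theorem Runs.for {x : ℕ} {e : Expr} {c : Program} {s : State} {L m : ℕ} (I : ℕ → State → Prop)
    (hs : s.Bounded W) (hZ : e.size + 2 ≤ Z) (hZ4 : 4 ≤ Z) (hL : L < 2 ^ W)
    (hx : c.writes x = false)
    (hb : ∀ s', Frame (.for x e c) s s' → e.val s' = L)
    (h0 : I 0 (s.setReg x 0))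
    (hstep : ∀ j < L, ∀ s', s'.Bounded W → Frame (.for x e c) s s' → s'.reg x = j → I j s' →
      Runs ρ W Z c s' m fun s'' => I (j + 1) (s''.setReg x (j + 1 : ℕ))) :
    Runs ρ W Z (.for x e c) s ((m + 2) * L + 2) (I L) := by
  have hsz : (Expr.op .lt (.reg x) e).size ≤ Z := by simp [Expr.size]; omega
  have key : ∀ k j s', k + j = L → s'.Bounded W → Frame (.for x e c) s s' → s'.reg x = j →
      I j s' → Runs ρ W Z (.loop (.op .lt (.reg x) e)
        (.seq c (.assign x (.op .add (.reg x) (.const 1))))) s' ((m + 2) * k + 1) (I L) := by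
    -- `k` is the number of iterations that are left
    intro k
    induction k with
    | zero =>
      intro j s' hj hs' hf hxj hI
      have hv : (Expr.op .lt (.reg x) e).val s' = 0 := by
        simp [Expr.val, Op.apply, hb s' hf, hxj]; omega
      have hc := Expr.cost_le_of_size_le hs' hsz
      have hc' := stepCost_eq W Z
      refine ⟨_, s', .loop_false hv, ?_, hs', by simpa [← hj] using hI⟩
      rw [Nat.mul_zero, Nat.zero_add]; omega
    | succ k ih =>
      intro j s' hj hs' hf hxj hI
      have hv : (Expr.op .lt (.reg x) e).val s' ≠ 0 := by
        simp [Expr.val, Op.apply, hb s' hf, hxj]; omega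
      have hc := Expr.cost_le_of_size_le hs' hsz
      have hc' := stepCost_eq W Z
      obtain ⟨t, s₁, he, ht, hs₁, hI₁⟩ := hstep j (by omega) s' hs' hf hxj hI
      have hxj₁ : s₁.reg x = j := by rw [he.frame.reg x hx, hxj]
      have hval : (Expr.op .add (.reg x) (.const 1)).val s₁ = (j + 1 : ℕ) := by
        simp [Expr.val, Op.apply, hxj₁]
      obtain ⟨t₂, s₂, he₂, ht₂, hs₂, hq₂⟩ := Runs.assign (ρ := ρ) (Z := Z) (x := x)
        (e := Expr.op .add (.reg x) (.const 1)) (Q := (· = s₁.setReg x (j + 1 : ℕ))) hs₁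
        (by simp [Expr.size]; omega)
        (by rw [hval]; exact bitLen_natCast_le (by omega)) (by rw [hval])
      subst hq₂
      have hf₂ : Frame (.for x e c) s' (s₁.setReg x (j + 1 : ℕ)) := by
        refine ⟨fun r hr => ?_, fun a ha => ?_, fun hu => ?_⟩
        · simp [Program.for, Program.writes] at hr
          rw [State.setReg_reg, if_neg hr.1, he.frame.reg r hr.2.1]
        · simp [Program.for, Program.stores] at ha
          rw [State.setReg_bank, he.frame.bank a ha]
        · simp [Program.for, Program.flips] at hu
          rw [State.setReg_used, he.frame.used hu]
      obtain ⟨t₃, s₃, he₃, ht₃, hs₃, hq₃⟩ := ih (j + 1) _ (by omega) hs₂ (hf.trans hf₂)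
        (by simp) hI₁
      refine ⟨_, s₃, .loop_true hv (.seq he he₂) he₃, ?_, hs₃, hq₃⟩
      have e1 : ((m + 2) * (k + 1) + 1) * stepCost W Z
          = m * stepCost W Z + 2 * stepCost W Z + ((m + 2) * k + 1) * stepCost W Z := by ring
      omega
  have hz : (Expr.const 0).val s = 0 := rfl
  have := Runs.assign_seq (ρ := ρ) (Z := Z) (x := x) (e := .const 0) (Q := I L)
    (c := .loop (.op .lt (.reg x) e) (.seq c (.assign x (.op .add (.reg x) (.const 1)))))
    (m := (m + 2) * L + 1) hs
    (by simp [Expr.size]; omega) (by rw [hz]; exact bitLen_natCast_le (by positivity))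
    (fun h => by
      rw [hz] at h ⊢
      refine key L 0 _ (by omega) h ?_ (by simp) h0
      refine ⟨fun r hr => ?_, fun _ _ => rfl, fun _ => rfl⟩
      simp [Program.for, Program.writes] at hr
      rw [State.setReg_reg, if_neg hr.1])
  exact this.mono (by omega) fun _ _ _ h => h

end Rules

end RAM

/-! ### The tables of the dynamic program -/

namespace ColoringTable

open Finset

/-- The linear functional `φ ↦ ∑ₘ cₘ φ(m)`, where `∑ₘ cₘ xᵐ` is the expansion of the graph
polynomial `∏_{(u, v) ∈ E} (x_u - x_v)` into monomials. It is defined by recursion on `E`, without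
the coefficients `cₘ`. -/
def expand : List (ℕ × ℕ) → ((ℕ → ℕ) → ℤ) → ℤ
  | [], φ => φ 0
  | (u, v) :: E, φ =>
    expand E (fun m => φ (m + Pi.single u 1)) - expand E (fun m => φ (m + Pi.single v 1))

/-- The degree of a vertex with respect to a list of edges. -/
def deg : List (ℕ × ℕ) → ℕ → ℕ
  | [], _ => 0
  | (u, v) :: E, w => deg E w + (if w = u then 1 else 0) + (if w = v then 1 else 0)

theorem expand_congr {E : List (ℕ × ℕ)} {φ ψ : (ℕ → ℕ) → ℤ}
    (h : ∀ m : ℕ → ℕ, (∀ w, m w ≤ deg E w) → φ m = ψ m) : expand E φ = expand E ψ := by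
  induction E generalizing φ ψ with
  | nil => exact h 0 fun _ => le_rfl
  | cons p E ih =>
    obtain ⟨u, v⟩ := p
    simp only [expand]
    congr 1
    · refine ih fun m hm => h _ fun w => ?_
      have := hm w
      simp only [Pi.add_apply, Pi.single_apply, deg]; omega
    · refine ih fun m hm => h _ fun w => ?_
      have := hm w
      simp only [Pi.add_apply, Pi.single_apply, deg]; omega

theorem expand_sum {ι : Type*} (E : List (ℕ × ℕ)) (s : Finset ι) (c : ι → ℤ)
    (φ : ι → (ℕ → ℕ) → ℤ) :
    expand E (fun m => ∑ i ∈ s, c i * φ i m) = ∑ i ∈ s, c i * expand E (φ i) := by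
  induction E generalizing φ with
  | nil => rfl
  | cons p E ih =>
    obtain ⟨u, v⟩ := p
    simp only [expand]
    rw [ih, ih, ← sum_sub_distrib]
    simp only [mul_sub]

theorem expand_sum_sum {ι κ : Type*} (E : List (ℕ × ℕ)) (s : Finset ι) (t : Finset κ)
    (c : ι → κ → ℤ) (φ : ι → κ → (ℕ → ℕ) → ℤ) :
    expand E (fun m => ∑ i ∈ s, ∑ j ∈ t, c i j * φ i j m)
      = ∑ i ∈ s, ∑ j ∈ t, c i j * expand E (φ i j) := by
  have := expand_sum E s (fun _ => 1) fun i m => ∑ j ∈ t, c i j * φ i j m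
  simpa only [one_mul, expand_sum] using this

theorem expand_const_mul (E : List (ℕ × ℕ)) (c : ℤ) (φ : (ℕ → ℕ) → ℤ) :
    expand E (fun m => c * φ m) = c * expand E φ := by
  simpa using expand_sum E {()} (fun _ => c) (fun _ => φ)

theorem abs_expand_le (E : List (ℕ × ℕ)) (φ : (ℕ → ℕ) → ℤ) (B : ℤ)
    (h : ∀ m : ℕ → ℕ, (∀ w, m w ≤ deg E w) → |φ m| ≤ B) : |expand E φ| ≤ 2 ^ E.length * B := by
  induction E generalizing φ with
  | nil => simpa [expand] using h 0 fun _ => le_rfl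
  | cons p E ih =>
    obtain ⟨u, v⟩ := p
    simp only [expand, List.length_cons]
    have h1 := ih (fun m => φ (m + Pi.single u 1)) fun m hm => h _ fun w => by
      have := hm w
      simp only [Pi.add_apply, Pi.single_apply, deg]; omega
    have h2 := ih (fun m => φ (m + Pi.single v 1)) fun m hm => h _ fun w => by
      have := hm w
      simp only [Pi.add_apply, Pi.single_apply, deg]; omega
    calc _ ≤ _ := abs_sub _ _
      _ ≤ 2 ^ E.length * B + 2 ^ E.length * B := add_le_add h1 h2
      _ = _ := by ring

theorem prod_pow_add_single {n u : ℕ} (hu : u < n) (x : ℕ → ℤ) (m : ℕ → ℕ) :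
    ∏ w ∈ range n, x w ^ (m + Pi.single u 1 : ℕ → ℕ) w = x u * ∏ w ∈ range n, x w ^ m w := by
  have hu' : u ∈ range n := by simpa using hu
  rw [← mul_prod_erase _ _ hu', ← mul_prod_erase _ _ hu']
  have : ∏ w ∈ (range n).erase u, x w ^ (m + Pi.single u 1 : ℕ → ℕ) w
      = ∏ w ∈ (range n).erase u, x w ^ m w := by
    refine prod_congr rfl fun w hw => ?_
    simp [(mem_erase.1 hw).1]
  rw [this]
  simp [pow_succ]; ring

theorem expand_prod_pow {n : ℕ} {E : List (ℕ × ℕ)} (hE : ∀ p ∈ E, p.1 < n ∧ p.2 < n)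
    (x : ℕ → ℤ) :
    expand E (fun m => ∏ w ∈ range n, x w ^ m w) = (E.map fun p => x p.1 - x p.2).prod := by
  induction E with
  | nil => simp [expand]
  | cons p E ih =>
    obtain ⟨u, v⟩ := p
    have h := hE (u, v) (by simp)
    simp only [expand, prod_pow_add_single h.1, prod_pow_add_single h.2, expand_const_mul]
    rw [ih fun p hp => hE p (by simp [hp])]
    simp [sub_mul]

/-- The number of table indices for a vertex of degree `d` of which `k` edges are introduced. -/
def radix (d k : ℕ) : ℕ := min k (d - k) + 1

/-- The contribution of a vertex of degree `d` of which `k` edges are introduced to the table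
entry with index `e`. As long as `2 k ≤ d`, the index is the exponent of the vertex in the part of
the graph polynomial that belongs to the introduced edges. Afterwards it is the exponent in the
part that belongs to the other edges, and the contribution of a monomial with exponent `m` is the
power sum `S (m + e)`. -/
def kernel (d : ℕ) (S : ℕ → ℤ) (k m e : ℕ) : ℤ :=
  if 2 * k ≤ d then (if m = e then 1 else 0) else S (m + e)

/-- The matrix that updates the index of a vertex, from `a` to `e`, when an edge is introduced and
the graph polynomial is multiplied by the `b`-th power of the variable of the vertex. -/
def update (d : ℕ) (S : ℕ → ℤ) (k b e a : ℕ) : ℤ :=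
  if 2 * (k + 1) ≤ d then (if e = a + b then 1 else 0)
  else if 2 * k ≤ d then S (a + b + e)
  else if a = e + b then 1 else 0

/-- The kernel after the introduction of an edge is the kernel before it, multiplied by the update
matrix. At the switch from `2 k ≤ d` to `2 (k + 1) > d` the power sum takes in the old index as the
exponent so far. -/
theorem kernel_succ {d k m b e : ℕ} (S : ℕ → ℤ) (hk : k < d) (hm : m ≤ k) (hb : b ≤ 1)
    (he : e < radix d (k + 1)) :
    kernel d S (k + 1) (m + b) e
      = ∑ a ∈ range (radix d k), update d S k b e a * kernel d S k m a := by
  unfold radix at he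
  have hr : 2 * k ≤ d → radix d k = k + 1 := fun h => by unfold radix; omega
  have hr' : ¬ 2 * k ≤ d → radix d k = d - k + 1 := fun h => by unfold radix; omega
  by_cases h1 : 2 * (k + 1) ≤ d
  · have h2 : 2 * k ≤ d := by omega
    rw [hr h2, sum_eq_single_of_mem m (by simp; omega)]
    · simp [kernel, update, h1, h2, eq_comm]
    · intro a _ ha
      simp [kernel, h2, Ne.symm ha]
  · by_cases h2 : 2 * k ≤ d
    · rw [hr h2, sum_eq_single_of_mem m (by simp; omega)]
      · simp [kernel, update, h1, h2]
      · intro a _ ha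
        simp [kernel, h2, Ne.symm ha]
    · rw [hr' h2, sum_eq_single_of_mem (e + b) (by simp; omega)]
      · simp [kernel, update, h1, h2]; congr 1; ring
      · intro a _ ha
        simp [update, h1, h2, ha]

/-- The table entry with index `e` after the edges in `E` have been introduced. -/
def table (n : ℕ) (d : ℕ → ℕ) (S : ℕ → ℕ → ℤ) (E : List (ℕ × ℕ)) (e : ℕ → ℕ) : ℤ :=
  expand E fun m => ∏ w ∈ range n, kernel (d w) (S w) (deg E w) (m w) (e w)

theorem table_congr {n : ℕ} {d : ℕ → ℕ} {S : ℕ → ℕ → ℤ} {E : List (ℕ × ℕ)} {e e' : ℕ → ℕ}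
    (h : ∀ w < n, e w = e' w) : table n d S E e = table n d S E e' := by
  unfold table
  congr 1
  funext m
  exact prod_congr rfl fun w hw => by rw [h w (mem_range.1 hw)]

theorem prod_eq_mul_mul_prod_erase {n u v : ℕ} (hu : u < n) (hv : v < n) (huv : u ≠ v)
    (f : ℕ → ℤ) :
    ∏ w ∈ range n, f w = f u * (f v * ∏ w ∈ ((range n).erase u).erase v, f w) := by
  rw [← mul_prod_erase _ _ (mem_range.2 hu),
    ← mul_prod_erase ((range n).erase u) f (mem_erase.2 ⟨huv.symm, mem_range.2 hv⟩)]

/-- One of the two terms that arise when an edge is introduced: `t` is the exponent vector of the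
variable that is multiplied to the graph polynomial. -/
theorem expand_shift {n u v : ℕ} {d : ℕ → ℕ} {S : ℕ → ℕ → ℤ} {E : List (ℕ × ℕ)} {e : ℕ → ℕ}
    (hu : u < n) (hv : v < n) (huv : u ≠ v) (hdu : deg E u < d u) (hdv : deg E v < d v)
    (heu : e u < radix (d u) (deg E u + 1)) (hev : e v < radix (d v) (deg E v + 1))
    {b b' : ℕ} (hb : b ≤ 1) (hb' : b' ≤ 1) {t : ℕ → ℕ}
    (htu : t u = b) (htv : t v = b') (ht : ∀ w, w ≠ u → w ≠ v → t w = 0) :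
    (expand E fun m => ∏ w ∈ range n,
        kernel (d w) (S w) (deg ((u, v) :: E) w) ((m + t) w) (e w))
      = ∑ a ∈ range (radix (d u) (deg E u)), ∑ a' ∈ range (radix (d v) (deg E v)),
        update (d u) (S u) (deg E u) b (e u) a * update (d v) (S v) (deg E v) b' (e v) a' *
          table n d S E (Function.update (Function.update e u a) v a') := by
  unfold table
  rw [← expand_sum_sum]
  refine expand_congr fun m hm => ?_
  rw [prod_eq_mul_mul_prod_erase hu hv huv]
  have h1 : deg ((u, v) :: E) u = deg E u + 1 := by simp [deg, huv]
  have h2 : deg ((u, v) :: E) v = deg E v + 1 := by simp [deg, huv.symm]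
  have hrest : ∏ w ∈ ((range n).erase u).erase v,
        kernel (d w) (S w) (deg ((u, v) :: E) w) ((m + t) w) (e w)
      = ∏ w ∈ ((range n).erase u).erase v, kernel (d w) (S w) (deg E w) (m w) (e w) := by
    refine prod_congr rfl fun w hw => ?_
    simp only [mem_erase] at hw
    simp [deg, hw.1, hw.2.1, ht w hw.2.1 hw.1]
  rw [hrest, h1, h2, Pi.add_apply, Pi.add_apply, htu, htv, kernel_succ _ hdu (hm u) hb heu,
    kernel_succ _ hdv (hm v) hb' hev, sum_mul]
  refine sum_congr rfl fun a _ => ?_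
  rw [sum_mul, mul_sum]
  refine sum_congr rfl fun a' _ => ?_
  rw [prod_eq_mul_mul_prod_erase hu hv huv]
  have hrest' : ∏ w ∈ ((range n).erase u).erase v, kernel (d w) (S w) (deg E w) (m w)
        (Function.update (Function.update e u a) v a' w)
      = ∏ w ∈ ((range n).erase u).erase v, kernel (d w) (S w) (deg E w) (m w) (e w) := by
    refine prod_congr rfl fun w hw => ?_
    simp only [mem_erase] at hw
    simp [Function.update_of_ne hw.1, Function.update_of_ne hw.2.1]
  rw [hrest']
  simp [huv]
  ring

/-- The recurrence for the tables: only the indices at the ends of the new edge change. -/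
theorem table_cons {n u v : ℕ} {d : ℕ → ℕ} {S : ℕ → ℕ → ℤ} {E : List (ℕ × ℕ)} {e : ℕ → ℕ}
    (hu : u < n) (hv : v < n) (huv : u ≠ v) (hdu : deg E u < d u) (hdv : deg E v < d v)
    (heu : e u < radix (d u) (deg E u + 1)) (hev : e v < radix (d v) (deg E v + 1)) :
    table n d S ((u, v) :: E) e
      = ∑ a ∈ range (radix (d u) (deg E u)), ∑ a' ∈ range (radix (d v) (deg E v)),
        (update (d u) (S u) (deg E u) 1 (e u) a * update (d v) (S v) (deg E v) 0 (e v) a' -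
          update (d u) (S u) (deg E u) 0 (e u) a * update (d v) (S v) (deg E v) 1 (e v) a') *
          table n d S E (Function.update (Function.update e u a) v a') := by
  have h1 := expand_shift (S := S) hu hv huv hdu hdv heu hev (b := 1) (b' := 0) le_rfl zero_le_one
    (t := Pi.single u 1) (by simp) (by simp [huv.symm]) (fun w h _ => by simp [h])
  have h2 := expand_shift (S := S) hu hv huv hdu hdv heu hev (b := 0) (b' := 1) zero_le_one le_rfl
    (t := Pi.single v 1) (by simp [huv]) (by simp) (fun w _ h => by simp [h])
  conv_lhs => unfold table
  simp only [expand]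
  rw [h1, h2, ← sum_sub_distrib]
  refine sum_congr rfl fun a _ => ?_
  rw [← sum_sub_distrib]
  exact sum_congr rfl fun a' _ => by ring

theorem abs_kernel_le {d k m e : ℕ} {S : ℕ → ℤ} {B : ℤ} (hB : 1 ≤ B) (hS : ∀ i ≤ d, |S i| ≤ B)
    (hm : m ≤ k) (hk : k ≤ d) (he : e < radix d k) : |kernel d S k m e| ≤ B := by
  unfold radix at he
  unfold kernel
  split_ifs with h1 h2
  · simpa using hB
  · simp; omega
  · exact hS _ (by omega)

theorem abs_update_le {d k b e a : ℕ} {S : ℕ → ℤ} {B : ℤ} (hB : 1 ≤ B) (hS : ∀ i ≤ d, |S i| ≤ B)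
    (hb : b ≤ 1) (hk : k < d) (ha : a < radix d k) (he : e < radix d (k + 1)) :
    |update d S k b e a| ≤ B := by
  unfold radix at he ha
  unfold update
  split_ifs with h1 h2
  · simpa using hB
  · simp; omega
  · exact hS _ (by omega)
  · simpa using hB
  · simp; omega

theorem abs_table_le {n : ℕ} {d : ℕ → ℕ} {S : ℕ → ℕ → ℤ} {E : List (ℕ × ℕ)} {e : ℕ → ℕ} {B : ℤ}
    (hB : 1 ≤ B) (hS : ∀ w < n, ∀ i ≤ d w, |S w i| ≤ B) (hd : ∀ w < n, deg E w ≤ d w)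
    (he : ∀ w < n, e w < radix (d w) (deg E w)) :
    |table n d S E e| ≤ 2 ^ E.length * B ^ n := by
  refine abs_expand_le _ _ _ fun m hm => ?_
  rw [abs_prod]
  calc _ ≤ ∏ _w ∈ range n, B := prod_le_prod (fun _ _ => abs_nonneg _) fun w hw => by
        have hw := mem_range.1 hw
        exact abs_kernel_le hB (hS w hw) (hm w) (hd w hw) (he w hw)
    _ = _ := by simp

/-- The power sums `∑_{t < q} yᵗ tᵐ`. -/
def powerSum (q : ℕ) (y : ℤ) (m : ℕ) : ℤ := ∑ t ∈ range q, y ^ t * (t : ℤ) ^ m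

/-- The colors that are used for the vertex `w`. Isolated vertices get the color `0`, since no power
sum enters the table for them. -/
def palette (q : ℕ) (d : ℕ → ℕ) (w : ℕ) : Finset ℕ := if d w = 0 then {0} else range q

/-- An assignment on `Fin n`, extended by `0`. -/
def extendZero {n : ℕ} (x : Fin n → ℕ) (w : ℕ) : ℤ := if h : w < n then x ⟨w, h⟩ else 0

/-- When all edges are introduced, the table has one entry left: a generating function
of the values of the graph polynomial on the colorings. -/
theorem table_zero {n q : ℕ} {d : ℕ → ℕ} {y : ℕ → ℤ} {E : List (ℕ × ℕ)}
    (hE : ∀ p ∈ E, p.1 < n ∧ p.2 < n) (hd : ∀ w < n, deg E w = d w) :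
    table n d (fun w => powerSum q (y w)) E 0
      = ∑ x ∈ Fintype.piFinset (fun w : Fin n => palette q d w),
          (∏ w : Fin n, y w ^ x w) * (E.map fun p => extendZero x p.1 - extendZero x p.2).prod := by
  simp only [← expand_prod_pow hE]
  rw [← expand_sum]
  refine expand_congr fun m hm => ?_
  have h1 : ∀ w : Fin n, kernel (d w) (powerSum q (y w)) (deg E w) (m w) ((0 : ℕ → ℕ) w)
      = ∑ t ∈ palette q d w, y w ^ t * (t : ℤ) ^ m w := by
    intro w
    rw [hd w w.2]
    have := hm w
    rw [hd w w.2] at this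
    by_cases h : d w = 0
    · have h0 : m w = 0 := by omega
      simp [kernel, palette, h, h0]
    · have : ¬ 2 * d w ≤ d w := by omega
      simp [kernel, palette, h, this, powerSum]
  rw [prod_range, prod_congr rfl fun w _ => h1 w, prod_univ_sum]
  refine sum_congr rfl fun x _ => ?_
  rw [prod_mul_distrib, prod_range]
  simp [extendZero]

end ColoringTable

/-! ### Notation for expressions -/

namespace RAM

instance : Add Expr := ⟨.op .add⟩
instance : Sub Expr := ⟨.op .sub⟩
instance : Mul Expr := ⟨.op .mul⟩
instance : Div Expr := ⟨.op .div⟩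
instance : Mod Expr := ⟨.op .mod⟩
instance (k : ℕ) : OfNat Expr k := ⟨.const k⟩

section Val

variable (s : State) (e f : Expr)

@[simp] theorem val_add : (e + f).val s = e.val s + f.val s := rfl
@[simp] theorem val_sub : (e - f).val s = e.val s - f.val s := rfl
@[simp] theorem val_mul : (e * f).val s = e.val s * f.val s := rfl
@[simp] theorem val_div : (e / f).val s = e.val s / f.val s := rfl
@[simp] theorem val_mod : (e % f).val s = e.val s % f.val s := rfl
@[simp] theorem val_zero : (0 : Expr).val s = 0 := rfl
@[simp] theorem val_one : (1 : Expr).val s = 1 := rfl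
@[simp] theorem val_two : (2 : Expr).val s = 2 := rfl
@[simp] theorem val_three : (3 : Expr).val s = 3 := rfl
@[simp] theorem val_reg (x : ℕ) : (Expr.reg x).val s = s.reg x := rfl
@[simp] theorem val_cell (a : ℕ) : (Expr.cell a e).val s = s.bank a (e.val s) := rfl
@[simp] theorem val_eq : (Expr.op .eq e f).val s = if e.val s = f.val s then 1 else 0 := rfl
@[simp] theorem val_lt : (Expr.op .lt e f).val s = if e.val s < f.val s then 1 else 0 := rfl

end Val

theorem bitLen_zero_le {W : ℕ} : bitLen 0 ≤ W := (bitLen_le_natAbs 0).trans (Nat.zero_le _)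

theorem bitLen_one_le {W : ℕ} (hW : 1 ≤ W) : bitLen 1 ≤ W := (bitLen_le_natAbs 1).trans hW

theorem Runs.le {ρ : ℕ → Bool} {W Z : ℕ} {c : Program} {s : State} {m m' : ℕ}
    {Q : State → Prop} (h : Runs ρ W Z c s m Q) (hm : m ≤ m') : Runs ρ W Z c s m' Q :=
  h.mono hm fun _ _ _ h => h

end RAM

/-! ### Degrees, random weights and power sums

The program uses the following memory banks: the input (bank `0`), the degrees of the vertices
(`1`), the random weights (`2`), the power sums (`3`), the powers of the base of the addresses
(`4`), the current degrees (`5`), the marks of the introduced edges (`6`), the tables (`7`), the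
numbers of indices of the vertices in the new table (`8`) and the current table index (`9`).
Register `7` counts the introduced edges. The specifications assume `400 ≤ Z`, which is more than
the size of any expression that occurs. -/

namespace ColoringProgram

open RAM Finset ColoringTable

local infixr:60 " ;; " => Program.seq

/-- Register `1` holds the number of vertices. -/
abbrev rn : Expr := .reg 1
/-- Register `2` holds the number of colors. -/
abbrev rq : Expr := .reg 2
/-- Register `3` holds the base `n + 1` of the table addresses. -/
abbrev rB : Expr := .reg 3
/-- Register `4` holds the number of nodes of the decomposition. -/
abbrev rlen : Expr := .reg 4
/-- Register `5` holds the number of bits of each random weight. -/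
abbrev rK : Expr := .reg 5
/-- Register `6` holds `(n + 1) ^ n`. -/
abbrev rBN : Expr := .reg 6

/-- Compute the degrees of all vertices. -/
def degrees : Program :=
  .for 18 rn (.assign 15 0 ;;
    .for 21 rn (.assign 15 (.reg 15 + .cell 0 (2 + .reg 18 * rn + .reg 21))) ;;
    .store 1 (.reg 18) (.reg 15))

/-- Compute the powers of the base of the table addresses. -/
def powers : Program :=
  .assign 6 1 ;;
  .for 18 rn (.store 4 (.reg 18) (.reg 6) ;; .assign 6 (.reg 6 * rB))

/-- Choose the random weights of the vertices. -/
def weights : Program :=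
  .for 18 rn (.assign 15 0 ;;
    .for 21 rK (.flip 22 ;; .assign 15 (2 * .reg 15 + .reg 22)) ;;
    .store 2 (.reg 18) (.reg 15))

/-- Compute the power sums of all vertices. -/
def powerSums : Program :=
  .for 18 rn (.for 17 rB (.assign 15 0 ;;
    .for 21 rq (.assign 20 1 ;;
      .for 26 (.reg 21) (.assign 20 (.reg 20 * .cell 2 (.reg 18))) ;;
      .for 26 (.reg 17) (.assign 20 (.reg 20 * .reg 21)) ;;
      .assign 15 (.reg 15 + .reg 20)) ;;
    .store 3 (.reg 18 * rB + .reg 17) (.reg 15)))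

variable {ρ : ℕ → Bool} {W Z : ℕ} {s : State}

theorem degrees_spec {n : ℕ} {adj : ℕ → ℕ → ℕ} (hs : s.Bounded W) (hZ : 400 ≤ Z)
    (h1 : s.reg 1 = n) (hW : n < 2 ^ W)
    (hadj : ∀ w < n, ∀ x < n, s.bank 0 (2 + w * n + x) = adj w x) (hle : ∀ w x, adj w x ≤ 1) :
    Runs ρ W Z degrees s ((3 * n + 7) * n + 2)
      (fun s' => ∀ w < n, s'.bank 1 w = (∑ x ∈ range n, adj w x : ℕ)) := by
  refine Runs.for (L := n) (m := 3 * n + 5)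
    (fun j s' => ∀ w < j, s'.bank 1 w = (∑ x ∈ range n, adj w x : ℕ)) hs
    (le_trans (by decide) hZ) (by omega) hW rfl (fun s' hf => by simp [hf.reg 1 rfl, h1])
    (by simp) (fun j hj s' hs' hf hx hI => ?_)
  refine Runs.le (m := 1 + ((1 + 2) * n + 2 + 2)) ?_ (by omega)
  refine Runs.assign_seq hs' (le_trans (by decide) hZ) bitLen_zero_le
    fun hs1 => ?_
  have hbd : ∀ x ≤ n, ∑ y ∈ range x, adj j y < 2 ^ W := fun x hx =>
    lt_of_le_of_lt ((sum_le_sum fun y _ => hle j y).trans (by simpa using hx)) hW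
  refine (Runs.for (L := n) (m := 1)
    (fun x s'' => s''.reg 15 = (∑ y ∈ range x, adj j y : ℕ)) hs1
    (le_trans (by decide) hZ) (by omega) hW rfl
    (fun s'' hf2 => by simp [hf2.reg 1 rfl, hf.reg 1 rfl, h1]) (by simp)
    (fun x hx2 s'' hs'' hf2 hxx hI2 => ?_)).seq (fun s2 hs2 hf2 h2 => ?_)
  · have hv : (Expr.reg 15 + .cell 0 (2 + .reg 18 * rn + .reg 21)).val s''
        = (∑ y ∈ range (x + 1), adj j y : ℕ) := by
      simp [hf2.reg 18 rfl, hf2.reg 1 rfl, hf.reg 1 rfl, h1, hx, hxx, hI2, hf2.bank 0 rfl,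
        hf.bank 0 rfl, hadj j hj x hx2, sum_range_succ]
    refine Runs.assign hs'' (le_trans (by decide) hZ) ?_ ?_
    · rw [hv]; exact bitLen_natCast_le (hbd _ hx2)
    · rw [hv]; simp
  · refine Runs.store hs2 (le_trans (by decide) hZ) (le_trans (by decide) hZ) ?_ ?_
    · simp only [val_reg, h2]; exact bitLen_natCast_le (hbd _ le_rfl)
    · intro w hw
      simp only [val_reg, h2, hf2.reg 18 rfl]
      simp [hx, hf2.bank 1 rfl]
      split_ifs with hwj
      · rw [hwj]
      · rw [hI w (by omega)]; push_cast; rfl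

theorem powers_spec {n B : ℕ} (hs : s.Bounded W) (hZ : 400 ≤ Z) (h1 : s.reg 1 = n)
    (h3 : s.reg 3 = B) (hB : 1 ≤ B) (hnW : n < 2 ^ W) (hW : B ^ n < 2 ^ W) :
    Runs ρ W Z powers s (1 + (5 * n + 2))
      (fun s' => (∀ w < n, s'.bank 4 w = (B ^ w : ℕ)) ∧ s'.reg 6 = (B ^ n : ℕ)) := by
  have hbd : ∀ x ≤ n, B ^ x < 2 ^ W := fun x hx => (Nat.pow_le_pow_right hB hx).trans_lt hW
  have hW1 : 1 ≤ W := by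
    by_contra h
    have : W = 0 := by omega
    have h2 : 0 < B ^ n := by positivity
    subst this
    omega
  refine Runs.assign_seq hs (le_trans (by decide) hZ) (bitLen_one_le hW1) fun hs1 => ?_
  refine Runs.for (L := n) (m := 3)
    (fun j s' => (∀ w < j, s'.bank 4 w = (B ^ w : ℕ)) ∧ s'.reg 6 = (B ^ j : ℕ)) hs1
    (le_trans (by decide) hZ) (by omega) hnW rfl (fun s' hf => by simp [hf.reg 1 rfl, h1])
    (by simp) (fun j hj s' hs' hf hx hI => ?_)
  have h3' : s'.reg 3 = B := by simp [hf.reg 3 rfl, h3]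
  refine Runs.le (m := 2 + 1) ?_ le_rfl
  refine Runs.store_seq hs' (le_trans (by decide) hZ) (le_trans (by decide) hZ) ?_ fun hs2 => ?_
  · simp only [val_reg, hI.2]; exact bitLen_natCast_le (hbd _ hj.le)
  · refine Runs.assign hs2 (le_trans (by decide) hZ) ?_ ?_
    · have : (rBN * rB).val (s'.setCell 4 (Expr.val s' (.reg 18)) (Expr.val s' (.reg 6)))
          = (B ^ (j + 1) : ℕ) := by
        simp [hI.2, h3', pow_succ]
      rw [this]; exact bitLen_natCast_le (hbd _ hj)
    · refine ⟨fun w hw => ?_, ?_⟩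
      · simp [hx, hI.2]
        split_ifs with hwj
        · rw [hwj]
        · rw [hI.1 w (by omega)]; push_cast; rfl
      · simp [hI.2, h3', pow_succ]

/-- The number with the binary digits `f 0, …, f (k - 1)`, the most significant one first. -/
def ofBits (f : ℕ → Bool) : ℕ → ℕ
  | 0 => 0
  | k + 1 => 2 * ofBits f k + if f k then 1 else 0

theorem ofBits_lt (f : ℕ → Bool) (k : ℕ) : ofBits f k < 2 ^ k := by
  induction k with
  | zero => simp [ofBits]
  | succ k ih => simp only [ofBits, pow_succ]; split_ifs <;> omega

/-- The weight of the vertex `w` that is obtained from the coins `w * K, …, w * K + K - 1`. -/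
def weight (ρ : ℕ → Bool) (K w : ℕ) : ℕ := ofBits (fun i => ρ (w * K + i)) K

theorem weights_spec {n K : ℕ} (hs : s.Bounded W) (hZ : 400 ≤ Z) (h1 : s.reg 1 = n)
    (h5 : s.reg 5 = K) (hu : s.used = 0) (hW1 : 1 ≤ W) (hnW : n < 2 ^ W) (hKW : K ≤ W) :
    Runs ρ W Z weights s ((4 * K + 7) * n + 2)
      (fun s' => ∀ w < n, s'.bank 2 w = weight ρ K w) := by
  have hKW' : K < 2 ^ W := hKW.trans_lt Nat.lt_two_pow_self
  refine Runs.mono (Runs.for (L := n) (m := 4 * K + 5)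
    (fun j s' => (∀ w < j, s'.bank 2 w = weight ρ K w) ∧ s'.used = j * K) hs
    (le_trans (by decide) hZ) (by omega) hnW rfl (fun s' hf => by simp [hf.reg 1 rfl, h1])
    (by simp [hu]) (fun j hj s' hs' hf hx hI => ?_)) le_rfl (fun s' _ _ h => h.1)
  refine Runs.le (m := 1 + ((2 + 2) * K + 2 + 2)) ?_ (by omega)
  refine Runs.assign_seq hs' (le_trans (by decide) hZ) bitLen_zero_le fun hs1 => ?_
  have hbd : ∀ x ≤ K, ofBits (fun i => ρ (j * K + i)) x < 2 ^ W := fun x hx =>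
    (ofBits_lt _ _).trans_le (Nat.pow_le_pow_right (by norm_num) (hx.trans hKW))
  refine (Runs.for (L := K) (m := 2)
    (fun x s'' => s''.reg 15 = ofBits (fun i => ρ (j * K + i)) x ∧ s''.used = j * K + x) hs1
    (le_trans (by decide) hZ) (by omega) hKW' rfl
    (fun s'' hf2 => by simp [hf2.reg 5 rfl, hf.reg 5 rfl, h5]) (by simp [hI.2, ofBits])
    (fun x hx2 s'' hs'' hf2 hxx hI2 => ?_)).seq (fun s2 hs2 hf2 h2 => ?_)
  · refine Runs.seq (m₁ := 1) (m₂ := 1) (Runs.flip (Q := (· = s''.flipCoin ρ 22)) hs'' hW1 rfl)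
      fun s3 hs3 _ h3 => ?_
    subst h3
    have hv : (2 * Expr.reg 15 + .reg 22).val (s''.flipCoin ρ 22)
        = (ofBits (fun i => ρ (j * K + i)) (x + 1) : ℕ) := by
      simp [hI2.1, hI2.2, ofBits]
    refine Runs.assign hs3 (le_trans (by decide) hZ) ?_ ?_
    · rw [hv]; exact bitLen_natCast_le (hbd _ hx2)
    · rw [hv]; simp [hI2.2, add_assoc]
  · refine Runs.store hs2 (le_trans (by decide) hZ) (le_trans (by decide) hZ) ?_ ?_
    · simp only [val_reg, h2.1]; exact bitLen_natCast_le (hbd _ le_rfl)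
    · refine ⟨fun w hw => ?_, ?_⟩
      · simp only [val_reg, h2.1, hf2.reg 18 rfl]
        simp [hx, hf2.bank 2 rfl]
        split_ifs with hwj
        · rw [hwj]; rfl
        · exact hI.1 w (by omega)
      · simp [h2.2]; ring

theorem mul_add_inj {B a b a' b' : ℕ} (hb : b < B) (hb' : b' < B) :
    a * B + b = a' * B + b' ↔ a = a' ∧ b = b' := by
  refine ⟨fun h => ?_, fun h => by rw [h.1, h.2]⟩
  have hB : 0 < B := by omega
  have h1 : (a * B + b) / B = a := by
    rw [add_comm, Nat.add_mul_div_right _ _ hB, Nat.div_eq_of_lt hb, zero_add]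
  have h2 : (a' * B + b') / B = a' := by
    rw [add_comm, Nat.add_mul_div_right _ _ hB, Nat.div_eq_of_lt hb', zero_add]
  have h3 : a = a' := by rw [← h1, ← h2, h]
  subst h3
  exact ⟨rfl, by omega⟩

theorem pow_mul_pow_le {y t i k q B K : ℕ} (hy : y < 2 ^ K) (hi : i ≤ q) (ht : t ≤ B) (hB : 1 ≤ B)
    (hk : k ≤ B) : y ^ i * t ^ k ≤ 2 ^ (K * q) * B ^ B := by
  refine Nat.mul_le_mul ?_ ?_
  · calc y ^ i ≤ (2 ^ K) ^ i := Nat.pow_le_pow_left hy.le i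
      _ ≤ (2 ^ K) ^ q := Nat.pow_le_pow_right (by positivity) hi
      _ = _ := by rw [pow_mul]
  · exact (Nat.pow_le_pow_left ht k).trans (Nat.pow_le_pow_right hB hk)

theorem powerSums_spec {n q B K : ℕ} {y : ℕ → ℕ} (hs : s.Bounded W) (hZ : 400 ≤ Z)
    (h1 : s.reg 1 = n) (h2 : s.reg 2 = q) (h3 : s.reg 3 = B) (hqB : q ≤ B) (hnB : n ≤ B)
    (hBW : B < 2 ^ W) (hy : ∀ w < n, s.bank 2 w = y w) (hyK : ∀ w < n, y w < 2 ^ K)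
    (hW : B * (2 ^ (K * q) * B ^ B) < 2 ^ W) :
    Runs ρ W Z powerSums s ((((6 * B + 9) * q + 7) * B + 4) * n + 2)
      (fun s' => ∀ w < n, ∀ m < B,
        s'.bank 3 ((w * B + m : ℕ) : ℤ) = ColoringTable.powerSum q (y w) m) := by
  have hcast : ∀ w m, ColoringTable.powerSum q (y w) m = (∑ t ∈ range q, y w ^ t * t ^ m : ℕ) := by
    intro w m; simp [ColoringTable.powerSum]
  simp only [hcast]
  refine Runs.for (L := n) (m := ((6 * B + 9) * q + 7) * B + 2)
    (fun j s' => ∀ w < j, ∀ m < B,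
      s'.bank 3 ((w * B + m : ℕ) : ℤ) = (∑ t ∈ range q, y w ^ t * t ^ m : ℕ)) hs
    (le_trans (by decide) hZ) (by omega) (hnB.trans_lt hBW) rfl
    (fun s' hf => by simp [hf.reg 1 rfl, h1])
    (by simp) (fun j hj s' hs' hf hx hI => ?_)
  refine Runs.mono (Runs.for (L := B) (m := (6 * B + 9) * q + 5)
    (fun l s' => (∀ w < j, ∀ m < B,
      s'.bank 3 ((w * B + m : ℕ) : ℤ) = (∑ t ∈ range q, y w ^ t * t ^ m : ℕ)) ∧
      ∀ m < l, s'.bank 3 ((j * B + m : ℕ) : ℤ) = (∑ t ∈ range q, y j ^ t * t ^ m : ℕ)) hs'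
    (le_trans (by decide) hZ) (by omega) hBW rfl
    (fun s' hf1 => by simp [hf1.reg 3 rfl, hf.reg 3 rfl, h3])
    (by simpa using hI) (fun l hl s1 hs1 hf1 hl1 hI1 => ?_)) le_rfl (fun s1 _ _ h => ?_)
  · refine Runs.le (m := 1 + ((6 * B + 7 + 2) * q + 2 + 2)) ?_
      (by simp only [Nat.add_assoc, Nat.reduceAdd]; omega)
    refine Runs.assign_seq hs1 (le_trans (by decide) hZ) bitLen_zero_le fun hs2 => ?_
    have hB1 : 1 ≤ B := by omega
    have hbd : ∀ x ≤ q, ∑ t ∈ range x, y j ^ t * t ^ l < 2 ^ W := fun x hx => by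
      refine lt_of_le_of_lt ?_ hW
      calc ∑ t ∈ range x, y j ^ t * t ^ l ≤ ∑ _t ∈ range x, 2 ^ (K * q) * B ^ B :=
            sum_le_sum fun t ht => by
              have := mem_range.1 ht
              exact pow_mul_pow_le (hyK j hj) (by omega) (by omega) hB1 hl.le
        _ = x * (2 ^ (K * q) * B ^ B) := by simp
        _ ≤ _ := Nat.mul_le_mul_right _ (hx.trans hqB)
    have hbd' : ∀ i ≤ q, ∀ t ≤ B, ∀ k ≤ B, y j ^ i * t ^ k < 2 ^ W := fun i hi t ht k hk => by
      refine lt_of_le_of_lt (pow_mul_pow_le (hyK j hj) hi ht hB1 hk) (lt_of_le_of_lt ?_ hW)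
      exact Nat.le_mul_of_pos_left _ hB1
    have hf18 : s1.reg 18 = j := by rw [hf1.reg 18 rfl, hx]
    have hy1 : s1.bank 2 j = y j := by rw [hf1.bank 2 rfl, hf.bank 2 rfl, hy j hj]
    refine (Runs.for (L := q) (m := 6 * B + 7)
      (fun x s'' => s''.reg 15 = (∑ t ∈ range x, y j ^ t * t ^ l : ℕ)) hs2
      (le_trans (by decide) hZ) (by omega) (hqB.trans_lt hBW) rfl
      (fun s'' hf2 => by simp [hf2.reg 2 rfl, hf1.reg 2 rfl, hf.reg 2 rfl, h2]) (by simp)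
      (fun x hx2 s3 hs3 hf3 hx3 hI3 => ?_)).seq (fun s3 hs3 hf3 hI3 => ?_)
    · have h18 : s3.reg 18 = j := by simp [hf3.reg 18 rfl, hf18]
      have h17 : s3.reg 17 = l := by simp [hf3.reg 17 rfl, hl1]
      have hy3 : s3.bank 2 j = y j := by simp [hf3.bank 2 rfl, hy1]
      refine Runs.le (m := 1 + ((1 + 2) * x + 2 + ((1 + 2) * l + 2 + 1))) ?_ (by omega)
      refine Runs.assign_seq hs3 (le_trans (by decide) hZ) ?_ fun hs4 => ?_
      · simpa using bitLen_natCast_le (hbd' 0 (by omega) 0 (by omega) 0 (by omega))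
      refine (Runs.for (L := x) (m := 1)
        (fun i s'' => s''.reg 20 = (y j ^ i : ℕ)) hs4
        (le_trans (by decide) hZ) (by omega) (by omega) rfl
        (fun s'' hf4 => by simp [hf4.reg 21 rfl, hx3]) (by simp)
        (fun i hi s5 hs5 hf5 hi5 hI5 => ?_)).seq (fun s5 hs5 hf5 hI5 => ?_)
      · have hv : (Expr.reg 20 * .cell 2 (.reg 18)).val s5 = (y j ^ (i + 1) : ℕ) := by
          simp [hf5.reg 18 rfl, h18, hf5.bank 2 rfl, hy3, hI5, pow_succ]
        refine Runs.assign hs5 (le_trans (by decide) hZ) ?_ ?_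
        · rw [hv]
          simpa using bitLen_natCast_le (hbd' (i + 1) (by omega) 0 (by omega) 0 (by omega))
        · rw [hv]; simp
      · have h21 : s5.reg 21 = x := by simp [hf5.reg 21 rfl, hx3]
        have h17 : s5.reg 17 = l := by simp [hf5.reg 17 rfl, h17]
        refine (Runs.for (L := l) (m := 1)
          (fun i s'' => s''.reg 20 = (y j ^ x * x ^ i : ℕ)) hs5
          (le_trans (by decide) hZ) (by omega) (by omega) rfl
          (fun s'' hf4 => by simp [hf4.reg 17 rfl, h17]) (by simp [hI5])
          (fun i hi s6 hs6 hf6 hi6 hI6 => ?_)).seq (fun s6 hs6 hf6 hI6 => ?_)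
        · have hv : (Expr.reg 20 * .reg 21).val s6 = (y j ^ x * x ^ (i + 1) : ℕ) := by
            simp [hf6.reg 21 rfl, h21, hI6, pow_succ]; ring
          refine Runs.assign hs6 (le_trans (by decide) hZ) ?_ ?_
          · rw [hv]
            exact bitLen_natCast_le (hbd' x (by omega) x (by omega) (i + 1) (by omega))
          · rw [hv]; simp
        · have hv : (Expr.reg 15 + .reg 20).val s6
              = (∑ t ∈ range (x + 1), y j ^ t * t ^ l : ℕ) := by
            simp [hf6.reg 15 rfl, hf5.reg 15 rfl, hI3, hI6, sum_range_succ]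
          refine Runs.assign hs6 (le_trans (by decide) hZ) ?_ ?_
          · rw [hv]
            exact bitLen_natCast_le (hbd _ hx2)
          · rw [hv]; simp
    · have h18 : s3.reg 18 = j := by simp [hf3.reg 18 rfl, hf18]
      have h17 : s3.reg 17 = l := by simp [hf3.reg 17 rfl, hl1]
      have h3' : s3.reg 3 = B := by
        simp [hf3.reg 3 rfl, hf1.reg 3 rfl, hf.reg 3 rfl, h3]
      have hv : (Expr.reg 18 * rB + .reg 17).val s3 = ((j * B + l : ℕ) : ℤ) := by
        simp [h18, h17, h3']
      refine Runs.store hs3 (le_trans (by decide) hZ) (le_trans (by decide) hZ) ?_ ?_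
      · simp only [val_reg, hI3]; exact bitLen_natCast_le (hbd _ le_rfl)
      · rw [hv]
        simp only [val_reg, hI3, State.setReg_bank, State.setCell_bank, hf3.bank 3 rfl,
          Nat.cast_inj, true_and]
        refine ⟨fun w hw m hm => ?_, fun m hm => ?_⟩
        · rw [if_neg (mt (mul_add_inj hm hl).1 (by omega))]
          exact hI1.1 w hw m hm
        · split_ifs with h
          · rw [((mul_add_inj (by omega) hl).1 h).2]
          · exact hI1.2 m (by omega)
  · intro w hw m hm
    rcases Nat.lt_succ_iff_lt_or_eq.1 hw with h' | rfl
    · exact h.1 w h' m hm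
    · exact h.2 m hm

/-! ### Addresses of table entries -/

/-- The number with the digits `e 0, …, e (n - 1)` in base `B`. -/
def address (n B : ℕ) (e : ℕ → ℕ) : ℕ := ∑ w ∈ range n, e w * B ^ w

theorem address_lt {n B : ℕ} {e : ℕ → ℕ} (h : ∀ w < n, e w < B) : address n B e < B ^ n := by
  induction n with
  | zero => simp [address]
  | succ n ih =>
    have h1 := ih fun w hw => h w (by omega)
    have h2 := h n (by omega)
    unfold address at h1 ⊢
    rw [sum_range_succ, pow_succ]
    calc _ < B ^ n + e n * B ^ n := by omega
      _ = (e n + 1) * B ^ n := by ring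
      _ ≤ B * B ^ n := Nat.mul_le_mul_right _ h2
      _ = _ := by ring

theorem address_mono {n n' B : ℕ} (e : ℕ → ℕ) (h : n ≤ n') : address n B e ≤ address n' B e :=
  sum_le_sum_of_subset (range_mono h)

theorem address_inj {n B : ℕ} {e e' : ℕ → ℕ} (h : ∀ w < n, e w < B) (h' : ∀ w < n, e' w < B)
    (heq : address n B e = address n B e') : ∀ w < n, e w = e' w := by
  induction n with
  | zero => simp
  | succ n ih =>
    have h1 : address n B e < B ^ n := address_lt fun w hw => h w (by omega)
    have h2 : address n B e' < B ^ n := address_lt fun w hw => h' w (by omega)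
    have h3 : e n * B ^ n + address n B e = e' n * B ^ n + address n B e' := by
      have := heq
      unfold address at this ⊢
      rw [sum_range_succ, sum_range_succ] at this
      omega
    obtain ⟨h4, h5⟩ := (mul_add_inj h1 h2).1 h3
    intro w hw
    rcases Nat.lt_succ_iff_lt_or_eq.1 hw with hw | rfl
    · exact ih (fun w hw => h w (by omega)) (fun w hw => h' w (by omega)) h5 w hw
    · exact h4

theorem address_update {n B u : ℕ} (hu : u < n) (e : ℕ → ℕ) (a : ℕ) :
    (address n B (Function.update e u a) : ℤ) = address n B e + (a - e u) * (B : ℤ) ^ u := by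
  have hu' : u ∈ range n := mem_range.2 hu
  unfold address
  rw [← add_sum_erase _ _ hu', ← add_sum_erase _ (fun w => e w * B ^ w) hu']
  have : ∑ w ∈ (range n).erase u, Function.update e u a w * B ^ w
      = ∑ w ∈ (range n).erase u, e w * B ^ w :=
    sum_congr rfl fun w hw => by rw [Function.update_of_ne (mem_erase.1 hw).1]
  rw [this]
  simp
  ring

/-- The digits of `i` in the mixed radix system `r`. -/
def digit (r : ℕ → ℕ) (i w : ℕ) : ℕ := i / (∏ x ∈ range w, r x) % r w

/-- Every table index is the digit vector of some number, so a single loop visits all of them. -/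
theorem exists_digit_eq {n : ℕ} {r e : ℕ → ℕ} (he : ∀ w < n, e w < r w) :
    ∃ i < ∏ w ∈ range n, r w, ∀ w < n, digit r i w = e w := by
  induction n with
  | zero => exact ⟨0, by simp⟩
  | succ n ih =>
    obtain ⟨i, hi, hd⟩ := ih fun w hw => he w (by omega)
    have hn := he n (by omega)
    set P := ∏ w ∈ range n, r w with hP
    refine ⟨i + P * e n, ?_, fun w hw => ?_⟩
    · rw [prod_range_succ]
      calc _ < P + P * e n := by omega
        _ = P * (e n + 1) := by ring
        _ ≤ _ := Nat.mul_le_mul_left _ hn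
    · rcases Nat.lt_succ_iff_lt_or_eq.1 hw with hw | rfl
      · rw [← hd w hw]
        unfold digit
        have hdvd : (∏ x ∈ range w, r x) * r w ∣ P * e n := by
          rw [← prod_range_succ]
          exact Dvd.dvd.mul_right (prod_dvd_prod_of_subset _ _ _ (range_mono hw)) _
        obtain ⟨c, hc⟩ := hdvd
        have hpos : 0 < ∏ x ∈ range w, r x := prod_pos fun x hx => by
          have := he x (by have := mem_range.1 hx; omega)
          omega
        rw [hc, mul_assoc, Nat.add_mul_div_left _ _ hpos, Nat.add_mul_mod_self_left]
      · unfold digit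
        rw [← hP, Nat.add_mul_div_left _ _ (by omega), Nat.div_eq_of_lt hi, zero_add,
          Nat.mod_eq_of_lt hn]

/-! ### The program for one table -/

/-- The expression for `radix d k`, a minimum that is computed from a comparison. -/
def radixExpr (d k : Expr) : Expr :=
  k * .op .lt k (d - k) + (d - k) * (1 - .op .lt k (d - k)) + 1

/-- The expression for the entry of the update matrix of the vertex in register `x`. -/
def updateExpr (x : ℕ) (b a : Expr) : Expr :=
  (1 - .op .lt (.cell 1 (.reg x)) (2 * .cell 5 (.reg x) + 2)) * .op .eq (.cell 9 (.reg x)) (a + b) +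
  .op .lt (.cell 1 (.reg x)) (2 * .cell 5 (.reg x) + 2) *
    ((1 - .op .lt (.cell 1 (.reg x)) (2 * .cell 5 (.reg x))) *
      .cell 3 (.reg x * rB + (a + b + .cell 9 (.reg x))) +
    .op .lt (.cell 1 (.reg x)) (2 * .cell 5 (.reg x)) * .op .eq a (.cell 9 (.reg x) + b))

/-- Compute the numbers of indices of all vertices after the edge in the registers `9` and `10` is
introduced, and the size of the table. -/
def sizes : Program :=
  .assign 12 1 ;;
  .for 18 rn (
    .store 8 (.reg 18) (radixExpr (.cell 1 (.reg 18))
      (.cell 5 (.reg 18) + .op .eq (.reg 18) (.reg 9) + .op .eq (.reg 18) (.reg 10))) ;;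
    .assign 12 (.reg 12 * .cell 8 (.reg 18)))

/-- Compute the table index with number `reg 11` and its address. -/
def decode : Program :=
  .assign 13 (.reg 11) ;; .assign 14 0 ;;
  .for 18 rn (
    .store 9 (.reg 18) (.reg 13 % .cell 8 (.reg 18)) ;;
    .assign 14 (.reg 14 + .cell 9 (.reg 18) * .cell 4 (.reg 18)) ;;
    .assign 13 (.reg 13 / .cell 8 (.reg 18)))

/-- One summand of the recurrence for the tables. -/
def summand : Expr :=
  (updateExpr 9 1 (.reg 16) * updateExpr 10 0 (.reg 17) -
    updateExpr 9 0 (.reg 16) * updateExpr 10 1 (.reg 17)) *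
  .cell 7 (.reg 7 * rBN + .reg 14 + (.reg 16 - .cell 9 (.reg 9)) * .cell 4 (.reg 9) +
    (.reg 17 - .cell 9 (.reg 10)) * .cell 4 (.reg 10))

/-- Compute one table entry by the recurrence. -/
def entry : Program :=
  decode ;; .assign 15 0 ;;
  .for 16 (radixExpr (.cell 1 (.reg 9)) (.cell 5 (.reg 9)))
    (.for 17 (radixExpr (.cell 1 (.reg 10)) (.cell 5 (.reg 10)))
      (.assign 15 (.reg 15 + summand))) ;;
  .store 7 ((.reg 7 + 1) * rBN + .reg 14) (.reg 15)

theorem radixExpr_val {d k : Expr} {D i : ℕ} (hd : d.val s = D) (hk : k.val s = i) (h : i ≤ D) :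
    (radixExpr d k).val s = radix D i := by
  simp only [radixExpr, val_add, val_mul, val_sub, val_lt, val_one, hd, hk, radix]
  split_ifs with h1
  · rw [min_eq_left (by omega)]; simp
  · rw [min_eq_right (by omega)]; push_cast [h]; ring

theorem radix_le {d k : ℕ} : radix d k ≤ d + 1 := by unfold radix; omega

/-- The data that stay fixed while the tables are computed. -/
structure Fixed (n B len : ℕ) (d : ℕ → ℕ) (S : ℕ → ℕ → ℤ) (kd ku kv : ℕ → ℕ) (s : State) :
    Prop where
  reg_n : s.reg 1 = n
  reg_B : s.reg 3 = B
  reg_len : s.reg 4 = len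
  reg_BN : s.reg 6 = (B ^ n : ℕ)
  kind : ∀ j < len, s.bank 0 (3 + n * n + j * (n + 3)) = kd j
  left : ∀ j < len, s.bank 0 (3 + n * n + j * (n + 3) + 1) = ku j
  right : ∀ j < len, s.bank 0 (3 + n * n + j * (n + 3) + 2) = kv j
  degree : ∀ w < n, s.bank 1 w = d w
  sums : ∀ w < n, ∀ m < B, s.bank 3 ((w * B + m : ℕ) : ℤ) = S w m
  pow : ∀ w < n, s.bank 4 w = (B ^ w : ℕ)

/-- The state after the edges in `E` are introduced. The addresses of the table entries have the
number of introduced edges as leading digit, so a new table never overwrites an old one. -/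
structure Introduced (n B : ℕ) (d : ℕ → ℕ) (S : ℕ → ℕ → ℤ) (E : List (ℕ × ℕ)) (s : State) :
    Prop where
  time : s.reg 7 = E.length
  degree : ∀ w < n, s.bank 5 w = deg E w
  mark : ∀ u < n, ∀ v < n,
    s.bank 6 ((u * n + v : ℕ) : ℤ) = if (u, v) ∈ E ∨ (v, u) ∈ E then 1 else 0
  table : ∀ e : ℕ → ℕ, (∀ w < n, e w < radix (d w) (deg E w)) →
    s.bank 7 ((E.length * B ^ n + address n B e : ℕ) : ℤ) = table n d S E e

theorem Fixed.frame {n B len : ℕ} {d : ℕ → ℕ} {S : ℕ → ℕ → ℤ} {kd ku kv : ℕ → ℕ} {c : Program}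
    {s' : State} (h : Fixed n B len d S kd ku kv s) (hf : Frame c s s')
    (hr : (c.writes 1 || c.writes 3 || c.writes 4 || c.writes 6) = false)
    (hb : (c.stores 0 || c.stores 1 || c.stores 3 || c.stores 4) = false) :
    Fixed n B len d S kd ku kv s' := by
  simp only [Bool.or_eq_false_iff] at hr hb
  obtain ⟨⟨⟨r1, r3⟩, r4⟩, r6⟩ := hr
  obtain ⟨⟨⟨b0, b1⟩, b3⟩, b4⟩ := hb
  refine ⟨?_, ?_, ?_, ?_, ?_, ?_, ?_, ?_, ?_, ?_⟩
  · rw [hf.reg _ r1, h.reg_n]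
  · rw [hf.reg _ r3, h.reg_B]
  · rw [hf.reg _ r4, h.reg_len]
  · rw [hf.reg _ r6, h.reg_BN]
  · rw [hf.bank _ b0]; exact h.kind
  · rw [hf.bank _ b0]; exact h.left
  · rw [hf.bank _ b0]; exact h.right
  · rw [hf.bank _ b1]; exact h.degree
  · rw [hf.bank _ b3]; exact h.sums
  · rw [hf.bank _ b4]; exact h.pow

theorem frame_assign (s : State) (x : ℕ) (e : Expr) (z : ℤ) :
    Frame (.assign x e) s (s.setReg x z) := by
  refine ⟨fun r hr => ?_, fun _ _ => rfl, fun _ => rfl⟩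
  have : r ≠ x := by simpa [Program.writes] using hr
  simp [this]

theorem frame_store (s : State) (a : ℕ) (i e : Expr) (y z : ℤ) :
    Frame (.store a i e) s (s.setCell a y z) := by
  refine ⟨fun _ _ => rfl, fun b hb => ?_, fun _ => rfl⟩
  have : b ≠ a := by simpa [Program.stores] using hb
  funext j
  simp [this]

theorem updateExpr_val {x w B D k e a b : ℕ} {bE aE : Expr} {Sw : ℕ → ℤ} (hx : s.reg x = w)
    (h3 : s.reg 3 = B) (hD : s.bank 1 w = D) (hk : s.bank 5 w = k) (he : s.bank 9 w = e)
    (hS : ∀ m < B, s.bank 3 ((w * B + m : ℕ) : ℤ) = Sw m) (hb : bE.val s = b) (ha : aE.val s = a)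
    (hDB : D < B) (hkD : k < D) (hb1 : b ≤ 1) (ha' : a < radix D k) (he' : e < radix D (k + 1)) :
    (updateExpr x bE aE).val s = update D Sw k b e a := by
  simp only [updateExpr, val_add, val_mul, val_sub, val_lt, val_eq, val_one, val_two, val_cell,
    val_reg, hx, hD, hk, he, hb, ha, h3]
  unfold radix at ha' he'
  unfold update
  have c1 : (if (D : ℤ) < 2 * k + 2 then (1 : ℤ) else 0) = if 2 * (k + 1) ≤ D then 0 else 1 := by
    split_ifs <;> omega
  have c2 : (if (D : ℤ) < 2 * k then (1 : ℤ) else 0) = if 2 * k ≤ D then 0 else 1 := by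
    split_ifs <;> omega
  have c3 : (if (e : ℤ) = a + b then (1 : ℤ) else 0) = if e = a + b then 1 else 0 := by
    split_ifs <;> omega
  have c4 : (if (a : ℤ) = e + b then (1 : ℤ) else 0) = if a = e + b then 1 else 0 := by
    split_ifs <;> omega
  rw [c1, c2, c3, c4]
  by_cases h1 : 2 * (k + 1) ≤ D
  · rw [if_pos h1, if_pos h1]; ring
  · rw [if_neg h1, if_neg h1]
    by_cases h2 : 2 * k ≤ D
    · have := hS (a + b + e) (by omega)
      push_cast at this
      rw [if_pos h2, if_pos h2, this]; ring
    · rw [if_neg h2, if_neg h2]; ring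

theorem sizes_spec {n u v : ℕ} {d r : ℕ → ℕ} {E : List (ℕ × ℕ)} (hs : s.Bounded W) (hZ : 400 ≤ Z)
    (h1 : s.reg 1 = n) (h9 : s.reg 9 = u) (h10 : s.reg 10 = v)
    (hd : ∀ w < n, s.bank 1 w = d w) (hk : ∀ w < n, s.bank 5 w = deg E w)
    (hr : r = fun w => radix (d w) (deg ((u, v) :: E) w))
    (hle : ∀ w < n, deg ((u, v) :: E) w ≤ d w)
    (hnW : n < 2 ^ W) (hW : ∏ w ∈ range n, r w < 2 ^ W) :
    Runs ρ W Z sizes s (5 * n + 3)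
      (fun s' => (∀ w < n, s'.bank 8 w = r w) ∧ s'.reg 12 = (∏ w ∈ range n, r w : ℕ)) := by
  have hr1 : ∀ w, 1 ≤ r w := fun w => by simp [hr, radix]
  have hbd : ∀ x ≤ n, ∏ w ∈ range x, r w < 2 ^ W := fun x hx =>
    (prod_le_prod_of_subset_of_one_le' (range_mono hx) fun w _ _ => hr1 w).trans_lt hW
  have hbd' : ∀ w < n, r w < 2 ^ W := fun w hw =>
    (single_le_prod' (fun w _ => hr1 w) (mem_range.2 hw)).trans_lt hW
  have hW1 : 1 ≤ W := by
    by_contra h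
    have h2 : W = 0 := by omega
    have := hbd 0 (by omega)
    simp [h2] at this
  refine Runs.le (m := 1 + ((3 + 2) * n + 2)) ?_ (by omega)
  refine Runs.assign_seq hs (le_trans (by decide) hZ) (bitLen_one_le hW1) fun hs1 => ?_
  refine Runs.for (L := n) (m := 3)
    (fun j s' => (∀ w < j, s'.bank 8 w = r w) ∧ s'.reg 12 = (∏ w ∈ range j, r w : ℕ)) hs1
    (le_trans (by decide) hZ) (by omega) hnW rfl (fun s' hf => by simp [hf.reg 1 rfl, h1])
    (by simp) (fun j hj s' hs' hf hx hI => ?_)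
  refine Runs.le (m := 2 + 1) ?_ le_rfl
  have hv : (radixExpr (.cell 1 (.reg 18)) (.cell 5 (.reg 18) +
      .op .eq (.reg 18) (.reg 9) + .op .eq (.reg 18) (.reg 10))).val s' = r j := by
    rw [hr]
    refine radixExpr_val ?_ ?_ (hle j hj)
    · simp [hx, hf.bank 1 rfl, hd j hj]
    · simp [hx, hf.bank 5 rfl, hk j hj, hf.reg 9 rfl, hf.reg 10 rfl, h9, h10, deg]
  refine Runs.store_seq hs' (le_trans (by decide) hZ) (le_trans (by decide) hZ) ?_ fun hs2 => ?_
  · rw [hv]; exact bitLen_natCast_le (hbd' j hj)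
  · rw [hv] at hs2 ⊢
    have hv2 : (Expr.reg 12 * .cell 8 (.reg 18)).val
        (s'.setCell 8 (Expr.val s' (.reg 18)) (r j)) = (∏ w ∈ range (j + 1), r w : ℕ) := by
      simp [hI.2, prod_range_succ]
    refine Runs.assign hs2 (le_trans (by decide) hZ) ?_ ?_
    · rw [hv2]; exact bitLen_natCast_le (hbd _ hj)
    · refine ⟨fun w hw => ?_, ?_⟩
      · simp only [val_reg, hx, State.setReg_bank, State.setCell_bank, true_and, Nat.cast_inj]
        split_ifs with hwj
        · rw [hwj]
        · exact hI.1 w (by omega)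
      · rw [hv2]; simp

theorem decode_spec {n B i : ℕ} {r : ℕ → ℕ} (hs : s.Bounded W) (hZ : 400 ≤ Z)
    (h1 : s.reg 1 = n) (h11 : s.reg 11 = i) (h4 : ∀ w < n, s.bank 4 w = (B ^ w : ℕ))
    (h8 : ∀ w < n, s.bank 8 w = r w) (hr : ∀ w < n, 1 ≤ r w) (hrB : ∀ w < n, r w ≤ B)
    (hnW : n < 2 ^ W) (hi : i < 2 ^ W) (hW : B ^ n < 2 ^ W) :
    Runs ρ W Z decode s (6 * n + 4)
      (fun s' => (∀ w < n, s'.bank 9 w = digit r i w) ∧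
        s'.reg 14 = address n B (digit r i)) := by
  have hdB : ∀ w < n, digit r i w < B := fun w hw =>
    (Nat.mod_lt _ (hr w hw)).trans_le (hrB w hw)
  refine Runs.le (m := 1 + (1 + ((4 + 2) * n + 2))) ?_ (by omega)
  refine Runs.assign_seq hs (le_trans (by decide) hZ) (hs.reg _) fun hs1 => ?_
  refine Runs.assign_seq hs1 (le_trans (by decide) hZ) bitLen_zero_le fun hs1 => ?_
  refine Runs.mono (Runs.for (L := n) (m := 4)
    (fun j s' => (∀ w < j, s'.bank 9 w = digit r i w) ∧
      s'.reg 13 = (i / ∏ x ∈ range j, r x : ℕ) ∧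
        s'.reg 14 = address j B (digit r i)) hs1
    (le_trans (by decide) hZ) (by omega) hnW rfl (fun s' hf => by simp [hf.reg 1 rfl, h1])
    (by simp [h11, address]) (fun j hj s' hs' hf hx hI => ?_)) le_rfl
    (fun s' _ _ h => ⟨h.1, h.2.2⟩)
  obtain ⟨hI1, hI2, hI3⟩ := hI
  have h8' : s'.bank 8 j = r j := by simp [hf.bank 8 rfl, h8 j hj]
  have h4' : s'.bank 4 j = (B ^ j : ℕ) := by
    simp only [hf.bank 4 rfl, State.setReg_bank]; exact h4 j hj
  have hv1 : (Expr.reg 13 % .cell 8 (.reg 18)).val s' = digit r i j := by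
    simp [hx, h8', hI2, digit]
  refine Runs.le (m := 2 + (1 + 1)) ?_ le_rfl
  refine Runs.store_seq hs' (le_trans (by decide) hZ) (le_trans (by decide) hZ) ?_ fun hs2 => ?_
  · rw [hv1]
    refine bitLen_natCast_le (lt_of_le_of_lt ?_ hi)
    exact (Nat.mod_le _ _).trans (Nat.div_le_self _ _)
  rw [hv1] at hs2 ⊢
  simp only [val_reg, hx] at hs2 ⊢
  have hv2 : (Expr.reg 14 + .cell 9 (.reg 18) * .cell 4 (.reg 18)).val
      (s'.setCell 9 j (digit r i j)) = address (j + 1) B (digit r i) := by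
    have h4'' := h4'
    push_cast at h4''
    simp [hx, hI3, address, sum_range_succ, h4'']
  refine Runs.assign_seq hs2 (le_trans (by decide) hZ) ?_ fun hs3 => ?_
  · rw [hv2]
    exact bitLen_natCast_le (((address_mono _ hj).trans_lt (address_lt hdB)).trans hW)
  rw [hv2] at hs3 ⊢
  have hv3 : (Expr.reg 13 / .cell 8 (.reg 18)).val ((s'.setCell 9 j (digit r i j)).setReg 14
      (address (j + 1) B (digit r i))) = (i / ∏ x ∈ range (j + 1), r x : ℕ) := by
    rw [prod_range_succ, ← Nat.div_div_eq_div_mul, Int.natCast_ediv, ← h8', ← hI2]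
    simp [hx]
  refine Runs.assign hs3 (le_trans (by decide) hZ) ?_ ⟨fun w hw => ?_, ?_, ?_⟩
  · rw [hv3]
    exact bitLen_natCast_le (lt_of_le_of_lt (Nat.div_le_self _ _) hi)
  · simp only [State.setReg_bank, State.setCell_bank, true_and, Nat.cast_inj]
    split_ifs with hwj
    · rw [hwj]
    · exact hI1 w (by omega)
  · rw [hv3]; simp
  · simp

theorem bitLen_le_of_abs_le {z X : ℤ} (h : |z| ≤ X) (hX : X < 2 ^ W) : bitLen z ≤ W := by
  rw [bitLen_le_iff]
  zify
  exact h.trans_lt hX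

/-- The program `entry` writes one entry of the new table and changes nothing else in bank `7`. The
number `2 Sm ^ 2 Tm` bounds the summands of the recurrence. -/
theorem entry_spec {n B len i u v : ℕ} {d : ℕ → ℕ} {S : ℕ → ℕ → ℤ} {kd ku kv r : ℕ → ℕ}
    {E : List (ℕ × ℕ)} {Sm Tm : ℤ} (hs : s.Bounded W) (hZ : 400 ≤ Z)
    (hF : Fixed n B len d S kd ku kv s) (h9 : s.reg 9 = u) (h10 : s.reg 10 = v)
    (h7 : s.reg 7 = E.length) (h11 : s.reg 11 = i) (h5 : ∀ w < n, s.bank 5 w = deg E w)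
    (h8 : ∀ w < n, s.bank 8 w = r w)
    (hT : ∀ e : ℕ → ℕ, (∀ w < n, e w < radix (d w) (deg E w)) →
      s.bank 7 ((E.length * B ^ n + address n B e : ℕ) : ℤ) = table n d S E e)
    (hr : r = fun w => radix (d w) (deg ((u, v) :: E) w))
    (hu : u < n) (hv : v < n) (huv : u ≠ v) (hdu : deg E u < d u) (hdv : deg E v < d v)
    (hdB : ∀ w < n, d w < B) (hSm : 1 ≤ Sm) (hS : ∀ w < n, ∀ i ≤ d w, |S w i| ≤ Sm)
    (hTm : ∀ e : ℕ → ℕ, (∀ w < n, e w < radix (d w) (deg E w)) → |table n d S E e| ≤ Tm)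
    (hnW : n < 2 ^ W) (hi : i < 2 ^ W) (hBW : B ^ n < 2 ^ W) (hB : B < 2 ^ W)
    (hW : (B : ℤ) * B * (2 * Sm ^ 2 * Tm) < 2 ^ W) :
    Runs ρ W Z entry s (6 * n + 4 + (1 + ((3 * B + 4) * B + 2 + 2)))
      (fun s' => ∀ A : ℤ, s'.bank 7 A =
        if A = (((E.length + 1) * B ^ n + address n B (digit r i) : ℕ) : ℤ)
          then table n d S ((u, v) :: E) (digit r i) else s.bank 7 A) := by
  have hr1 : ∀ w < n, 1 ≤ r w := fun w _ => by simp [hr, radix]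
  have hrB : ∀ w < n, r w ≤ B := fun w hw => by
    have := hdB w hw
    have : r w ≤ d w + 1 := by rw [hr]; exact radix_le
    omega
  set e := digit r i with he
  have hev : ∀ w < n, e w < r w := fun w hw => Nat.mod_lt _ (hr1 w hw)
  refine (decode_spec hs hZ hF.reg_n h11 hF.pow h8 hr1 hrB hnW hi hBW).seq
    fun s1 hs1 hf1 h1 => ?_
  obtain ⟨h1d, h1a⟩ := h1
  rw [← he] at h1a
  have hF1 := hF.frame hf1 rfl rfl
  have h9' : s1.reg 9 = u := by rw [hf1.reg 9 rfl, h9]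
  have h10' : s1.reg 10 = v := by rw [hf1.reg 10 rfl, h10]
  have h7' : s1.reg 7 = E.length := by rw [hf1.reg 7 rfl, h7]
  have h5' : ∀ w < n, s1.bank 5 w = deg E w := by rw [hf1.bank 5 rfl]; exact h5
  have h7b : s1.bank 7 = s.bank 7 := hf1.bank 7 rfl
  refine Runs.assign_seq hs1 (le_trans (by decide) hZ) bitLen_zero_le fun hs2 => ?_
  set ru := radix (d u) (deg E u) with hru
  set rv := radix (d v) (deg E v) with hrv
  have hruB : ru ≤ B := by
    have := hdB u hu
    have : ru ≤ d u + 1 := radix_le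
    omega
  have hrvB : rv ≤ B := by
    have := hdB v hv
    have : rv ≤ d v + 1 := radix_le
    omega
  have heu : e u < radix (d u) (deg E u + 1) := by
    have := hev u hu
    simpa [hr, deg, huv] using this
  have hevv : e v < radix (d v) (deg E v + 1) := by
    have := hev v hv
    simpa [hr, deg, huv.symm] using this
  set f : ℕ → ℕ → ℤ := fun a b =>
    (update (d u) (S u) (deg E u) 1 (e u) a * update (d v) (S v) (deg E v) 0 (e v) b -
      update (d u) (S u) (deg E u) 0 (e u) a * update (d v) (S v) (deg E v) 1 (e v) b) *
      table n d S E (Function.update (Function.update e u a) v b) with hf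
  have hvalid : ∀ a < ru, ∀ b < rv, ∀ w < n,
      Function.update (Function.update e u a) v b w < radix (d w) (deg E w) := by
    intro a ha b hb w hw
    by_cases hwv : w = v
    · subst hwv; simpa using hb
    by_cases hwu : w = u
    · subst hwu; simpa [hwv] using ha
    have := hev w hw
    simpa [hwv, hwu, hr, deg] using this
  have hTm0 : 0 ≤ Tm := (abs_nonneg _).trans
    (hTm (Function.update (Function.update e u 0) v 0)
      (hvalid 0 (by rw [hru]; simp [radix]) 0 (by rw [hrv]; simp [radix])))
  set X : ℤ := 2 * Sm ^ 2 * Tm with hX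
  have hX0 : 0 ≤ X := by positivity
  have hfX : ∀ a < ru, ∀ b < rv, |f a b| ≤ X := by
    intro a ha b hb
    have t := hTm _ (hvalid a ha b hb)
    have a1 := abs_update_le (b := 1) hSm (hS u hu) le_rfl hdu ha heu
    have a0 := abs_update_le (b := 0) hSm (hS u hu) zero_le_one hdu ha heu
    have b1 := abs_update_le (b := 1) hSm (hS v hv) le_rfl hdv hb hevv
    have b0 := abs_update_le (b := 0) hSm (hS v hv) zero_le_one hdv hb hevv
    simp only [hf, abs_mul, hX]
    refine mul_le_mul ?_ t (abs_nonneg _) (by positivity)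
    refine (abs_sub _ _).trans ?_
    rw [abs_mul, abs_mul]
    have m1 := mul_le_mul a1 b0 (abs_nonneg _) (by linarith)
    have m2 := mul_le_mul a0 b1 (abs_nonneg _) (by linarith)
    linarith [sq Sm]
  -- All partial sums have to fit into `W` bits, not only the final entry.
  have hpart : ∀ a < ru, ∀ b ≤ rv,
      bitLen (∑ a' ∈ range a, ∑ b' ∈ range rv, f a' b' + ∑ b' ∈ range b, f a b') ≤ W := by
    intro a ha b hb
    refine bitLen_le_of_abs_le (X := B * B * X) ?_ hW
    have q1 : |∑ a' ∈ range a, ∑ b' ∈ range rv, f a' b'| ≤ a * (rv * X) := by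
      refine (abs_sum_le_sum_abs _ _).trans ?_
      refine (sum_le_sum (g := fun _ => (rv : ℤ) * X) fun a' ha' => ?_).trans (by simp)
      refine (abs_sum_le_sum_abs _ _).trans ?_
      refine (sum_le_sum (g := fun _ => X) fun b' hb' => ?_).trans (by simp)
      exact hfX a' (by have := mem_range.1 ha'; omega) b' (mem_range.1 hb')
    have q2 : |∑ b' ∈ range b, f a b'| ≤ b * X := by
      refine (abs_sum_le_sum_abs _ _).trans ?_
      refine (sum_le_sum (g := fun _ => X) fun b' hb' => ?_).trans (by simp)
      exact hfX a ha b' (by have := mem_range.1 hb'; omega)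
    have q3 : (a * rv + b : ℤ) ≤ B * B := by
      have : a * rv + b ≤ B * B := by
        calc a * rv + b ≤ a * rv + rv := by omega
          _ = (a + 1) * rv := by ring
          _ ≤ B * B := Nat.mul_le_mul (by omega) hrvB
      exact_mod_cast this
    calc _ ≤ _ := abs_add_le _ _
      _ ≤ a * (rv * X) + b * X := add_le_add q1 q2
      _ = (a * rv + b) * X := by ring
      _ ≤ _ := mul_le_mul_of_nonneg_right q3 hX0
  have hpart' : bitLen (∑ a' ∈ range ru, ∑ b' ∈ range rv, f a' b') ≤ W := by
    have hru1 : ru = (ru - 1) + 1 := by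
      have : 1 ≤ ru := by simp [hru, radix]
      omega
    rw [hru1, sum_range_succ]
    exact hpart _ (by omega) _ le_rfl
  refine (Runs.mono (m' := (3 * B + 4) * B + 2) (Runs.for (L := ru) (m := 3 * B + 2)
      (fun a s' => s'.reg 15 = ∑ a' ∈ range a, ∑ b' ∈ range rv, f a' b') hs2
      (le_trans (by decide) hZ) (by omega) (hruB.trans_lt hB) rfl
      (fun s' hf2 => ?_) (by simp) (fun a ha s3 hs3 hf3 ha3 hI3 => ?_)) ?_
      (fun s' _ _ h => h)).seq (fun s3 hs3 hf3 hI3 => ?_)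
  · refine radixExpr_val ?_ ?_ hdu.le
    · simp [hf2.reg 9 rfl, hf2.bank 1 rfl, h9', hF1.degree u hu]
    · simp [hf2.reg 9 rfl, hf2.bank 5 rfl, h9', h5' u hu]
  · refine Runs.mono (Runs.for (L := rv) (m := 1)
      (fun b s' => s'.reg 15 =
        ∑ a' ∈ range a, ∑ b' ∈ range rv, f a' b' + ∑ b' ∈ range b, f a b') hs3
      (le_trans (by decide) hZ) (by omega) (hrvB.trans_lt hB) rfl
      (fun s' hf4 => ?_) (by simp [hI3]) (fun b hb s5 hs5 hf5 hb5 hI5 => ?_)) (by omega)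
      (fun s' _ _ h => by simp [h, sum_range_succ])
    · refine radixExpr_val ?_ ?_ hdv.le
      · simp [hf4.reg 10 rfl, hf4.bank 1 rfl, hf3.reg 10 rfl, hf3.bank 1 rfl, h10',
          hF1.degree v hv]
      · simp [hf4.reg 10 rfl, hf4.bank 5 rfl, hf3.reg 10 rfl, hf3.bank 5 rfl, h10', h5' v hv]
    · have hF5 := ((hF1.frame (frame_assign s1 15 0 0) rfl rfl).frame hf3 rfl rfl).frame hf5 rfl rfl
      have g9 : s5.reg 9 = u := by simp [hf5.reg 9 rfl, hf3.reg 9 rfl, h9']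
      have g10 : s5.reg 10 = v := by simp [hf5.reg 10 rfl, hf3.reg 10 rfl, h10']
      have g7 : s5.reg 7 = E.length := by simp [hf5.reg 7 rfl, hf3.reg 7 rfl, h7']
      have g14 : s5.reg 14 = address n B e := by simp [hf5.reg 14 rfl, hf3.reg 14 rfl, h1a]
      have g16 : s5.reg 16 = a := by simp [hf5.reg 16 rfl, ha3]
      have g5 : s5.bank 5 = s1.bank 5 := by simp [hf5.bank 5 rfl, hf3.bank 5 rfl]
      have g9b : s5.bank 9 = s1.bank 9 := by simp [hf5.bank 9 rfl, hf3.bank 9 rfl]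
      have g7b : s5.bank 7 = s1.bank 7 := by simp [hf5.bank 7 rfl, hf3.bank 7 rfl]
      have hup : ∀ (bn : ℕ) (bE : Expr), bE.val s5 = bn → bn ≤ 1 →
          (updateExpr 9 bE (.reg 16)).val s5 = update (d u) (S u) (deg E u) bn (e u) a := by
        intro bn bE hbE hbn
        refine updateExpr_val g9 hF5.reg_B (hF5.degree u hu) ?_ ?_ (hF5.sums u hu) hbE ?_
          (hdB u hu) hdu hbn ha heu
        · rw [g5]; exact h5' u hu
        · rw [g9b]; exact h1d u hu
        · simp [g16]
      have hvp : ∀ (bn : ℕ) (bE : Expr), bE.val s5 = bn → bn ≤ 1 →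
          (updateExpr 10 bE (.reg 17)).val s5 = update (d v) (S v) (deg E v) bn (e v) b := by
        intro bn bE hbE hbn
        refine updateExpr_val g10 hF5.reg_B (hF5.degree v hv) ?_ ?_ (hF5.sums v hv) hbE ?_
          (hdB v hv) hdv hbn hb hevv
        · rw [g5]; exact h5' v hv
        · rw [g9b]; exact h1d v hv
        · simp [hb5]
      have haddr : (Expr.reg 7 * rBN + .reg 14 + (.reg 16 - .cell 9 (.reg 9)) * .cell 4 (.reg 9) +
          (.reg 17 - .cell 9 (.reg 10)) * .cell 4 (.reg 10)).val s5
          = ((E.length * B ^ n +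
              address n B (Function.update (Function.update e u a) v b) : ℕ) : ℤ) := by
        have p1 := hF5.pow u hu
        have p2 := hF5.pow v hv
        have p3 := hF5.reg_BN
        push_cast at p1 p2 p3 ⊢
        rw [address_update hv, address_update hu, Function.update_of_ne huv.symm]
        simp only [val_add, val_sub, val_mul, val_reg, val_cell, g7, p3, g14, g16, hb5, g9, g10,
          g9b, p1, p2, h1d u hu, h1d v hv]
        ring
      have hsum : summand.val s5 = f a b := by
        unfold summand
        rw [val_mul, val_sub, val_mul, val_mul, hup 1 1 rfl le_rfl, hup 0 0 rfl zero_le_one,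
          hvp 1 1 rfl le_rfl, hvp 0 0 rfl zero_le_one, val_cell, haddr, g7b, h7b,
          hT _ (hvalid a ha b hb)]
      have hval : (Expr.reg 15 + summand).val s5
          = ∑ a' ∈ range a, ∑ b' ∈ range rv, f a' b' + ∑ b' ∈ range (b + 1), f a b' := by
        rw [val_add, hsum, val_reg, hI5, sum_range_succ]; ring
      refine Runs.assign hs5 (le_trans (by decide) hZ) ?_ ?_
      · rw [hval]; exact hpart a ha _ hb
      · rw [hval]; simp
  · have : (3 * B + 2 + 2) * ru ≤ (3 * B + 4) * B := Nat.mul_le_mul le_rfl hruB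
    omega
  · have g7 : s3.reg 7 = E.length := by simp [hf3.reg 7 rfl, h7']
    have g6 : s3.reg 6 = (B ^ n : ℕ) := by
      rw [hf3.reg 6 rfl, State.setReg_reg, if_neg (by decide), hF1.reg_BN]
    have g14 : s3.reg 14 = address n B e := by simp [hf3.reg 14 rfl, h1a]
    refine Runs.store hs3 (le_trans (by decide) hZ) (le_trans (by decide) hZ) ?_ fun A => ?_
    · rw [val_reg, hI3]; exact hpart'
    · have hA : ((Expr.reg 7 + 1) * rBN + .reg 14).val s3
          = (((E.length + 1) * B ^ n + address n B e : ℕ) : ℤ) := by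
        simp only [val_add, val_mul, val_reg, val_one, g7, g6, g14]
        push_cast
        ring
      rw [hA, val_reg, hI3, table_cons hu hv huv hdu hdv heu hevv, State.setCell_bank]
      simp [hf3.bank 7 rfl, h7b, hf, ← hru, ← hrv]

/-! ### The program for all tables -/

/-- Introduce the edge of the node whose label starts in the cell `reg 23`. -/
def introduce : Program :=
  .assign 9 (.cell 0 (.reg 23 + 1)) ;; .assign 10 (.cell 0 (.reg 23 + 2)) ;;
  .store 6 (.reg 9 * rn + .reg 10) 1 ;; .store 6 (.reg 10 * rn + .reg 9) 1 ;;
  sizes ;; .for 11 (.reg 12) entry ;;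
  .store 5 (.reg 9) (.cell 5 (.reg 9) + 1) ;; .store 5 (.reg 10) (.cell 5 (.reg 10) + 1) ;;
  .assign 7 (.reg 7 + 1)

/-- Pass through all nodes, ignoring those that do not introduce a new edge. -/
def nodes : Program :=
  .for 8 rlen (
    .assign 23 (3 + rn * rn + .reg 8 * (rn + 3)) ;;
    .ite (.op .eq (.cell 0 (.reg 23)) 2 *
        .op .eq (.cell 6 (.cell 0 (.reg 23 + 1) * rn + .cell 0 (.reg 23 + 2))) 0)
      introduce .skip)

/-- The edges that are introduced at the first nodes, without repetitions; the node `j` introduces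
the edge `{ku j, kv j}` if `kd j = 2`. -/
def edges (kd ku kv : ℕ → ℕ) : ℕ → List (ℕ × ℕ)
  | 0 => []
  | j + 1 =>
    if kd j = 2 ∧ ¬((ku j, kv j) ∈ edges kd ku kv j ∨ (kv j, ku j) ∈ edges kd ku kv j)
    then (ku j, kv j) :: edges kd ku kv j else edges kd ku kv j

theorem length_edges_le (kd ku kv : ℕ → ℕ) (j : ℕ) : (edges kd ku kv j).length ≤ j := by
  induction j with
  | zero => simp [edges]
  | succ j ih =>
    simp only [edges]
    split_ifs
    · simpa using ih
    · omega

theorem deg_edges_mono (kd ku kv : ℕ → ℕ) (w : ℕ) :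
    Monotone fun j => deg (edges kd ku kv j) w := by
  refine monotone_nat_of_le_succ fun j => ?_
  simp only [edges]
  split_ifs
  · simp only [deg]; omega
  · exact le_rfl

/-- The program `introduce` computes the next table, of at most `P` entries. -/
theorem introduce_spec {n B len j u v P : ℕ} {d : ℕ → ℕ} {S : ℕ → ℕ → ℤ} {kd ku kv : ℕ → ℕ}
    {E : List (ℕ × ℕ)} {Sm Tm : ℤ} (hs : s.Bounded W) (hZ : 400 ≤ Z)
    (hF : Fixed n B len d S kd ku kv s) (hE : Introduced n B d S E s) (hj : j < len)
    (h23 : s.reg 23 = (3 + n * n + j * (n + 3) : ℕ)) (hku : ku j = u) (hkv : kv j = v)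
    (hu : u < n) (hv : v < n) (huv : u ≠ v) (hd : ∀ w < n, deg ((u, v) :: E) w ≤ d w)
    (hdB : ∀ w < n, d w < B) (hSm : 1 ≤ Sm) (hS : ∀ w < n, ∀ i ≤ d w, |S w i| ≤ Sm)
    (hTm : ∀ e : ℕ → ℕ, (∀ w < n, e w < radix (d w) (deg E w)) → |table n d S E e| ≤ Tm)
    (hP : ∏ w ∈ range n, radix (d w) (deg ((u, v) :: E) w) ≤ P)
    (hnB : n < B) (hlW : E.length + 1 < 2 ^ W) (hPW : P < 2 ^ W) (hBW : B ^ n < 2 ^ W)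
    (hB : B < 2 ^ W) (hW : (B : ℤ) * B * (2 * Sm ^ 2 * Tm) < 2 ^ W) :
    Runs ρ W Z introduce s
      (5 * n + 18 + (6 * n + 4 + (1 + ((3 * B + 4) * B + 2 + 2)) + 2) * P)
      (fun s' => Introduced n B d S ((u, v) :: E) s') := by
  set r : ℕ → ℕ := fun w => radix (d w) (deg ((u, v) :: E) w) with hr
  set es := 6 * n + 4 + (1 + ((3 * B + 4) * B + 2 + 2)) with hes
  have hW1 : 1 ≤ W := by
    by_contra h
    have : W = 0 := by omega
    simp [this] at hlW
  have hnW : n < 2 ^ W := by omega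
  have hrB : ∀ w < n, r w ≤ B := fun w hw => by
    have := hdB w hw
    have : r w ≤ d w + 1 := radix_le
    omega
  have hvu : v ≠ u := huv.symm
  have hdegu : deg ((u, v) :: E) u = deg E u + 1 := by simp [deg, huv]
  have hdegv : deg ((u, v) :: E) v = deg E v + 1 := by simp [deg, hvu]
  have hdu : deg E u < d u := by have := hd u hu; omega
  have hdv : deg E v < d v := by have := hd v hv; omega
  have hl := hF.left j hj
  have hrt := hF.right j hj
  rw [hku] at hl
  rw [hkv] at hrt
  refine Runs.le (m := 1 + (1 + (2 + (2 + ((5 * n + 3) + (((es + 2) *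
    ∏ w ∈ range n, r w) + 2 + (2 + (2 + 1)))))))) ?_ ?_
  swap
  · have : (es + 2) * ∏ w ∈ range n, r w ≤ (es + 2) * P := Nat.mul_le_mul_left _ hP
    omega
  refine Runs.assign_seq hs (le_trans (by decide) hZ) (hs.bank _ _) fun hs1 => ?_
  have hv1 : (Expr.cell 0 (.reg 23 + 1)).val s = u := by
    simp only [val_cell, val_add, val_reg, val_one, h23]
    push_cast
    exact hl
  rw [hv1] at hs1 ⊢
  refine Runs.assign_seq hs1 (le_trans (by decide) hZ) (hs1.bank _ _) fun hs2 => ?_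
  have hv2 : (Expr.cell 0 (.reg 23 + 2)).val (s.setReg 9 u) = v := by
    simp only [val_cell, val_add, val_reg, val_two, State.setReg_reg, State.setReg_bank,
      if_neg (by decide : ¬ 23 = 9), h23]
    push_cast
    exact hrt
  rw [hv2] at hs2 ⊢
  refine Runs.store_seq hs2 (le_trans (by decide) hZ) (le_trans (by decide) hZ)
    (bitLen_one_le hW1) fun hs3 => ?_
  have hv3 : (Expr.reg 9 * rn + .reg 10).val ((s.setReg 9 u).setReg 10 v) = (u * n + v : ℕ) := by
    simp [hF.reg_n]
  rw [hv3] at hs3 ⊢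
  refine Runs.store_seq hs3 (le_trans (by decide) hZ) (le_trans (by decide) hZ)
    (bitLen_one_le hW1) fun hs4 => ?_
  have hv4 : (Expr.reg 10 * rn + .reg 9).val
      (((s.setReg 9 u).setReg 10 v).setCell 6 (u * n + v : ℕ) 1) = (v * n + u : ℕ) := by
    simp [hF.reg_n]
  rw [val_one] at hs4 ⊢
  rw [hv4] at hs4 ⊢
  rw [val_one] at hs4 ⊢
  set s4 := (((s.setReg 9 u).setReg 10 v).setCell 6 (u * n + v : ℕ) 1).setCell 6 (v * n + u : ℕ) 1
    with hs4'
  have hF4 : Fixed n B len d S kd ku kv s4 :=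
    ((((hF.frame (frame_assign s 9 0 u) rfl rfl).frame (frame_assign _ 10 0 v) rfl rfl).frame
      (frame_store _ 6 0 0 _ _) rfl rfl).frame (frame_store _ 6 0 0 _ _) rfl rfl)
  have g9 : s4.reg 9 = u := by simp [hs4']
  have g10 : s4.reg 10 = v := by simp [hs4']
  have g7 : s4.reg 7 = E.length := by simp [hs4', hE.time]
  have b5 : ∀ w < n, s4.bank 5 w = deg E w := fun w hw => by simp [hs4', hE.degree w hw]
  have b7 : s4.bank 7 = s.bank 7 := by funext A; simp [hs4']
  have hb6 : ∀ x < n, ∀ y < n, s4.bank 6 ((x * n + y : ℕ) : ℤ)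
      = if (x, y) ∈ (u, v) :: E ∨ (y, x) ∈ (u, v) :: E then 1 else 0 := by
    intro x hx y hy
    simp only [hs4', State.setCell_bank, State.setReg_bank, true_and, Nat.cast_inj,
      mul_add_inj hy hu, mul_add_inj hy hv, hE.mark x hx y hy, List.mem_cons, Prod.mk.injEq]
    by_cases c1 : x = v ∧ y = u
    · rw [if_pos c1, if_pos (Or.inr (Or.inl ⟨c1.2, c1.1⟩))]
    · by_cases c2 : x = u ∧ y = v
      · rw [if_neg c1, if_pos c2, if_pos (Or.inl (Or.inl c2))]
      · rw [if_neg c1, if_neg c2]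
        have c1' : ¬ (y = u ∧ x = v) := fun h => c1 ⟨h.2, h.1⟩
        simp [c1', c2]
  clear_value s4
  refine (sizes_spec (u := u) (v := v) (r := r) hs4 hZ hF4.reg_n g9 g10 hF4.degree b5 rfl hd hnW
    (hP.trans_lt hPW)).seq fun s5 hs5 hf5 h5 => ?_
  obtain ⟨h58, h512⟩ := h5
  have hF5 := hF4.frame hf5 rfl rfl
  have hr1 : ∀ w, 0 < r w := fun w => by simp [hr, radix]
  refine (Runs.for (L := ∏ w ∈ range n, r w) (m := es)
    (fun i s' => (∀ e : ℕ → ℕ, (∀ w < n, e w < radix (d w) (deg E w)) →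
        s'.bank 7 ((E.length * B ^ n + address n B e : ℕ) : ℤ) = table n d S E e) ∧
      ∀ i' < i, s'.bank 7 (((E.length + 1) * B ^ n + address n B (digit r i') : ℕ) : ℤ)
        = table n d S ((u, v) :: E) (digit r i')) hs5
    (le_trans (by decide) hZ) (by omega) (hP.trans_lt hPW) rfl
    (fun s' hf => by simp only [val_reg, hf.reg 12 rfl, h512])
    ⟨fun e he => by
      rw [State.setReg_bank, hf5.bank 7 rfl, b7]; exact hE.table e he, by simp⟩
    (fun i hi s' hs' hf hx hI => ?_)).seq (fun s6 hs6 hf6 h6 => ?_)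
  · have hi' : i < 2 ^ W := hi.trans (hP.trans_lt hPW)
    refine Runs.mono (entry_spec (u := u) (v := v) (i := i) (r := r) hs' hZ (hF5.frame hf rfl rfl)
      ?_ ?_ ?_ hx ?_ ?_ hI.1 rfl hu hv huv hdu hdv hdB hSm hS hTm hnW hi' hBW hB hW) le_rfl
      (fun s'' _ _ h => ⟨fun e he => ?_, fun i' hi'' => ?_⟩)
    · rw [hf.reg 9 rfl, hf5.reg 9 rfl, g9]
    · rw [hf.reg 10 rfl, hf5.reg 10 rfl, g10]
    · rw [hf.reg 7 rfl, hf5.reg 7 rfl, g7]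
    · rw [hf.bank 5 rfl, hf5.bank 5 rfl]; exact b5
    · rw [hf.bank 8 rfl]; exact h58
    -- the entries of the old table have a smaller leading digit and are not overwritten
    · rw [State.setReg_bank, h, if_neg, hI.1 e he]
      have hlt : address n B e < B ^ n := address_lt fun w hw =>
        (he w hw).trans_le (by
          have := hdB w hw
          have : radix (d w) (deg E w) ≤ d w + 1 := radix_le
          omega)
      rw [Nat.cast_inj, add_one_mul]
      omega
    · rw [State.setReg_bank, h]
      split_ifs with hc
      · refine table_congr fun w hw => ?_
        have hlt : ∀ i, ∀ w < n, digit r i w < B := fun i w hw =>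
          (Nat.mod_lt _ (hr1 w)).trans_le (hrB w hw)
        refine address_inj (hlt i) (hlt i') ?_ w hw
        have := Nat.cast_injective hc
        omega
      · refine hI.2 i' ?_
        rcases Nat.lt_succ_iff_lt_or_eq.1 hi'' with h' | rfl
        · exact h'
        · exact absurd rfl hc
  · have g9 : s6.reg 9 = u := by rw [hf6.reg 9 rfl, hf5.reg 9 rfl, g9]
    have g10 : s6.reg 10 = v := by rw [hf6.reg 10 rfl, hf5.reg 10 rfl, g10]
    have g7 : s6.reg 7 = E.length := by rw [hf6.reg 7 rfl, hf5.reg 7 rfl, g7]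
    have b5 : ∀ w < n, s6.bank 5 w = deg E w := by
      rw [hf6.bank 5 rfl, hf5.bank 5 rfl]; exact b5
    have b6 : s6.bank 6 = s4.bank 6 := by rw [hf6.bank 6 rfl, hf5.bank 6 rfl]
    have hdW : ∀ w < n, d w < 2 ^ W := fun w hw => (hdB w hw).trans hB
    have hv1 : (Expr.cell 5 (.reg 9) + 1).val s6 = (deg E u + 1 : ℕ) := by simp [g9, b5 u hu]
    refine Runs.store_seq hs6 (le_trans (by decide) hZ) (le_trans (by decide) hZ) ?_ fun hs7 => ?_
    · rw [hv1]; exact bitLen_natCast_le (lt_of_le_of_lt hdu (hdW u hu))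
    rw [hv1] at hs7 ⊢
    simp only [val_reg, g9] at hs7 ⊢
    have hv2 : (Expr.cell 5 (.reg 10) + 1).val (s6.setCell 5 u (deg E u + 1 : ℕ))
        = (deg E v + 1 : ℕ) := by simp [g10, b5 v hv, hvu]
    refine Runs.store_seq hs7 (le_trans (by decide) hZ) (le_trans (by decide) hZ) ?_ fun hs8 => ?_
    · rw [hv2]; exact bitLen_natCast_le (lt_of_le_of_lt hdv (hdW v hv))
    rw [hv2] at hs8 ⊢
    simp only [val_reg, State.setCell_reg, g10] at hs8 ⊢
    have hv3 : (Expr.reg 7 + 1).val ((s6.setCell 5 u (deg E u + 1 : ℕ)).setCell 5 v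
        (deg E v + 1 : ℕ)) = (E.length + 1 : ℕ) := by simp [g7]
    refine Runs.assign hs8 (le_trans (by decide) hZ) ?_ ?_
    · rw [hv3]; exact bitLen_natCast_le hlW
    rw [hv3]
    refine ⟨by simp, fun w hw => ?_, fun x hx y hy => ?_, fun e he => ?_⟩
    · simp only [State.setReg_bank, State.setCell_bank, true_and, Nat.cast_inj, b5 w hw]
      by_cases c1 : w = v
      · subst c1; rw [if_pos rfl, hdegv]
      · rw [if_neg c1]
        by_cases c2 : w = u
        · subst c2; rw [if_pos rfl, hdegu]
        · rw [if_neg c2]; simp [deg, c1, c2]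
    · simp only [State.setReg_bank, State.setCell_bank, b6]
      simpa using hb6 x hx y hy
    · obtain ⟨i, hi, hdi⟩ := exists_digit_eq (r := r) he
      have := h6.2 i hi
      have haddr : address n B (digit r i) = address n B e :=
        sum_congr rfl fun w hw => by rw [hdi w (mem_range.1 hw)]
      rw [haddr, table_congr hdi] at this
      simpa using this

/-- The program `nodes` computes the tables for all prefixes of the list of edges. -/
theorem nodes_spec {n B len P : ℕ} {d : ℕ → ℕ} {S : ℕ → ℕ → ℤ} {kd ku kv : ℕ → ℕ}
    {Sm : ℤ} (hs : s.Bounded W) (hZ : 400 ≤ Z)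
    (hF : Fixed n B len d S kd ku kv s) (hE : Introduced n B d S [] s)
    (hk : ∀ j < len, kd j = 2 → ku j < n ∧ kv j < n ∧ ku j ≠ kv j)
    (hd : ∀ w < n, deg (edges kd ku kv len) w ≤ d w)
    (hdB : ∀ w < n, d w < B) (hSm : 1 ≤ Sm) (hS : ∀ w < n, ∀ i ≤ d w, |S w i| ≤ Sm)
    (hP : ∀ j ≤ len, ∏ w ∈ range n, radix (d w) (deg (edges kd ku kv j) w) ≤ P)
    (hnB : n < B) (hBlen : 3 + n * n + len * (n + 3) < 2 ^ W) (hPW : P < 2 ^ W)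
    (hBW : B ^ n < 2 ^ W) (hB : B < 2 ^ W)
    (hW : (B : ℤ) * B * (2 * Sm ^ 2 * (2 ^ len * Sm ^ n)) < 2 ^ W) :
    Runs ρ W Z nodes s
      ((1 + (1 + (5 * n + 18 + (6 * n + 4 + (1 + ((3 * B + 4) * B + 2 + 2)) + 2) * P)) + 2) * len
        + 2)
      (fun s' => Introduced n B d S (edges kd ku kv len) s') := by
  have hlen : ∀ j ≤ len, j * (n + 3) ≤ len * (n + 3) := fun j hj => Nat.mul_le_mul_right _ hj
  have hlenW : len < 2 ^ W := by nlinarith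
  refine Runs.for (L := len) (fun j s' => Introduced n B d S (edges kd ku kv j) s') hs
    (le_trans (by decide) hZ) (by omega) hlenW rfl
    (fun s' hf => by simp only [val_reg, hf.reg 4 rfl, hF.reg_len]) ?_
    (fun j hj s' hs' hf hx hI => ?_)
  · exact ⟨by simpa [edges] using hE.time, hE.degree, hE.mark, hE.table⟩
  have hF' := hF.frame hf rfl rfl
  have hv : (3 + rn * rn + .reg 8 * (rn + 3) : Expr).val s' = (3 + n * n + j * (n + 3) : ℕ) := by
    simp [hF'.reg_n, hx]
  have hle := hlen j hj.le
  refine Runs.assign_seq hs' (le_trans (by decide) hZ) ?_ fun hs1 => ?_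
  · rw [hv]; exact bitLen_natCast_le (by omega)
  rw [hv] at hs1 ⊢
  set s1 := s'.setReg 23 (3 + n * n + j * (n + 3) : ℕ) with hs1'
  have hf1 : Frame (.assign 23 0) s' s1 := frame_assign _ _ _ _
  have hF1 := hF'.frame hf1 rfl rfl
  have h23 : s1.reg 23 = (3 + n * n + j * (n + 3) : ℕ) := by simp [hs1']
  have hI1 : Introduced n B d S (edges kd ku kv j) s1 :=
    ⟨by simpa [hs1'] using hI.time, hI.degree, hI.mark, hI.table⟩
  clear_value s1
  have hkj := hF1.kind j hj
  have hlj := hF1.left j hj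
  have hrj := hF1.right j hj
  have hcond : ((Expr.op .eq (.cell 0 (.reg 23)) 2 *
        .op .eq (.cell 6 (.cell 0 (.reg 23 + 1) * rn + .cell 0 (.reg 23 + 2))) 0).val s1 ≠ 0) ↔
      kd j = 2 ∧ ¬((ku j, kv j) ∈ edges kd ku kv j ∨ (kv j, ku j) ∈ edges kd ku kv j) := by
    simp only [val_mul, val_eq, val_cell, val_reg, val_add, val_one, val_two, val_zero, h23,
      hF1.reg_n]
    push_cast
    rw [hkj, hlj, hrj]
    by_cases h2 : kd j = 2
    · obtain ⟨h3, h4, -⟩ := hk j hj h2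
      have := hI1.mark _ h3 _ h4
      push_cast at this
      rw [this]
      simp [h2]
    · have : ¬ (kd j : ℤ) = 2 := by exact_mod_cast h2
      simp [h2, this]
  refine Runs.ite hs1 (le_trans (by decide) hZ) (fun hc => ?_) (fun hc => ?_)
  · rw [hcond] at hc
    obtain ⟨h3, h4, h5⟩ := hk j hj hc.1
    have hsucc : edges kd ku kv (j + 1) = (ku j, kv j) :: edges kd ku kv j := by
      simp only [edges]; rw [if_pos hc]
    have hdeg : ∀ w < n, deg (edges kd ku kv (j + 1)) w ≤ d w := fun w hw =>
      (deg_edges_mono kd ku kv w hj).trans (hd w hw)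
    have hdeg' : ∀ w < n, deg (edges kd ku kv j) w ≤ d w := fun w hw =>
      (deg_edges_mono kd ku kv w hj.le).trans (hd w hw)
    have hlj := length_edges_le kd ku kv j
    rw [hsucc] at hdeg
    have hPj := hP (j + 1) hj
    rw [hsucc] at hPj
    refine Runs.mono (introduce_spec hs1 hZ hF1 hI1 hj h23 rfl rfl h3 h4 h5 hdeg hdB hSm hS
      (Tm := 2 ^ len * Sm ^ n) (fun e he => ?_) hPj hnB (by nlinarith) hPW hBW hB hW) le_rfl
      (fun s'' _ _ h => ?_)
    · refine (abs_table_le hSm hS hdeg' he).trans ?_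
      exact mul_le_mul_of_nonneg_right (pow_le_pow_right₀ (by norm_num) (by omega))
        (by positivity)
    · rw [hsucc]
      exact ⟨by simpa using h.time, h.degree, h.mark, h.table⟩
  · have hc' := mt hcond.2 (not_not.2 hc)
    have hsucc : edges kd ku kv (j + 1) = edges kd ku kv j := by
      simp only [edges]; rw [if_neg hc']
    refine Runs.le (Runs.skip hs1 ?_) (by omega)
    rw [hsucc]
    exact ⟨by simpa using hI1.time, hI1.degree, hI1.mark, hI1.table⟩

/-! ### The algorithm and its specification -/

/-- Compute the number of bits of each random weight. -/
def numBits (c : ℕ) : Program :=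
  .assign 5 1 ;; .for 21 (.const c) (.assign 5 (.reg 5 * .reg 19)) ;; .assign 5 (.reg 5 + .reg 19)

/-- The algorithm for at least one but fewer than `n` colors. The initial table has the single entry
`1`. -/
def main (c : ℕ) : Program :=
  .assign 3 (rn + 1) ;; .assign 4 (.cell 0 (2 + rn * rn)) ;;
  .assign 19 ((3 + rn * rn + rlen * (rn + 3)) * (rn + rlen + 2)) ;;
  numBits c ;; degrees ;; powers ;; weights ;; powerSums ;; .store 7 0 1 ;; nodes ;;
  .assign 0 (1 - .op .eq (.cell 7 (.reg 7 * rBN)) 0)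

/-- The algorithm. The answer is yes if there are at least as many colors as vertices, and no if
there are vertices but no colors. -/
def program (c : ℕ) : Program :=
  .assign 1 (.cell 0 0) ;; .assign 2 (.cell 0 1) ;;
  .ite (.op .lt rq rn) (.ite (.op .eq rq 0) (.assign 0 0) (main c)) (.assign 0 1)

/-- An upper bound for the input size, which the algorithm computes. -/
def sizeBound (n len : ℕ) : ℕ := (3 + n * n + len * (n + 3)) * (n + len + 2)

/-- The number of bits of each random weight. With `M = sizeBound n len`, the term `M ^ c` gives
the error bound, and the term `M` compensates for the degree `n * q < 2 ^ M` in the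
Schwartz–Zippel lemma. -/
def bitBound (c n len : ℕ) : ℕ := sizeBound n len ^ c + sizeBound n len

theorem numBits_spec {c M : ℕ} (hs : s.Bounded W) (hZ : 400 ≤ Z) (hc : c + 3 ≤ Z)
    (h19 : s.reg 19 = M) (hM : 1 ≤ M) (hcW : c < 2 ^ W) (hW : M ^ c + M < 2 ^ W) :
    Runs ρ W Z (numBits c) s (3 * c + 4) (fun s' => s'.reg 5 = (M ^ c + M : ℕ)) := by
  have hbd : ∀ x ≤ c, M ^ x < 2 ^ W := fun x hx =>
    (Nat.pow_le_pow_right hM hx).trans_lt (by omega)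
  have hW1 : 1 ≤ W := by
    by_contra h
    have : W = 0 := by omega
    subst this
    omega
  refine Runs.le (m := 1 + (((1 + 2) * c + 2) + 1)) ?_ (by omega)
  refine Runs.assign_seq hs (le_trans (by decide) hZ) (bitLen_one_le hW1) fun hs1 => ?_
  refine (Runs.for (L := c) (m := 1) (fun j s' => s'.reg 5 = (M ^ j : ℕ)) hs1
    (by simp [Expr.size]; omega) (by omega) hcW rfl (fun s' hf => rfl) (by simp)
    (fun j hj s' hs' hf hx hI => ?_)).seq (fun s2 hs2 hf2 h2 => ?_)
  · have hv : (Expr.reg 5 * .reg 19).val s' = (M ^ (j + 1) : ℕ) := by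
      simp [hI, hf.reg 19 rfl, h19, pow_succ]
    refine Runs.assign hs' (le_trans (by decide) hZ) ?_ ?_
    · rw [hv]; exact bitLen_natCast_le (hbd _ hj)
    · rw [hv]; simp
  · have hv : (Expr.reg 5 + .reg 19).val s2 = (M ^ c + M : ℕ) := by
      simp [h2, hf2.reg 19 rfl, h19]
    refine Runs.assign hs2 (le_trans (by decide) hZ) ?_ ?_
    · rw [hv]; exact bitLen_natCast_le hW
    · rw [hv]; simp

theorem powerSum_bound_le {n q K : ℕ} (hq : q < n) (hn : n + 1 ≤ K) :
    (n + 1) * (2 ^ (K * q) * (n + 1) ^ (n + 1)) ≤ 2 ^ (3 * K ^ 2) := by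
  have hB : n + 1 ≤ 2 ^ K := hn.trans Nat.lt_two_pow_self.le
  calc _ ≤ 2 ^ K * (2 ^ (K * q) * (2 ^ K) ^ (n + 1)) :=
        Nat.mul_le_mul hB (Nat.mul_le_mul_left _ (Nat.pow_le_pow_left hB _))
    _ = 2 ^ (K + (K * q + K * (n + 1))) := by rw [← pow_mul, ← pow_add, ← pow_add]
    _ ≤ _ := Nat.pow_le_pow_right (by norm_num) (by nlinarith)

/-- The sums in the recurrence for the tables have at most `20 * K ^ 3` bits. Here the parenthesis
`(n + 1) * (2 ^ (K * q) * (n + 1) ^ (n + 1))` bounds the power sums. -/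
theorem bounds_lt_two_pow {n q len K : ℕ} (hq : q < n) (hn : n + 1 ≤ K) (hl : len ≤ K)
    (hK : 6 ≤ K) :
    (((n + 1 : ℕ) : ℤ) * (n + 1 : ℕ) * (2 * ((n + 1 : ℕ) * (2 ^ (K * q) * (n + 1 : ℕ) ^ (n + 1)))
        ^ 2 * (2 ^ len * ((n + 1 : ℕ) * (2 ^ (K * q) * (n + 1 : ℕ) ^ (n + 1))) ^ n)) : ℤ)
      < 2 ^ (20 * K ^ 3) := by
  have hB : n + 1 ≤ 2 ^ K := hn.trans Nat.lt_two_pow_self.le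
  have hSm := powerSum_bound_le hq hn
  have key : (n + 1) * (n + 1) * (2 * ((n + 1) * (2 ^ (K * q) * (n + 1) ^ (n + 1))) ^ 2 *
      (2 ^ len * ((n + 1) * (2 ^ (K * q) * (n + 1) ^ (n + 1))) ^ n)) < 2 ^ (20 * K ^ 3) := by
    calc _ ≤ 2 ^ K * 2 ^ K * (2 ^ 1 * (2 ^ (3 * K ^ 2)) ^ 2 *
            (2 ^ len * (2 ^ (3 * K ^ 2)) ^ n)) :=
          Nat.mul_le_mul (Nat.mul_le_mul hB hB) (Nat.mul_le_mul
            (Nat.mul_le_mul le_rfl (Nat.pow_le_pow_left hSm _))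
            (Nat.mul_le_mul_left _ (Nat.pow_le_pow_left hSm _)))
      _ = 2 ^ (K + K + (1 + 3 * K ^ 2 * 2 + (len + 3 * K ^ 2 * n))) := by
          simp only [← pow_mul, ← pow_add]
      _ < _ := Nat.pow_lt_pow_right (by norm_num) (by
          have h1 : 3 * K ^ 2 * n ≤ 3 * K ^ 2 * K := Nat.mul_le_mul_left _ (by omega)
          have h2 : 6 * K ^ 2 ≤ K ^ 2 * K := by rw [mul_comm]; exact Nat.mul_le_mul_left _ hK
          have h3 : 6 * K ≤ K ^ 2 := by rw [sq]; exact Nat.mul_le_mul_right _ hK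
          have h4 : K ^ 3 = K ^ 2 * K := by ring
          have h5 : 3 * K ^ 2 * K = 3 * (K ^ 2 * K) := by ring
          have h6 : 0 < K ^ 2 := by positivity
          omega)
  exact_mod_cast key

/-- The total number of steps of `main`, summed over its parts. -/
theorem sum_le_pow_mul {n q len c K P : ℕ} (hq : q < n) (hn : n + 1 ≤ K) (hl : len ≤ K)
    (hK : 6 ≤ K) (hP : 1 ≤ P) :
    1 + (1 + (1 + ((3 * c + 4) + (((3 * n + 7) * n + 2) + ((1 + (5 * n + 2)) +
      (((4 * K + 7) * n + 2) + (((((6 * (n + 1) + 9) * q + 7) * (n + 1) + 4) * n + 2) + (2 +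
      (((1 + (1 + (5 * n + 18 + (6 * n + 4 + (1 + ((3 * (n + 1) + 4) * (n + 1) + 2 + 2)) + 2) * P))
        + 2) * len + 2) + 1))))))))) ≤ (c + 100) * K ^ 4 * P := by
  have hK1 : 1 ≤ K := by omega
  have e1 : (3 * n + 7) * n ≤ 5 * K * K := Nat.mul_le_mul (by omega) (by omega)
  have e2 : (4 * K + 7) * n ≤ (6 * K) * K := Nat.mul_le_mul (by omega) (by omega)
  have e3 : (6 * (n + 1) + 9) * q ≤ (8 * K) * K := Nat.mul_le_mul (by omega) (by omega)
  have e4 : ((6 * (n + 1) + 9) * q + 7) * (n + 1) ≤ (8 * K * K + 7) * K :=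
    Nat.mul_le_mul (by omega) hn
  have e5 : (((6 * (n + 1) + 9) * q + 7) * (n + 1) + 4) * n ≤ ((8 * K * K + 7) * K + 4) * K :=
    Nat.mul_le_mul (by omega) (by omega)
  have e6 : (3 * (n + 1) + 4) * (n + 1) ≤ (4 * K) * K := Nat.mul_le_mul (by omega) hn
  have e7 : (6 * n + 4 + (1 + ((3 * (n + 1) + 4) * (n + 1) + 2 + 2)) + 2) * P
      ≤ (6 * K + 4 * K * K + 5) * P := Nat.mul_le_mul_right _ (by omega)
  have e8 : (1 + (1 + (5 * n + 18 + (6 * n + 4 + (1 + ((3 * (n + 1) + 4) * (n + 1) + 2 + 2)) + 2)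
      * P)) + 2) * len ≤ (5 * K + 17 + (6 * K + 4 * K * K + 5) * P) * K :=
    Nat.mul_le_mul (by omega) hl
  have k2 : 6 * K ≤ K ^ 2 := by rw [sq]; exact Nat.mul_le_mul_right _ hK
  have k3 : 6 * K ^ 2 ≤ K ^ 3 := by
    rw [pow_succ K 2, mul_comm]; exact Nat.mul_le_mul_left _ hK
  have k4 : 6 * K ^ 3 ≤ K ^ 4 := by
    rw [pow_succ K 3, mul_comm]; exact Nat.mul_le_mul_left _ hK
  have p1 : K ≤ K * P := Nat.le_mul_of_pos_right _ hP
  have p2 : K ^ 2 ≤ K ^ 2 * P := Nat.le_mul_of_pos_right _ hP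
  have p3 : K ^ 3 ≤ K ^ 3 * P := Nat.le_mul_of_pos_right _ hP
  have p4 : K ^ 4 ≤ K ^ 4 * P := Nat.le_mul_of_pos_right _ hP
  have q2 : 6 * (K * P) ≤ K ^ 2 * P := by
    rw [← mul_assoc]; exact Nat.mul_le_mul_right _ k2
  have q3 : 6 * (K ^ 2 * P) ≤ K ^ 3 * P := by
    rw [← mul_assoc]; exact Nat.mul_le_mul_right _ k3
  have q4 : 6 * (K ^ 3 * P) ≤ K ^ 4 * P := by
    rw [← mul_assoc]; exact Nat.mul_le_mul_right _ k4
  have c1 : 3 * c ≤ c * (K ^ 4 * P) := by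
    rw [mul_comm]; exact Nat.mul_le_mul_left _ (by omega)
  have f5 : ((8 * K * K + 7) * K + 4) * K = 8 * K ^ 4 + 7 * K ^ 2 + 4 * K := by ring
  have f8 : (5 * K + 17 + (6 * K + 4 * K * K + 5) * P) * K
      = 5 * K ^ 2 + 17 * K + 6 * (K ^ 2 * P) + 4 * (K ^ 3 * P) + 5 * (K * P) := by ring
  have f0 : (c + 100) * K ^ 4 * P = c * (K ^ 4 * P) + 100 * (K ^ 4 * P) := by ring
  have f1 : 5 * K * K = 5 * K ^ 2 := by ring
  have f2 : 6 * K * K = 6 * K ^ 2 := by ring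
  omega

/-- The program `main` answers yes if and only if the last table entry is not `0`. The number `P`
bounds the sizes of all tables. -/
theorem main_spec {c n q len P : ℕ} {adj : ℕ → ℕ → ℕ} {kd ku kv : ℕ → ℕ}
    (hq0 : 0 < q) (hqn : q < n) (hs : s.Bounded (20 * bitBound c n len ^ 3))
    (h1 : s.reg 1 = n) (h2 : s.reg 2 = q) (h7 : s.reg 7 = 0) (hu : s.used = 0)
    (hbank : ∀ a, a ≠ 0 → ∀ i, s.bank a i = 0)
    (hadj : ∀ w < n, ∀ x < n, s.bank 0 (2 + w * n + x) = adj w x) (hle : ∀ w x, adj w x ≤ 1)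
    (hlen : s.bank 0 (2 + n * n) = len)
    (hkd : ∀ j < len, s.bank 0 (3 + n * n + j * (n + 3)) = kd j)
    (hku : ∀ j < len, s.bank 0 (3 + n * n + j * (n + 3) + 1) = ku j)
    (hkv : ∀ j < len, s.bank 0 (3 + n * n + j * (n + 3) + 2) = kv j)
    (hk : ∀ j < len, kd j = 2 → ku j < n ∧ kv j < n ∧ ku j ≠ kv j)
    (hd : ∀ w < n, deg (edges kd ku kv len) w ≤ ∑ x ∈ range n, adj w x)
    (hP : ∀ j ≤ len,
      ∏ w ∈ range n, radix (∑ x ∈ range n, adj w x) (deg (edges kd ku kv j) w) ≤ P) :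
    Runs ρ (20 * bitBound c n len ^ 3) (c + 400) (main c) s
      ((c + 100) * bitBound c n len ^ 4 * P)
      (fun s' => s'.reg 0 = if table n (fun w => ∑ x ∈ range n, adj w x)
        (fun w => powerSum q (weight ρ (bitBound c n len) w)) (edges kd ku kv len) 0 = 0
        then 0 else 1) := by
  set M := sizeBound n len with hM
  set K := bitBound c n len with hK
  set W := 20 * K ^ 3 with hW
  have hKM : K = M ^ c + M := rfl
  have hM1 : 3 + n * n + len * (n + 3) ≤ M := Nat.le_mul_of_pos_right _ (by omega)
  have hM2 : n + len + 2 ≤ M := Nat.le_mul_of_pos_left _ (by omega)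
  have hM3 : 6 ≤ M := by
    rw [hM, sizeBound]
    calc 6 ≤ 3 * 2 := le_rfl
      _ ≤ _ := Nat.mul_le_mul (by omega) (by omega)
  have hMK : M ≤ K := by omega
  have hcK : c < K := by
    have h1 : c < 2 ^ c := Nat.lt_two_pow_self
    have h2 : 2 ^ c ≤ M ^ c := Nat.pow_le_pow_left (by omega) c
    omega
  have hKW : K ≤ W := by
    have : K ≤ K ^ 3 := Nat.le_self_pow (by norm_num) K
    omega
  have hWW : W < 2 ^ W := Nat.lt_two_pow_self
  have hZ : 400 ≤ c + 400 := by omega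
  have hP1 : 1 ≤ P := (hP 0 (by omega)).trans' (one_le_prod' fun w _ => by simp [radix])
  set B := n + 1 with hB
  set Sm : ℕ := B * (2 ^ (K * q) * B ^ B) with hSm
  have hSm1 : 1 ≤ Sm := Nat.mul_pos (by omega) (by positivity)
  have hSmW : Sm < 2 ^ W := (powerSum_bound_le hqn (by omega)).trans_lt
    (Nat.pow_lt_pow_right (by norm_num) (by
      have : 1 * K ^ 2 ≤ K * K ^ 2 := Nat.mul_le_mul_right _ (by omega)
      have h2 : K ^ 3 = K * K ^ 2 := by ring
      have h3 : 0 < K ^ 2 := pow_pos (by omega) 2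
      omega))
  have hBn : B ^ n < 2 ^ W := by
    refine lt_of_le_of_lt ?_ hSmW
    calc B ^ n ≤ B ^ B := Nat.pow_le_pow_right (by omega) (by omega)
      _ ≤ 2 ^ (K * q) * B ^ B := Nat.le_mul_of_pos_left _ (by positivity)
      _ ≤ _ := Nat.le_mul_of_pos_left _ (by omega)
  have hbig := bounds_lt_two_pow (K := K) (len := len) hqn (by omega) (by omega) (by omega)
  refine Runs.le (Z := c + 400) ?_
    (sum_le_pow_mul (c := c) (K := K) (len := len) hqn (by omega) (by omega) (by omega) hP1)
  have hv1 : (rn + 1).val s = B := by simp [h1, hB]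
  refine Runs.assign_seq hs (le_trans (by decide) hZ) ?_ fun hs1 => ?_
  · rw [hv1]; exact bitLen_natCast_le (by omega)
  rw [hv1] at hs1 ⊢
  have hv2 : (Expr.cell 0 (2 + rn * rn)).val (s.setReg 3 B) = len := by simp [h1, hlen]
  refine Runs.assign_seq hs1 (le_trans (by decide) hZ) ?_ fun hs2 => ?_
  · rw [hv2]; exact bitLen_natCast_le (by omega)
  rw [hv2] at hs2 ⊢
  have hv3 : ((3 + rn * rn + rlen * (rn + 3)) * (rn + rlen + 2) : Expr).val
      ((s.setReg 3 B).setReg 4 len) = M := by simp [h1, hM, sizeBound]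
  refine Runs.assign_seq hs2 (le_trans (by decide) hZ) ?_ fun hs3 => ?_
  · rw [hv3]; exact bitLen_natCast_le (by omega)
  rw [hv3] at hs3 ⊢
  set s3 := ((s.setReg 3 B).setReg 4 len).setReg 19 M with hs3'
  have b3 : s3.bank = s.bank := rfl
  have u3 : s3.used = 0 := hu
  have r1 : s3.reg 1 = n := by simp [hs3', h1]
  have r2 : s3.reg 2 = q := by simp [hs3', h2]
  have r3 : s3.reg 3 = B := by simp [hs3']
  have r4 : s3.reg 4 = len := by simp [hs3']
  have r7 : s3.reg 7 = 0 := by simp [hs3', h7]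
  have r19 : s3.reg 19 = M := by simp [hs3']
  clear_value s3
  refine (numBits_spec hs3 hZ (by omega) r19 (by omega) (by omega) (by omega)).seq
    fun s4 hs4 hf4 h4 => ?_
  refine (degrees_spec (n := n) (adj := adj) hs4 hZ (by rw [hf4.reg 1 rfl, r1]) (by omega)
    (by rw [hf4.bank 0 rfl, b3]; exact hadj) hle).seq fun s5 hs5 hf5 h5 => ?_
  refine (powers_spec (n := n) (B := B) hs5 hZ (by rw [hf5.reg 1 rfl, hf4.reg 1 rfl, r1])
    (by rw [hf5.reg 3 rfl, hf4.reg 3 rfl, r3]) (by omega) (by omega) hBn).seq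
    fun s6 hs6 hf6 h6 => ?_
  refine (weights_spec (n := n) (K := K) hs6 hZ
    (by rw [hf6.reg 1 rfl, hf5.reg 1 rfl, hf4.reg 1 rfl, r1])
    (by rw [hf6.reg 5 rfl, hf5.reg 5 rfl, h4, ← hKM])
    (by rw [hf6.used rfl, hf5.used rfl, hf4.used rfl, u3]) (by omega) (by omega) hKW).seq
    fun s7 hs7 hf7 h7' => ?_
  refine (powerSums_spec (n := n) (q := q) (B := B) (K := K) (y := weight ρ K) hs7 hZ
    (by rw [hf7.reg 1 rfl, hf6.reg 1 rfl, hf5.reg 1 rfl, hf4.reg 1 rfl, r1])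
    (by rw [hf7.reg 2 rfl, hf6.reg 2 rfl, hf5.reg 2 rfl, hf4.reg 2 rfl, r2])
    (by rw [hf7.reg 3 rfl, hf6.reg 3 rfl, hf5.reg 3 rfl, hf4.reg 3 rfl, r3])
    (by omega) (by omega) (by omega) h7' (fun w _ => ofBits_lt _ _) hSmW).seq
    fun s8 hs8 hf8 h8 => ?_
  refine Runs.store_seq hs8 (le_trans (by decide) hZ) (le_trans (by decide) hZ)
    (bitLen_one_le (by omega)) fun hs9 => ?_
  simp only [val_zero, val_one] at hs9 ⊢
  set d : ℕ → ℕ := fun w => ∑ x ∈ range n, adj w x with hd'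
  set S : ℕ → ℕ → ℤ := fun w => powerSum q (weight ρ K w) with hS'
  have hdB : ∀ w < n, d w < B := fun w _ => by
    have : d w ≤ n := (sum_le_sum fun x _ => hle w x).trans (by simp)
    omega
  have hS : ∀ w < n, ∀ i ≤ d w, |S w i| ≤ (Sm : ℤ) := by
    intro w hw i hi
    have hi' := hdB w hw
    have hc : S w i = (∑ t ∈ range q, weight ρ K w ^ t * t ^ i : ℕ) := by
      simp [hS', powerSum]
    rw [hc, Nat.abs_cast, Nat.cast_le]
    calc ∑ t ∈ range q, weight ρ K w ^ t * t ^ i ≤ ∑ _t ∈ range q, 2 ^ (K * q) * B ^ B :=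
          sum_le_sum fun t ht => by
            have := mem_range.1 ht
            exact pow_mul_pow_le (ofBits_lt _ _) (by omega) (by omega) (by omega) (by omega)
      _ = q * (2 ^ (K * q) * B ^ B) := by simp
      _ ≤ _ := Nat.mul_le_mul_right _ (by omega)
  have hb0 : s8.bank 0 = s.bank 0 := by
    rw [hf8.bank 0 rfl, hf7.bank 0 rfl, hf6.bank 0 rfl, hf5.bank 0 rfl, hf4.bank 0 rfl, b3]
  have hF : Fixed n B len d S kd ku kv (s8.setCell 7 0 1) := by
    refine Fixed.frame (s := s8) (c := .store 7 0 1) ?_ (frame_store _ _ _ _ _ _) rfl rfl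
    refine ⟨?_, ?_, ?_, ?_, ?_, ?_, ?_, ?_, ?_, ?_⟩
    · rw [hf8.reg 1 rfl, hf7.reg 1 rfl, hf6.reg 1 rfl, hf5.reg 1 rfl, hf4.reg 1 rfl, r1]
    · rw [hf8.reg 3 rfl, hf7.reg 3 rfl, hf6.reg 3 rfl, hf5.reg 3 rfl, hf4.reg 3 rfl, r3]
    · rw [hf8.reg 4 rfl, hf7.reg 4 rfl, hf6.reg 4 rfl, hf5.reg 4 rfl, hf4.reg 4 rfl, r4]
    · rw [hf8.reg 6 rfl, hf7.reg 6 rfl, h6.2]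
    · rw [hb0]; exact hkd
    · rw [hb0]; exact hku
    · rw [hb0]; exact hkv
    · rw [hf8.bank 1 rfl, hf7.bank 1 rfl, hf6.bank 1 rfl]; exact h5
    · exact h8
    · rw [hf8.bank 4 rfl, hf7.bank 4 rfl]; exact h6.1
  have hE : Introduced n B d S [] (s8.setCell 7 0 1) := by
    refine ⟨?_, fun w hw => ?_, fun x hx y hy => ?_, fun e he => ?_⟩
    · simp [hf8.reg 7 rfl, hf7.reg 7 rfl, hf6.reg 7 rfl, hf5.reg 7 rfl, hf4.reg 7 rfl, r7]
    · simp [hf8.bank 5 rfl, hf7.bank 5 rfl, hf6.bank 5 rfl, hf5.bank 5 rfl, hf4.bank 5 rfl, b3,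
        hbank, deg]
    · simp [hf8.bank 6 rfl, hf7.bank 6 rfl, hf6.bank 6 rfl, hf5.bank 6 rfl, hf4.bank 6 rfl, b3,
        hbank]
    · have he0 : ∀ w < n, e w = (0 : ℕ → ℕ) w := fun w hw => by
        have := he w hw
        simp only [deg, radix] at this
        simp only [Pi.zero_apply]
        omega
      have : address n B e = 0 := sum_eq_zero fun w hw => by
        rw [he0 w (mem_range.1 hw)]; simp
      rw [this, table_congr he0]
      simp [table, expand, deg, kernel]
  -- `P` itself need not fit into `W` bits, but the tables have at most `B ^ n` entries.
  refine (nodes_spec (P := min P (B ^ n)) hs9 hZ hF hE hk hd hdB (by exact_mod_cast hSm1) hS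
    (fun j hj => le_min (hP j hj) ?_) (by omega) (by omega) ((min_le_right _ _).trans_lt hBn) hBn
    (by omega) ?_).mono (m' := (1 + (1 + (5 * n + 18 +
      (6 * n + 4 + (1 + ((3 * B + 4) * B + 2 + 2)) + 2) * P)) + 2) * len + 2) ?_
      (fun _ _ _ h => h) |>.seq fun s9 hs9 hf9 h9 => ?_
  · calc _ ≤ ∏ _w ∈ range n, B := prod_le_prod' fun w hw => by
          have := hdB w (mem_range.1 hw)
          exact radix_le.trans this
      _ = _ := by simp
  · rw [hSm]
    push_cast at hbig ⊢
    exact hbig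
  · have hmin : min P (B ^ n) ≤ P := min_le_left _ _
    gcongr
  · have hF9 := hF.frame hf9 rfl rfl
    have h0 := h9.table 0 (fun w _ => by simp [radix])
    have ha : address n B 0 = 0 := sum_eq_zero fun w _ => by simp
    rw [ha] at h0
    push_cast at h0
    have hv : (1 - .op .eq (.cell 7 (.reg 7 * rBN)) 0 : Expr).val s9
        = if table n d S (edges kd ku kv len) 0 = 0 then 0 else 1 := by
      have h6' := hF9.reg_BN
      push_cast at h6'
      simp only [val_sub, val_one, val_eq, val_cell, val_mul, val_reg, val_zero, h9.time, h6']
      rw [add_zero] at h0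
      rw [h0]
      split_ifs <;> simp
    refine Runs.assign hs9 (le_trans (by decide) hZ) ?_ ?_
    · rw [hv]
      split_ifs
      · exact bitLen_zero_le
      · exact bitLen_one_le (by omega)
    · rw [hv]; simp

/-- The program answers yes if there are at least as many colors as vertices. -/
theorem program_spec_of_le {c n q : ℕ} (hs : s.Bounded W) (hW : 1 ≤ W) (h0 : s.bank 0 0 = n)
    (h1 : s.bank 0 1 = q) (h : n ≤ q) :
    Runs ρ W (c + 400) (program c) s 4 (fun s' => s'.reg 0 = 1) := by
  have hZ : 400 ≤ c + 400 := by omega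
  refine Runs.le (m := 1 + (1 + (1 + 1))) ?_ le_rfl
  refine Runs.assign_seq hs (le_trans (by decide) hZ) (hs.bank _ _) fun hs1 => ?_
  refine Runs.assign_seq hs1 (le_trans (by decide) hZ) (hs1.bank _ _) fun hs2 => ?_
  refine Runs.ite hs2 (le_trans (by decide) hZ) (fun hc => ?_) (fun _ => ?_)
  · simp [h0, h1] at hc; omega
  · exact Runs.assign hs2 (le_trans (by decide) hZ) (bitLen_one_le hW) (by simp)

/-- The program answers no if there are vertices but no colors. -/
theorem program_spec_of_zero {c n : ℕ} (hs : s.Bounded W) (h0 : s.bank 0 0 = n)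
    (h1 : s.bank 0 1 = 0) (h : 0 < n) :
    Runs ρ W (c + 400) (program c) s 5 (fun s' => s'.reg 0 = 0) := by
  have hZ : 400 ≤ c + 400 := by omega
  refine Runs.le (m := 1 + (1 + (1 + (1 + 1)))) ?_ le_rfl
  refine Runs.assign_seq hs (le_trans (by decide) hZ) (hs.bank _ _) fun hs1 => ?_
  refine Runs.assign_seq hs1 (le_trans (by decide) hZ) (hs1.bank _ _) fun hs2 => ?_
  refine Runs.ite hs2 (le_trans (by decide) hZ) (fun _ => ?_) (fun hc => ?_)
  · refine Runs.ite hs2 (le_trans (by decide) hZ) (fun _ => ?_) (fun hc => ?_)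
    · exact Runs.assign hs2 (le_trans (by decide) hZ) bitLen_zero_le (by simp)
    · simp [h1] at hc
  · simp [h0, h1] at hc; omega

theorem program_spec {c n q len P : ℕ} {adj : ℕ → ℕ → ℕ} {kd ku kv : ℕ → ℕ}
    (hq0 : 0 < q) (hqn : q < n) (hs : s.Bounded (20 * bitBound c n len ^ 3))
    (h0 : s.bank 0 0 = n) (h1 : s.bank 0 1 = q) (hreg : ∀ r, s.reg r = 0) (hu : s.used = 0)
    (hbank : ∀ a, a ≠ 0 → ∀ i, s.bank a i = 0)
    (hadj : ∀ w < n, ∀ x < n, s.bank 0 (2 + w * n + x) = adj w x) (hle : ∀ w x, adj w x ≤ 1)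
    (hlen : s.bank 0 (2 + n * n) = len)
    (hkd : ∀ j < len, s.bank 0 (3 + n * n + j * (n + 3)) = kd j)
    (hku : ∀ j < len, s.bank 0 (3 + n * n + j * (n + 3) + 1) = ku j)
    (hkv : ∀ j < len, s.bank 0 (3 + n * n + j * (n + 3) + 2) = kv j)
    (hk : ∀ j < len, kd j = 2 → ku j < n ∧ kv j < n ∧ ku j ≠ kv j)
    (hd : ∀ w < n, deg (edges kd ku kv len) w ≤ ∑ x ∈ range n, adj w x)
    (hP : ∀ j ≤ len,
      ∏ w ∈ range n, radix (∑ x ∈ range n, adj w x) (deg (edges kd ku kv j) w) ≤ P) :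
    Runs ρ (20 * bitBound c n len ^ 3) (c + 400) (program c) s
      (1 + (1 + (1 + (1 + (c + 100) * bitBound c n len ^ 4 * P))))
      (fun s' => s'.reg 0 = if table n (fun w => ∑ x ∈ range n, adj w x)
        (fun w => powerSum q (weight ρ (bitBound c n len) w)) (edges kd ku kv len) 0 = 0
        then 0 else 1) := by
  have hZ : 400 ≤ c + 400 := by omega
  refine Runs.assign_seq hs (le_trans (by decide) hZ) (hs.bank _ _) fun hs1 => ?_
  refine Runs.assign_seq hs1 (le_trans (by decide) hZ) (hs1.bank _ _) fun hs2 => ?_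
  refine Runs.ite hs2 (le_trans (by decide) hZ) (fun _ => ?_) (fun hc => ?_)
  · refine Runs.ite hs2 (le_trans (by decide) hZ) (fun hc => ?_) (fun _ => ?_)
    · simp [h1] at hc; omega
    · exact main_spec hq0 hqn hs2 (by simp [h0]) (by simp [h1]) (by simp [hreg]) hu hbank hadj hle
        hlen hkd hku hkv hk hd hP
  · simp [h0, h1] at hc; omega

end ColoringProgram

/-! ### The input -/

namespace ColoringProgram

open RAM Finset ColoringTable

theorem length_flatMap_of_forall {α : Type*} {k : ℕ} {f : α → List ℕ} (hf : ∀ a, (f a).length = k)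
    (l : List α) : (l.flatMap f).length = l.length * k := by
  induction l with
  | nil => simp
  | cons a l ih => simp [ih, hf a]; ring

theorem getElem?_flatMap_of_forall {α : Type*} {k : ℕ} {f : α → List ℕ}
    (hf : ∀ a, (f a).length = k) (l : List α) (i : ℕ) (hi : i < l.length) {t : ℕ} (ht : t < k) :
    (l.flatMap f)[i * k + t]? = (f l[i])[t]? := by
  induction l generalizing i with
  | nil => simp at hi
  | cons a l ih =>
    rw [List.flatMap_cons]
    cases i with
    | zero => rw [List.getElem?_append_left (by rw [hf]; omega)]; simp
    | succ i =>
      have h1 : (i + 1) * k + t = (f a).length + (i * k + t) := by rw [hf]; ring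
      rw [h1, List.getElem?_append_right (by omega), Nat.add_sub_cancel_left,
        ih i (by simpa using hi)]
      simp

open Classical in
/-- The adjacency matrix of a graph on `Fin n`, extended by zeros. -/
noncomputable def adjacency {n : ℕ} (G : SimpleGraph (Fin n)) (u v : ℕ) : ℕ :=
  if h : u < n ∧ v < n then (if G.Adj ⟨u, h.1⟩ ⟨v, h.2⟩ then 1 else 0) else 0

theorem adjacency_le_one {n : ℕ} (G : SimpleGraph (Fin n)) (u v : ℕ) : adjacency G u v ≤ 1 := by
  unfold adjacency; split_ifs <;> simp

variable {n : ℕ} {G : SimpleGraph (Fin n)}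

/-- The `t`-th number of the label of the node `j`. -/
def label (D : NicePathDecomposition G) (t j : ℕ) : ℕ :=
  if h : j < D.len then (D.kind ⟨j, h⟩).encode.getD t 0 else 0

theorem length_encode (x : NodeKind n) : x.encode.length = 3 := by cases x <;> rfl

theorem length_encodeInput (q : ℕ) (D : NicePathDecomposition G) :
    (encodeInput q G D).length = 3 + n * n + D.len * (n + 3) := by
  unfold encodeInput
  rw [List.length_append, List.length_append, List.length_append,
    length_flatMap_of_forall (k := n) (by simp),
    length_flatMap_of_forall (k := n + 3) (by simp [length_encode]; omega)]
  simp
  omega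

theorem encodeInput_adjacency (q : ℕ) (D : NicePathDecomposition G) {u v : ℕ} (hu : u < n)
    (hv : v < n) : (encodeInput q G D).getD (2 + u * n + v) 0 = adjacency G u v := by
  classical
  have h1 : u * n + v < n * n := by nlinarith
  unfold encodeInput
  rw [List.getD_eq_getElem?_getD, List.getElem?_append_left, List.getElem?_append_left,
    List.getElem?_append_right]
  · have h2 : 2 + u * n + v - [n, q].length = u * n + v := by simp; omega
    rw [h2, getElem?_flatMap_of_forall (k := n) (by simp) _ _ (by simpa using hu) hv]
    simp [adjacency, hu, hv]
  · simp; omega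
  · rw [List.length_append, length_flatMap_of_forall (k := n) (by simp)]; simp; omega
  · rw [List.length_append, List.length_append, length_flatMap_of_forall (k := n) (by simp)]
    simp; omega

theorem encodeInput_len (q : ℕ) (D : NicePathDecomposition G) :
    (encodeInput q G D).getD (2 + n * n) 0 = D.len := by
  classical
  unfold encodeInput
  rw [List.getD_eq_getElem?_getD, List.getElem?_append_left, List.getElem?_append_right]
  · rw [List.length_append, length_flatMap_of_forall (k := n) (by simp)]
    simp
  · rw [List.length_append, length_flatMap_of_forall (k := n) (by simp)]; simp
  · rw [List.length_append, List.length_append, length_flatMap_of_forall (k := n) (by simp)]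
    simp

theorem encodeInput_label (q : ℕ) (D : NicePathDecomposition G) {j t : ℕ} (hj : j < D.len)
    (ht : t < 3) :
    (encodeInput q G D).getD (3 + n * n + j * (n + 3) + t) 0 = label D t j := by
  classical
  unfold encodeInput
  rw [List.getD_eq_getElem?_getD, List.getElem?_append_right]
  · rw [List.length_append, List.length_append, length_flatMap_of_forall (k := n) (by simp)]
    have h2 : 3 + n * n + j * (n + 3) + t - ([n, q].length + (List.finRange n).length * n
        + [D.len].length) = j * (n + 3) + t := by simp; omega
    rw [h2, getElem?_flatMap_of_forall (k := n + 3) (by simp [length_encode]; omega) _ _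
      (by simpa using hj) (by omega), List.getElem?_append_left (by rw [length_encode]; exact ht)]
    simp [label, hj]
  · rw [List.length_append, List.length_append, length_flatMap_of_forall (k := n) (by simp)]
    simp; omega

theorem length_le_inputSize (l : List ℕ) : l.length ≤ inputSize l := by
  unfold inputSize
  induction l with
  | nil => simp
  | cons a l ih => simp at ih ⊢; omega

theorem size_le_inputSize {l : List ℕ} {a : ℕ} (h : a ∈ l) : Nat.size a ≤ inputSize l := by
  unfold inputSize
  have := List.le_sum_of_mem (List.mem_map_of_mem (f := fun a => Nat.size a + 1) h)
  omega

theorem inputSize_le_of_forall {l : List ℕ} {b : ℕ} (h : ∀ a ∈ l, Nat.size a + 1 ≤ b) :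
    inputSize l ≤ l.length * b := by
  unfold inputSize
  have := List.sum_le_card_nsmul (l.map fun a => Nat.size a + 1) b (by simpa using h)
  simpa using this

theorem size_le_self (a : ℕ) : Nat.size a ≤ a := Nat.size_le.2 Nat.lt_two_pow_self

theorem inputSize_le_sizeBound {q : ℕ} (hq : q < n) (D : NicePathDecomposition G) :
    inputSize (encodeInput q G D) ≤ sizeBound n D.len := by
  classical
  unfold sizeBound
  rw [← length_encodeInput q D]
  refine inputSize_le_of_forall fun a ha => ?_
  have h3 : Nat.size 3 = 2 := by decide +revert
  have h : a ≤ n ∨ a ≤ D.len ∨ a ≤ 3 := by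
    simp only [encodeInput, List.mem_append, List.mem_flatMap, List.mem_map, List.mem_cons,
      List.not_mem_nil, or_false] at ha
    rcases ha with (((rfl | rfl) | ⟨u, -, v, -, rfl⟩) | rfl) | ⟨i, -, h | ⟨v, -, rfl⟩⟩
    · omega
    · omega
    · split_ifs <;> omega
    · omega
    · cases hk : D.kind i <;> simp [hk, NodeKind.encode] at h <;> omega
    · split_ifs <;> omega
  have hlen := D.len_pos
  have hs : Nat.size a ≤ n + D.len + 1 := by
    rcases h with h | h | h
    · have := size_le_self a; omega
    · have := size_le_self a; omega
    · have := Nat.size_le_size h; omega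
  omega

theorem sizeBound_le (q : ℕ) (D : NicePathDecomposition G) :
    sizeBound n D.len ≤ inputSize (encodeInput q G D) ^ 2 := by
  have h1 := length_le_inputSize (encodeInput q G D)
  rw [length_encodeInput] at h1
  unfold sizeBound
  rw [sq]
  refine Nat.mul_le_mul h1 (le_trans ?_ h1)
  have : n ≤ n * n := Nat.le_mul_self n
  nlinarith [Nat.zero_le (D.len * n)]

theorem start_bounded {l : List ℕ} {W : ℕ} (h : inputSize l ≤ W) : (start l).Bounded W := by
  refine ⟨fun r => bitLen_zero_le, fun a i => ?_⟩
  simp only [start]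
  split_ifs
  · have : bitLen ((l.getD i.toNat 0 : ℕ) : ℤ) = Nat.size (l.getD i.toNat 0) := by simp [bitLen]
    rw [this]
    by_cases hi : i.toNat < l.length
    · rw [List.getD_eq_getElem _ _ hi]
      exact (size_le_inputSize (List.getElem_mem hi)).trans h
    · rw [List.getD_eq_default _ _ (by omega)]; simp
  · exact bitLen_zero_le

theorem start_bank_zero (l : List ℕ) (i : ℕ) : (start l).bank 0 i = (l.getD i 0 : ℕ) := by
  simp [start]

end ColoringProgram

/-! ### The edges introduced by a nice path decomposition -/

namespace ColoringProgram

open RAM Finset ColoringTable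

variable {n : ℕ} {G : SimpleGraph (Fin n)}

/-- The edges that are introduced at the first `j` nodes, without repetitions. -/
abbrev edgeList (D : NicePathDecomposition G) (j : ℕ) : List (ℕ × ℕ) :=
  edges (label D 0) (label D 1) (label D 2) j

theorem label_eq_two {D : NicePathDecomposition G} {j : ℕ} (hj : j < D.len)
    (h : label D 0 j = 2) : ∃ u v : Fin n, D.kind ⟨j, hj⟩ = .introEdge u v ∧
      label D 1 j = u ∧ label D 2 j = v ∧ G.Adj u v := by
  have hv := D.kind_valid ⟨j, hj⟩
  simp only [label, dif_pos hj] at h ⊢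
  cases hk : D.kind ⟨j, hj⟩ <;> rw [hk] at h hv <;> simp [NodeKind.encode] at h
  obtain ⟨-, p, -, hadj, -⟩ := hv
  exact ⟨_, _, rfl, by simp [NodeKind.encode], by simp [NodeKind.encode], hadj⟩

theorem label_of_kind {D : NicePathDecomposition G} {j : ℕ} (hj : j < D.len) {u v : Fin n}
    (h : D.kind ⟨j, hj⟩ = .introEdge u v) :
    label D 0 j = 2 ∧ label D 1 j = u ∧ label D 2 j = v := by
  simp [label, hj, h, NodeKind.encode]

/-- Up to orientation, exactly the edges introduced at the first `j` nodes are in `edgeList D j`. -/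
theorem mem_edgeList_or_iff (D : NicePathDecomposition G) {j : ℕ} (hj : j ≤ D.len) (x y : Fin n) :
    ((x.val, y.val) ∈ edgeList D j ∨ (y.val, x.val) ∈ edgeList D j) ↔
      ∃ i : Fin D.len, i.val < j ∧ (D.kind i = .introEdge x y ∨ D.kind i = .introEdge y x) := by
  induction j with
  | zero => simp [edgeList, edges]
  | succ j ih =>
    specialize ih (by omega)
    have hsplit : (∃ i : Fin D.len, i.val < j + 1 ∧
        (D.kind i = .introEdge x y ∨ D.kind i = .introEdge y x)) ↔
        ((∃ i : Fin D.len, i.val < j ∧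
          (D.kind i = .introEdge x y ∨ D.kind i = .introEdge y x)) ∨
        (D.kind ⟨j, hj⟩ = .introEdge x y ∨ D.kind ⟨j, hj⟩ = .introEdge y x)) := by
      constructor
      · rintro ⟨i, hi, h⟩
        rcases Nat.lt_succ_iff_lt_or_eq.1 hi with hi | hi
        · exact Or.inl ⟨i, hi, h⟩
        · right
          have : i = ⟨j, hj⟩ := Fin.ext hi
          rwa [← this]
      · rintro (⟨i, hi, h⟩ | h)
        · exact ⟨i, by omega, h⟩
        · exact ⟨⟨j, hj⟩, by simp, h⟩
    rw [hsplit, ← ih]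
    have hkind : (D.kind ⟨j, hj⟩ = .introEdge x y ∨ D.kind ⟨j, hj⟩ = .introEdge y x) ↔
        (label D 0 j = 2 ∧ ((x.val, y.val) = (label D 1 j, label D 2 j) ∨
          (y.val, x.val) = (label D 1 j, label D 2 j))) := by
      constructor
      · rintro (h | h)
        · obtain ⟨h0, h1, h2⟩ := label_of_kind hj h
          exact ⟨h0, Or.inl (by rw [h1, h2])⟩
        · obtain ⟨h0, h1, h2⟩ := label_of_kind hj h
          exact ⟨h0, Or.inr (by rw [h1, h2])⟩
      · rintro ⟨h0, h⟩
        obtain ⟨u, v, hk, h1, h2, -⟩ := label_eq_two hj h0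
        rw [h1, h2] at h
        simp only [Prod.mk.injEq, Fin.val_inj] at h
        rcases h with ⟨rfl, rfl⟩ | ⟨rfl, rfl⟩
        · exact Or.inl hk
        · exact Or.inr hk
    rw [hkind]
    simp only [edgeList, edges]
    split_ifs with hc
    · simp only [List.mem_cons, hc.1, true_and]
      rw [or_or_or_comm, or_comm]
    · constructor
      · exact Or.inl
      · rintro (h | ⟨h0, h⟩)
        · exact h
        · have hc' := not_not.1 fun h' => hc ⟨h0, h'⟩
          rcases h with h | h
          · rw [h]; simp only [Prod.mk.injEq] at h; rw [h.1, h.2]; exact hc'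
          · rw [h]; simp only [Prod.mk.injEq] at h; rw [h.1, h.2]; exact hc'.symm

theorem mem_edgeList {D : NicePathDecomposition G} {j : ℕ} (hj : j ≤ D.len) {p : ℕ × ℕ}
    (hp : p ∈ edgeList D j) : ∃ u v : Fin n, p = (u.val, v.val) ∧ G.Adj u v := by
  induction j with
  | zero => simp [edgeList, edges] at hp
  | succ j ih =>
    simp only [edgeList, edges] at hp
    split_ifs at hp with hc
    · rcases List.mem_cons.1 hp with rfl | hp
      · obtain ⟨u, v, -, h1, h2, hadj⟩ := label_eq_two hj hc.1
        exact ⟨u, v, by rw [h1, h2], hadj⟩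
      · exact ih (by omega) hp
    · exact ih (by omega) hp

/-- As `edgeList D j` has no repetitions, not even with the opposite orientation, the degree is the
number of neighbors. -/
theorem deg_edgeList (D : NicePathDecomposition G) {j : ℕ} (hj : j ≤ D.len) (w : Fin n) :
    deg (edgeList D j) w =
      (univ.filter fun x : Fin n => (w.val, x.val) ∈ edgeList D j ∨
        (x.val, w.val) ∈ edgeList D j).card := by
  induction j with
  | zero => simp [edgeList, edges, deg]
  | succ j ih =>
    specialize ih (by omega)
    by_cases hc : label D 0 j = 2 ∧ ¬((label D 1 j, label D 2 j) ∈ edgeList D j ∨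
        (label D 2 j, label D 1 j) ∈ edgeList D j)
    · obtain ⟨u, v, -, h1, h2, hadj⟩ := label_eq_two hj hc.1
      have hsucc : edgeList D (j + 1) = (u.val, v.val) :: edgeList D j := by
        simp only [edgeList, edges]
        rw [if_pos hc, h1, h2]
      have hnot := hc.2
      rw [h1, h2] at hnot
      have huv := hadj.ne
      rw [hsucc]
      simp only [deg, ih, List.mem_cons, Prod.mk.injEq, Fin.val_inj]
      by_cases hwu : w = u
      · subst hwu
        have hset : (univ.filter fun x : Fin n => (w = w ∧ x = v ∨ (w.val, x.val) ∈ edgeList D j) ∨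
            (x = w ∧ w = v ∨ (x.val, w.val) ∈ edgeList D j)) =
            insert v (univ.filter fun x : Fin n => (w.val, x.val) ∈ edgeList D j ∨
              (x.val, w.val) ∈ edgeList D j) := by
          ext x
          simp only [mem_filter, mem_univ, true_and, mem_insert, huv, and_false]
          tauto
        rw [hset, card_insert_of_notMem (by simpa using hnot)]
        simp [huv]
      · by_cases hwv : w = v
        · subst hwv
          have hset : (univ.filter fun x : Fin n => (w = u ∧ x = w ∨
              (w.val, x.val) ∈ edgeList D j) ∨ (x = u ∧ w = w ∨ (x.val, w.val) ∈ edgeList D j)) =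
              insert u (univ.filter fun x : Fin n => (w.val, x.val) ∈ edgeList D j ∨
                (x.val, w.val) ∈ edgeList D j) := by
            ext x
            simp only [mem_filter, mem_univ, true_and, mem_insert, hwu, false_and]
            tauto
          rw [hset, card_insert_of_notMem (by simpa [or_comm] using hnot)]
          simp [hwu]
        · simp [hwu, hwv]
    · have hsucc : edgeList D (j + 1) = edgeList D j := by
        simp only [edgeList, edges]
        rw [if_neg hc]
      rw [hsucc]
      exact ih

theorem deg_edgeList_succ (D : NicePathDecomposition G) (i : Fin D.len) (v : Fin n) :
    deg (edgeList D (i + 1)) v = D.introducedDegree i v := by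
  classical
  rw [deg_edgeList D (Nat.succ_le_of_lt i.2)]
  unfold NicePathDecomposition.introducedDegree
  rw [← card_image_of_injective (f := fun x => s(v, x)) _
    (fun a b h => Sym2.congr_right.1 h)]
  congr 1
  ext e
  simp only [mem_image, mem_filter, mem_univ, true_and, NicePathDecomposition.introduced,
    mem_edgeList_or_iff D (Nat.succ_le_of_lt i.2)]
  constructor
  · rintro ⟨x, ⟨j, hj, h⟩, rfl⟩
    refine ⟨⟨j, by rw [Fin.le_def]; omega, ?_⟩, by simp⟩
    rcases h with h | h
    · exact ⟨_, _, h, rfl⟩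
    · exact ⟨_, _, h, Sym2.eq_swap⟩
  · rintro ⟨⟨j, hj, a, b, h, rfl⟩, hv⟩
    rw [Fin.le_def] at hj
    rcases Sym2.mem_iff.1 hv with rfl | rfl
    · exact ⟨b, ⟨j, by omega, Or.inl h⟩, rfl⟩
    · exact ⟨a, ⟨j, by omega, Or.inr h⟩, Sym2.eq_swap⟩

theorem adj_iff_mem_edgeList (D : NicePathDecomposition G) (x y : Fin n) :
    ((x.val, y.val) ∈ edgeList D D.len ∨ (y.val, x.val) ∈ edgeList D D.len) ↔ G.Adj x y := by
  constructor
  · rintro (h | h)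
    · obtain ⟨u, v, huv, hadj⟩ := mem_edgeList le_rfl h
      simp only [Prod.mk.injEq, Fin.val_inj] at huv
      rw [huv.1, huv.2]; exact hadj
    · obtain ⟨u, v, huv, hadj⟩ := mem_edgeList le_rfl h
      simp only [Prod.mk.injEq, Fin.val_inj] at huv
      rw [huv.1, huv.2]; exact hadj.symm
  · intro h
    rw [mem_edgeList_or_iff D le_rfl]
    obtain ⟨i, hi⟩ := D.edge_introduced x y h
    exact ⟨i, i.2, hi⟩

theorem sum_adjacency (w : Fin n) [Fintype (G.neighborSet w)] :
    ∑ x ∈ range n, adjacency G w x = G.degree w := by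
  classical
  have h : G.neighborFinset w = univ.filter (G.Adj w) := by ext; simp
  rw [sum_range, ← SimpleGraph.card_neighborFinset_eq_degree, h, card_eq_sum_ones, sum_filter]
  refine sum_congr rfl fun x _ => ?_
  simp [adjacency]

theorem deg_edgeList_len (D : NicePathDecomposition G) {w : ℕ} (hw : w < n) :
    deg (edgeList D D.len) w = ∑ x ∈ range n, adjacency G w x := by
  classical
  have h1 := sum_adjacency (G := G) ⟨w, hw⟩
  have h2 := deg_edgeList D le_rfl ⟨w, hw⟩
  simp only at h1 h2
  rw [h1, h2, ← SimpleGraph.card_neighborFinset_eq_degree, SimpleGraph.neighborFinset_eq_filter]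
  congr 1
  ext x
  simp only [mem_filter, mem_univ, true_and]
  exact adj_iff_mem_edgeList D ⟨w, hw⟩ x

/-- The edges at a vertex are introduced while the vertex is in the bag, so outside of its bags
either none or all of its edges are introduced. -/
theorem radix_eq_one_of_notMem (D : NicePathDecomposition G) (i : Fin D.len) {v : Fin n}
    (hv : v ∉ D.bag i) :
    radix (∑ x ∈ range n, adjacency G v x) (deg (edgeList D (i + 1)) v) = 1 := by
  classical
  have hmem : ∀ (j : Fin D.len) (x : Fin n),
      (D.kind j = .introEdge v x ∨ D.kind j = .introEdge x v) → v ∈ D.bag j := by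
    intro j x h
    have := D.kind_valid j
    rcases h with h | h
    · rw [h] at this
      obtain ⟨-, p, -, -, h1, -, h2⟩ := this
      rw [h2]; exact h1
    · rw [h] at this
      obtain ⟨-, p, -, -, -, h1, h2⟩ := this
      rw [h2]; exact h1
  by_cases h : ∃ (x : Fin n) (j : Fin D.len), j ≤ i ∧
      (D.kind j = .introEdge v x ∨ D.kind j = .introEdge x v)
  · obtain ⟨x, j, hji, hj⟩ := h
    have hle : ∑ x ∈ range n, adjacency G v x ≤ deg (edgeList D (i + 1)) v := by
      rw [sum_adjacency, deg_edgeList D (Nat.succ_le_of_lt i.2),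
        ← SimpleGraph.card_neighborFinset_eq_degree]
      refine card_le_card fun y hy => ?_
      rw [SimpleGraph.mem_neighborFinset] at hy
      simp only [mem_filter, mem_univ, true_and]
      rw [mem_edgeList_or_iff D (Nat.succ_le_of_lt i.2)]
      obtain ⟨k, hk⟩ := D.edge_introduced v y hy
      by_cases hki : k ≤ i
      · rw [Fin.le_def] at hki
        exact ⟨k, by omega, hk⟩
      · exact absurd (D.convex j i k hji (le_of_not_ge hki) v (hmem j x hj) (hmem k y hk)) hv
    -- the truncated difference of the degrees is `0`
    unfold radix; omega
  · have h0 : deg (edgeList D (i + 1)) v = 0 := by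
      rw [deg_edgeList D (Nat.succ_le_of_lt i.2), card_eq_zero, filter_eq_empty_iff]
      intro x _ hx
      rw [mem_edgeList_or_iff D (Nat.succ_le_of_lt i.2)] at hx
      obtain ⟨j, hj, hx⟩ := hx
      exact h ⟨x, j, by rw [Fin.le_def]; omega, hx⟩
    rw [h0]; simp [radix]

theorem one_le_tableSize (D : NicePathDecomposition G) : 1 ≤ D.tableSize := by
  classical
  refine le_trans ?_ (le_sup (f := fun i : Fin D.len => ∏ v ∈ D.bag i,
    (min (D.introducedDegree i v) (G.degree v - D.introducedDegree i v) + 1))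
    (mem_univ ⟨0, D.len_pos⟩))
  exact one_le_prod' fun v _ => by omega

/-- The tables of the algorithm are not larger than the products in the running time. -/
theorem prod_radix_le_tableSize (D : NicePathDecomposition G) {j : ℕ} (hj : j ≤ D.len) :
    ∏ w ∈ range n, radix (∑ x ∈ range n, adjacency G w x) (deg (edgeList D j) w)
      ≤ D.tableSize := by
  classical
  cases j with
  | zero =>
    refine le_trans (le_of_eq ?_) (one_le_tableSize D)
    exact prod_eq_one fun w _ => by simp [edgeList, edges, deg, radix]
  | succ j =>
    rw [prod_range, ← prod_subset (subset_univ (D.bag ⟨j, hj⟩))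
      (fun v _ hv => radix_eq_one_of_notMem D ⟨j, hj⟩ hv)]
    refine le_trans (le_of_eq ?_) (le_sup (f := fun i : Fin D.len => ∏ v ∈ D.bag i,
      (min (D.introducedDegree i v) (G.degree v - D.introducedDegree i v) + 1))
      (mem_univ ⟨j, hj⟩))
    refine prod_congr rfl fun v _ => ?_
    have := deg_edgeList_succ D ⟨j, hj⟩ v
    simp only at this
    rw [this, sum_adjacency]
    rfl

end ColoringProgram

/-! ### The generating function and its zeros -/

namespace ColoringProgram

open RAM Finset ColoringTable

/-- The generating function of the values of the graph polynomial: the coefficient of `∏_v Y_v ^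
x_v` is the value at `x`. -/
noncomputable def genPoly (n q : ℕ) (d : ℕ → ℕ) (E : List (ℕ × ℕ)) : MvPolynomial (Fin n) ℤ :=
  ∑ x ∈ Fintype.piFinset (fun w : Fin n => palette q d w),
    MvPolynomial.monomial (Finsupp.equivFunOnFinite.symm x)
      (E.map fun p => extendZero x p.1 - extendZero x p.2).prod

/-- The last table entry is the value of the generating function at the weights. -/
theorem eval_genPoly {n q : ℕ} {d : ℕ → ℕ} {E : List (ℕ × ℕ)} (hE : ∀ p ∈ E, p.1 < n ∧ p.2 < n)
    (hd : ∀ w < n, deg E w = d w) (y : ℕ → ℤ) :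
    MvPolynomial.eval (fun w : Fin n => y w) (genPoly n q d E)
      = table n d (fun w => powerSum q (y w)) E 0 := by
  rw [table_zero hE hd, genPoly, map_sum]
  refine sum_congr rfl fun x _ => ?_
  rw [MvPolynomial.eval_monomial, mul_comm, Finsupp.prod_fintype _ _ (by simp)]
  simp

theorem coeff_genPoly {n q : ℕ} {d : ℕ → ℕ} {E : List (ℕ × ℕ)} {x : Fin n → ℕ}
    (hx : x ∈ Fintype.piFinset (fun w : Fin n => palette q d w)) :
    (genPoly n q d E).coeff (Finsupp.equivFunOnFinite.symm x)
      = (E.map fun p => extendZero x p.1 - extendZero x p.2).prod := by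
  classical
  rw [genPoly, MvPolynomial.coeff_sum, sum_eq_single_of_mem x hx]
  · simp
  · intro x' _ hne
    rw [MvPolynomial.coeff_monomial, if_neg]
    simpa using hne

theorem totalDegree_genPoly_le {n q : ℕ} (d : ℕ → ℕ) (E : List (ℕ × ℕ)) :
    (genPoly n q d E).totalDegree ≤ n * q := by
  refine MvPolynomial.totalDegree_finsetSum_le fun x hx => ?_
  refine (MvPolynomial.totalDegree_monomial_le _ _).trans ?_
  rw [Finsupp.sum_fintype _ _ (by simp)]
  calc ∑ i, Finsupp.equivFunOnFinite.symm x i ≤ ∑ _i : Fin n, q := sum_le_sum fun i _ => by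
        have := Fintype.mem_piFinset.1 hx i
        unfold palette at this
        split_ifs at this
        · simp at this; simp [this]
        · simp at this; simp; omega
    _ = n * q := by simp

variable {n : ℕ} {G : SimpleGraph (Fin n)}

/-- There are no false positives: if the sum is not `0`, then the graph polynomial does not vanish
at some `x`, which is a proper coloring. -/
theorem colorable_of_table_ne_zero {q : ℕ} (hq : 0 < q) (D : NicePathDecomposition G) (y : ℕ → ℤ)
    (h : table n (fun w => ∑ x ∈ range n, adjacency G w x) (fun w => powerSum q (y w))
      (edgeList D D.len) 0 ≠ 0) : G.Colorable q := by
  have hE : ∀ p ∈ edgeList D D.len, p.1 < n ∧ p.2 < n := fun p hp => by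
    obtain ⟨u, v, rfl, -⟩ := mem_edgeList le_rfl hp
    exact ⟨u.2, v.2⟩
  rw [table_zero hE (fun w hw => deg_edgeList_len D hw)] at h
  obtain ⟨x, hx, hne⟩ := exists_ne_zero_of_sum_ne_zero h
  have hxq : ∀ v, x v < q := fun v => by
    have := Fintype.mem_piFinset.1 hx v
    unfold palette at this
    split_ifs at this
    · simp at this; omega
    · simpa using this
  have hprod := right_ne_zero_of_mul hne
  have hmem : ∀ a b : Fin n, (a.val, b.val) ∈ edgeList D D.len → x a ≠ x b := by
    intro a b hab heq
    refine hprod (List.prod_eq_zero ?_)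
    exact List.mem_map.2 ⟨_, hab, by simp [extendZero, heq]⟩
  refine ⟨SimpleGraph.Coloring.mk (fun v => ⟨x v, hxq v⟩) fun {a b} hab heq => ?_⟩
  have heq' : x a = x b := by simpa using heq
  rcases (adj_iff_mem_edgeList D a b).2 hab with h' | h'
  · exact hmem a b h' heq'
  · exact hmem b a h' heq'.symm

/-- A proper coloring, changed to `0` at the isolated vertices, gives a nonzero coefficient. -/
theorem genPoly_ne_zero {q : ℕ} (D : NicePathDecomposition G) (hG : G.Colorable q) :
    genPoly n q (fun w => ∑ x ∈ range n, adjacency G w x) (edgeList D D.len) ≠ 0 := by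
  classical
  obtain ⟨φ⟩ := hG
  set x : Fin n → ℕ := fun v => if G.degree v = 0 then 0 else φ v with hx
  have hdeg : ∀ {a b}, G.Adj a b → x a = φ a := fun {a b} hab => by
    have : G.degree a ≠ 0 := fun h0 => by
      have hmem : b ∈ G.neighborFinset a := by simpa using hab
      have he : G.neighborFinset a = ∅ :=
        card_eq_zero.1 (by rw [SimpleGraph.card_neighborFinset_eq_degree, h0])
      simp [he] at hmem
    simp [hx, this]
  have hxS : x ∈ Fintype.piFinset
      (fun w : Fin n => palette q (fun w => ∑ x ∈ range n, adjacency G w x) w) := by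
    rw [Fintype.mem_piFinset]
    intro w
    simp only [palette, sum_adjacency, hx]
    split_ifs <;> simp
  intro h0
  have hc := coeff_genPoly (E := edgeList D D.len) hxS
  rw [h0, MvPolynomial.coeff_zero] at hc
  obtain ⟨p, hp, hp0⟩ := List.mem_map.1 (List.prod_eq_zero_iff.1 hc.symm)
  obtain ⟨u, v, rfl, hadj⟩ := mem_edgeList le_rfl hp
  simp only [extendZero, u.2, v.2, dif_pos, Fin.eta, hdeg hadj, hdeg hadj.symm] at hp0
  exact φ.valid hadj (Fin.ext (by omega))

/-! ### The probability of a wrong answer -/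

theorem ofBits_inj {f g : ℕ → Bool} {k : ℕ} (h : ofBits f k = ofBits g k) :
    ∀ i < k, f i = g i := by
  induction k with
  | zero => simp
  | succ k ih =>
    simp only [ofBits] at h
    have hk : f k = g k := by
      cases hf : f k <;> cases hg : g k <;> simp [hf, hg] at h ⊢ <;> omega
    rw [hk] at h
    intro i hi
    rcases Nat.lt_succ_iff_lt_or_eq.1 hi with hi | rfl
    · exact ih (by omega) i hi
    · exact hk

theorem coins_cylinder (k : ℕ) (ρ₀ : ℕ → Bool) :
    coins {ρ | ∀ i < k, ρ i = ρ₀ i} = (1 / 2 : ℝ≥0∞) ^ k := by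
  have h : {ρ : ℕ → Bool | ∀ i < k, ρ i = ρ₀ i}
      = ((range k : Finset ℕ) : Set ℕ).pi fun i => {ρ₀ i} := by
    ext ρ; simp [Set.mem_pi]
  rw [h, coins, Measure.infinitePi_pi _ (fun i _ => measurableSet_singleton _)]
  simp

/-- The weights determine the first `n * K` coins. -/
theorem coins_weight_le (n K : ℕ) (z : Fin n → ℤ) :
    coins {ρ | ∀ w : Fin n, (weight ρ K w : ℤ) = z w} ≤ (1 / 2 : ℝ≥0∞) ^ (n * K) := by
  by_cases h : ∃ ρ₀ : ℕ → Bool, ∀ w : Fin n, (weight ρ₀ K w : ℤ) = z w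
  · obtain ⟨ρ₀, h₀⟩ := h
    rw [← coins_cylinder (n * K) ρ₀]
    refine measure_mono fun ρ hρ i hi => ?_
    have hK : 0 < K := Nat.pos_of_ne_zero fun h => by simp [h] at hi
    have hw : i / K < n := Nat.div_lt_of_lt_mul (by rwa [mul_comm])
    have h1 := hρ ⟨i / K, hw⟩
    rw [← h₀ ⟨i / K, hw⟩, Nat.cast_inj] at h1
    have := ofBits_inj h1 (i % K) (Nat.mod_lt _ hK)
    have e : i / K * K + i % K = i := Nat.div_add_mod' i K
    simpa only [e] using this
  · have : {ρ : ℕ → Bool | ∀ w : Fin n, (weight ρ K w : ℤ) = z w} = ∅ :=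
      Set.eq_empty_iff_forall_notMem.2 fun ρ hρ => h ⟨ρ, hρ⟩
    rw [this]; simp

/-- By the Schwartz–Zippel lemma, the random weights are rarely a zero of a polynomial. -/
theorem coins_eval_eq_zero_le {n K δ : ℕ} {p : MvPolynomial (Fin n) ℤ} (hp : p ≠ 0)
    (hδ : p.totalDegree ≤ δ) :
    coins {ρ | MvPolynomial.eval (fun w : Fin n => (weight ρ K w : ℤ)) p = 0}
      ≤ δ * (1 / 2 : ℝ≥0∞) ^ K := by
  set S : Finset ℤ := (range (2 ^ K)).image fun a : ℕ => (a : ℤ) with hS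
  have hcard : S.card = 2 ^ K := by
    rw [hS, card_image_of_injective _ Nat.cast_injective, card_range]
  set Z := {f ∈ Fintype.piFinset fun _ : Fin n => S | MvPolynomial.eval f p = 0} with hZ
  have hsz : Z.card * 2 ^ K ≤ δ * (2 ^ K) ^ n := by
    have h := MvPolynomial.schwartz_zippel_totalDegree hp S
    rw [hcard, div_le_div_iff₀ (by positivity) (by positivity)] at h
    have h2 : Z.card * 2 ^ K ≤ p.totalDegree * (2 ^ K) ^ n := by exact_mod_cast h
    exact h2.trans (Nat.mul_le_mul_right _ hδ)
  have hsub : {ρ | MvPolynomial.eval (fun w : Fin n => (weight ρ K w : ℤ)) p = 0}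
      ⊆ ⋃ z ∈ Z, {ρ | ∀ w : Fin n, (weight ρ K w : ℤ) = z w} := by
    intro ρ hρ
    rw [Set.mem_iUnion₂]
    refine ⟨fun w => weight ρ K w, ?_, fun w => rfl⟩
    rw [hZ, mem_filter, Fintype.mem_piFinset]
    exact ⟨fun w => mem_image.2 ⟨_, mem_range.2 (ofBits_lt _ _), rfl⟩, hρ⟩
  calc _ ≤ ∑ z ∈ Z, coins {ρ | ∀ w : Fin n, (weight ρ K w : ℤ) = z w} :=
        (measure_mono hsub).trans (measure_biUnion_finset_le _ _)
    _ ≤ ∑ _z ∈ Z, (1 / 2 : ℝ≥0∞) ^ (n * K) := sum_le_sum fun z _ => coins_weight_le n K z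
    _ = Z.card * (1 / 2 : ℝ≥0∞) ^ (n * K) := by simp
    _ = (Z.card * 2 ^ K : ℕ) * (1 / 2 : ℝ≥0∞) ^ (n * K) * (1 / 2 : ℝ≥0∞) ^ K := by
        push_cast
        rw [mul_assoc, mul_assoc, mul_comm ((1 / 2 : ℝ≥0∞) ^ (n * K)), ← mul_assoc (2 ^ K),
          ← mul_pow, one_div, ENNReal.mul_inv_cancel (by simp) (by simp), one_pow, one_mul]
    _ ≤ (δ * (2 ^ K) ^ n : ℕ) * (1 / 2 : ℝ≥0∞) ^ (n * K) * (1 / 2 : ℝ≥0∞) ^ K := by gcongr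
    _ = _ := by
        push_cast
        rw [← pow_mul, mul_comm K n, mul_assoc (δ : ℝ≥0∞), ← mul_pow, one_div,
          ENNReal.mul_inv_cancel (by simp) (by simp), one_pow, mul_one]

/-- The degree in the Schwartz–Zippel bound is absorbed by the additional bits of the weights. -/
theorem mul_half_pow_le {δ M N c : ℕ} (hδ : δ ≤ M) (hN : N ≤ M) :
    (δ : ℝ≥0∞) * (1 / 2 : ℝ≥0∞) ^ (M ^ c + M) ≤ (1 / 2 : ℝ≥0∞) ^ (N ^ c) := by
  have h1 : (δ : ℝ≥0∞) ≤ 2 ^ M := by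
    have : δ ≤ 2 ^ M := hδ.trans Nat.lt_two_pow_self.le
    exact_mod_cast this
  calc (δ : ℝ≥0∞) * (1 / 2 : ℝ≥0∞) ^ (M ^ c + M)
      ≤ 2 ^ M * (1 / 2 : ℝ≥0∞) ^ (M ^ c + M) := by gcongr
    _ = (1 / 2 : ℝ≥0∞) ^ (M ^ c) := by
        rw [pow_add, mul_comm, mul_assoc, ← mul_pow, one_div,
          ENNReal.inv_mul_cancel (by simp) (by simp), one_pow, mul_one]
    _ ≤ _ := pow_le_pow_of_le_one (by simp) (by simp) (Nat.pow_le_pow_left hN c)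

end ColoringProgram

/-! ### The time and the error bound -/

namespace ColoringProgram

open RAM Finset ColoringTable

variable {n : ℕ} {G : SimpleGraph (Fin n)}

theorem start_reg (l : List ℕ) (r : ℕ) : (start l).reg r = 0 := rfl

theorem start_bank_of_ne (l : List ℕ) {a : ℕ} (ha : a ≠ 0) (i : ℤ) : (start l).bank a i = 0 := by
  simp [start, ha]

theorem start_bank_zero_zero (q : ℕ) (D : NicePathDecomposition G) :
    (start (encodeInput q G D)).bank 0 0 = n := by
  simp [start, encodeInput]

theorem start_bank_zero_one (q : ℕ) (D : NicePathDecomposition G) :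
    (start (encodeInput q G D)).bank 0 1 = q := by
  simp [start, encodeInput]

theorem one_le_inputSize (q : ℕ) (D : NicePathDecomposition G) :
    1 ≤ inputSize (encodeInput q G D) := by
  have := length_le_inputSize (encodeInput q G D)
  rw [length_encodeInput] at this
  omega

theorem bitBound_le (c q : ℕ) (D : NicePathDecomposition G) :
    bitBound c n D.len ≤ 2 * inputSize (encodeInput q G D) ^ (2 * c + 2) := by
  set N := inputSize (encodeInput q G D) with hN
  have h1 : 1 ≤ N := one_le_inputSize q D
  have hM := sizeBound_le q D
  have h2 : sizeBound n D.len ^ c ≤ N ^ (2 * c + 2) :=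
    calc sizeBound n D.len ^ c ≤ (N ^ 2) ^ c := Nat.pow_le_pow_left hM c
      _ = N ^ (2 * c) := (pow_mul N 2 c).symm
      _ ≤ _ := Nat.pow_le_pow_right h1 (by omega)
  have h3 : sizeBound n D.len ≤ N ^ (2 * c + 2) :=
    hM.trans (Nat.pow_le_pow_right h1 (by omega))
  unfold bitBound
  omega

/-- The factor of the running time that depends only on the exponent of the error bound. Here
`2688 = 21 * 2 ^ 7`, where `2` comes from `bitBound_le`, and `7 = 4 + 3` is the exponent of the bit
bound in the number of steps times the bit length. -/
def timeFactor (c : ℕ) : ℕ := 2688 * (c + 405) ^ 3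

/-- The exponent of the input size in the running time. -/
def timeExponent (c : ℕ) : ℕ := 14 * c + 14

theorem constant_time_le (c q : ℕ) (D : NicePathDecomposition G) {t m : ℕ} (hm : m ≤ 5)
    (ht : t ≤ m * stepCost (inputSize (encodeInput q G D)) (c + 400)) :
    t ≤ timeFactor c * inputSize (encodeInput q G D) ^ timeExponent c * D.tableSize := by
  set N := inputSize (encodeInput q G D) with hN
  have h1 : 1 ≤ N := one_le_inputSize q D
  have hNk : N ≤ N ^ timeExponent c := Nat.le_self_pow (by unfold timeExponent; omega) N
  calc t ≤ 5 * stepCost N (c + 400) := ht.trans (Nat.mul_le_mul_right _ hm)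
    _ ≤ 5 * ((c + 405) ^ 2 * (2 * N)) := by
        unfold stepCost; gcongr; omega
    _ = 10 * (c + 405) ^ 2 * N := by ring
    _ ≤ timeFactor c * N ^ timeExponent c := by
        refine Nat.mul_le_mul ?_ hNk
        exact Nat.mul_le_mul (by norm_num) (Nat.pow_le_pow_right (by omega) (by norm_num))
    _ ≤ _ := Nat.le_mul_of_pos_right _ (one_le_tableSize D)

theorem polynomial_time_le (c q : ℕ) (D : NicePathDecomposition G) {t : ℕ}
    (ht : t ≤ (1 + (1 + (1 + (1 + (c + 100) * bitBound c n D.len ^ 4 * D.tableSize))))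
      * stepCost (20 * bitBound c n D.len ^ 3) (c + 400)) :
    t ≤ timeFactor c * inputSize (encodeInput q G D) ^ timeExponent c * D.tableSize := by
  set N := inputSize (encodeInput q G D) with hN
  set K := bitBound c n D.len with hK
  set P := D.tableSize
  have hK1 : 1 ≤ K := by
    have : 1 ≤ sizeBound n D.len := Nat.mul_pos (by omega) (by omega)
    rw [hK]; unfold bitBound; omega
  have hP : 1 ≤ P := one_le_tableSize D
  have h1 : 1 ≤ K ^ 4 * P := Nat.mul_pos (Nat.pow_pos hK1) hP
  have h2 : 1 ≤ K ^ 3 := Nat.pow_pos hK1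
  have h3 : 1 + (1 + (1 + (1 + (c + 100) * K ^ 4 * P))) ≤ (c + 405) * (K ^ 4 * P) := by
    rw [mul_assoc (c + 100)]; nlinarith
  calc t ≤ ((c + 405) * (K ^ 4 * P)) * ((c + 405) ^ 2 * (21 * K ^ 3)) := by
        refine ht.trans (Nat.mul_le_mul h3 ?_)
        unfold stepCost
        exact Nat.mul_le_mul_left _ (by omega)
    _ = 21 * (c + 405) ^ 3 * K ^ 7 * P := by ring
    _ ≤ 21 * (c + 405) ^ 3 * (2 * N ^ (2 * c + 2)) ^ 7 * P := by
        gcongr; exact bitBound_le c q D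
    _ = _ := by
        rw [mul_pow, ← pow_mul, show (2 * c + 2) * 7 = timeExponent c by unfold timeExponent; ring]
        unfold timeFactor
        ring

theorem answers_of_runs {c m W Z : ℕ} {l : List ℕ} {ρ : ℕ → Bool} (b : Bool)
    (h : Runs ρ W Z (program c) (start l) m fun s => s.reg 0 = if b then 1 else 0) :
    ∃ t, Answers (program c) l ρ t b ∧ t ≤ m * stepCost W Z := by
  obtain ⟨t, s', hex, ht, -, hr⟩ := h
  exact ⟨t, ⟨s', hex, hr⟩, ht⟩

/-- The table entry from which the answer is read off: the values of the graph polynomial, summed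
over all assignments of colors, with random weights. -/
noncomputable def lastEntry (c q : ℕ) (D : NicePathDecomposition G) (ρ : ℕ → Bool) : ℤ :=
  table n (fun w => ∑ x ∈ range n, adjacency G w x)
    (fun w => powerSum q (weight ρ (bitBound c n D.len) w)) (edgeList D D.len) 0

theorem answers_of_lt (c : ℕ) {q : ℕ} (hq : 0 < q) (hqn : q < n) (D : NicePathDecomposition G)
    (ρ : ℕ → Bool) :
    ∃ t, Answers (program c) (encodeInput q G D) ρ t (decide (lastEntry c q D ρ ≠ 0)) ∧
      t ≤ timeFactor c * inputSize (encodeInput q G D) ^ timeExponent c * D.tableSize := by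
  have hW : inputSize (encodeInput q G D) ≤ 20 * bitBound c n D.len ^ 3 := by
    have h1 := inputSize_le_sizeBound hqn D
    have h2 : sizeBound n D.len ≤ bitBound c n D.len := Nat.le_add_left _ _
    have h3 : bitBound c n D.len ≤ bitBound c n D.len ^ 3 := Nat.le_self_pow (by norm_num) _
    omega
  have hlab : ∀ t : ℕ, t < 3 → ∀ j < D.len,
      (start (encodeInput q G D)).bank 0 (3 + n * n + j * (n + 3) + t) = label D t j :=
    fun t ht j hj => by
    have := start_bank_zero (encodeInput q G D) (3 + n * n + j * (n + 3) + t)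
    rw [encodeInput_label q D hj ht] at this
    exact_mod_cast this
  have h := program_spec (ρ := ρ) (c := c) (s := start (encodeInput q G D)) hq hqn
    (start_bounded hW)
    (start_bank_zero_zero q D)
    (start_bank_zero_one q D)
    (start_reg _) rfl (fun a ha => start_bank_of_ne _ ha)
    (adj := adjacency G) (kd := label D 0) (ku := label D 1) (kv := label D 2) (fun w hw x hx => by
      have := start_bank_zero (encodeInput q G D) (2 + w * n + x)
      rw [encodeInput_adjacency q D hw hx] at this
      exact_mod_cast this)
    (adjacency_le_one G)
    (by
      have := start_bank_zero (encodeInput q G D) (2 + n * n)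
      rw [encodeInput_len q D] at this
      exact_mod_cast this)
    (fun j hj => by simpa using hlab 0 (by omega) j hj)
    (fun j hj => by simpa using hlab 1 (by omega) j hj)
    (fun j hj => by simpa using hlab 2 (by omega) j hj)
    (fun j hj h2 => by
      obtain ⟨u, v, -, hu, hv, hadj⟩ := label_eq_two hj h2
      rw [hu, hv]
      exact ⟨u.2, v.2, fun he => hadj.ne (Fin.ext he)⟩)
    (fun w hw => (deg_edgeList_len D hw).le)
    (fun j hj => prod_radix_le_tableSize D hj)
  have h' := h.mono (Q' := fun s => s.reg 0 = if decide (lastEntry c q D ρ ≠ 0) then 1 else 0)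
    le_rfl fun s _ _ hs => by
      rw [hs]
      by_cases h0 : lastEntry c q D ρ = 0
      · refine (if_pos h0).trans ?_; simp [h0]
      · refine (if_neg h0).trans ?_; simp [h0]
  obtain ⟨t, hA, ht⟩ := answers_of_runs _ h'
  exact ⟨t, hA, polynomial_time_le c q D ht⟩

theorem coins_lastEntry_le (c : ℕ) {q : ℕ} (hqn : q < n)
    (D : NicePathDecomposition G) (hG : G.Colorable q) :
    coins {ρ | lastEntry c q D ρ = 0}
      ≤ (1 / 2 : ℝ≥0∞) ^ (inputSize (encodeInput q G D) ^ c) := by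
  have hE : ∀ p ∈ edgeList D D.len, p.1 < n ∧ p.2 < n := fun p hp => by
    obtain ⟨u, v, rfl, -⟩ := mem_edgeList le_rfl hp
    exact ⟨u.2, v.2⟩
  have hδ : n * q ≤ sizeBound n D.len :=
    calc n * q ≤ n * n := Nat.mul_le_mul_left _ hqn.le
      _ ≤ (3 + n * n + D.len * (n + 3)) * 1 := by omega
      _ ≤ _ := by rw [sizeBound]; exact Nat.mul_le_mul_left _ (by omega)
  have hsub : {ρ | lastEntry c q D ρ = 0} ⊆ {ρ | MvPolynomial.eval
      (fun w : Fin n => (weight ρ (bitBound c n D.len) w : ℤ))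
      (genPoly n q (fun w => ∑ x ∈ range n, adjacency G w x) (edgeList D D.len)) = 0} :=
    fun ρ (hρ : lastEntry c q D ρ = 0) => (eval_genPoly hE (fun w hw => deg_edgeList_len D hw)
      fun w => (weight ρ (bitBound c n D.len) w : ℤ)).trans hρ
  calc _ ≤ (n * q : ℕ) * (1 / 2 : ℝ≥0∞) ^ bitBound c n D.len :=
        (measure_mono hsub).trans
          (coins_eval_eq_zero_le (genPoly_ne_zero D hG) (totalDegree_genPoly_le _ _))
    _ ≤ _ := by
        rw [bitBound]
        exact mul_half_pow_le hδ (inputSize_le_sizeBound hqn D)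

/-- On every input the program halts in time, has no false positives, and is wrong only for the
coins of an unlikely set. -/
theorem exists_wrong_set (c q : ℕ) (D : NicePathDecomposition G) :
    ∃ S : Set (ℕ → Bool),
      coins S ≤ (1 / 2 : ℝ≥0∞) ^ (inputSize (encodeInput q G D) ^ c) ∧
      ∀ ρ, ∃ (t : ℕ) (b : Bool), Answers (program c) (encodeInput q G D) ρ t b ∧
        t ≤ timeFactor c * inputSize (encodeInput q G D) ^ timeExponent c * D.tableSize ∧
        (b = true → G.Colorable q) ∧ (ρ ∉ S → G.Colorable q → b = true) := by
  have h0 : (start (encodeInput q G D)).bank 0 0 = n := start_bank_zero_zero q D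
  have h1 : (start (encodeInput q G D)).bank 0 1 = q := start_bank_zero_one q D
  have hs : (start (encodeInput q G D)).Bounded (inputSize (encodeInput q G D)) :=
    start_bounded le_rfl
  rcases le_or_gt n q with hnq | hqn
  · refine ⟨∅, by simp, fun ρ => ?_⟩
    obtain ⟨t, hA, ht⟩ := answers_of_runs true
      ((program_spec_of_le (ρ := ρ) (c := c) hs (one_le_inputSize q D) h0 h1 hnq).mono le_rfl
        fun s _ _ hs => by simpa using hs)
    exact ⟨t, true, hA, constant_time_le c q D (by norm_num) ht,
      fun _ => G.colorable_of_fintype.mono (by simpa using hnq), fun _ _ => rfl⟩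
  · rcases Nat.eq_zero_or_pos q with rfl | hq
    · have hno : ¬ G.Colorable 0 := fun ⟨φ⟩ => (φ ⟨0, hqn⟩).elim0
      refine ⟨∅, by simp, fun ρ => ?_⟩
      obtain ⟨t, hA, ht⟩ := answers_of_runs false
        ((program_spec_of_zero (ρ := ρ) (c := c) hs h0 (by simpa using h1) hqn).mono le_rfl
          fun s _ _ hs => by simpa using hs)
      exact ⟨t, false, hA, constant_time_le c 0 D le_rfl ht, fun h => by simp at h,
        fun _ h => (hno h).elim⟩
    · by_cases hG : G.Colorable q
      · refine ⟨_, coins_lastEntry_le c hqn D hG, fun ρ => ?_⟩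
        obtain ⟨t, hA, ht⟩ := answers_of_lt c hq hqn D ρ
        exact ⟨t, _, hA, ht, fun _ => hG, fun h _ => by simpa using h⟩
      · refine ⟨∅, by simp, fun ρ => ?_⟩
        obtain ⟨t, hA, ht⟩ := answers_of_lt c hq hqn D ρ
        exact ⟨t, _, hA, ht, fun h => colorable_of_table_ne_zero hq D _ (of_decide_eq_true h),
          fun _ h => (hG h).elim⟩

end ColoringProgram

theorem theorem6 (c : ℕ) :
    ∃ (P : RAM.Program) (C k : ℕ),
      ∀ (n q : ℕ) (G : SimpleGraph (Fin n)) (D : NicePathDecomposition G),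
        (∀ ρ : ℕ → Bool, ∃ (t : ℕ) (b : Bool),
          RAM.Answers P (encodeInput q G D) ρ t b ∧
          t ≤ C * RAM.inputSize (encodeInput q G D) ^ k * D.tableSize ∧
          (b = true → G.Colorable q)) ∧
        RAM.coins {ρ | ¬ ∃ (t : ℕ) (b : Bool),
            RAM.Answers P (encodeInput q G D) ρ t b ∧ (b = true ↔ G.Colorable q)} ≤
          (1 / 2 : ℝ≥0∞) ^ (RAM.inputSize (encodeInput q G D) ^ c) := by
  refine ⟨ColoringProgram.program c, ColoringProgram.timeFactor c, ColoringProgram.timeExponent c,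
    fun n q G D => ?_⟩
  obtain ⟨S, hS, h⟩ := ColoringProgram.exists_wrong_set c q D
  refine ⟨fun ρ => ?_, (measure_mono fun ρ hρ => ?_).trans hS⟩
  · obtain ⟨t, b, hA, ht, hb, -⟩ := h ρ
    exact ⟨t, b, hA, ht, hb⟩
  · by_contra hρS
    obtain ⟨t, b, hA, -, hb, hb'⟩ := h ρ
    exact hρ ⟨t, b, hA, hb, hb' hρS⟩
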